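/- **Setting.** Let $(X_i,Y_i,S_i)_{i\ge1}$ be i.i.d. with $X_i=(x_{i1},\dots,x_{ip})^T\in\mathbb R^p$ and $Y_i,S_i\in\mathbb R$; $(X,Y,S)$ denotes a generic triple. For $k=1,2$ let $y\mapsto \exp(y\theta-b_k(\theta))\,c_k(y)$, $\theta\in\mathbb R$, be a family of probability densities with respect to some dominating measure. Given $X$, the response $Y$ has the density $\exp(y\,\beta_0^TX-b_1(\beta_0^TX))\,c_1(y)$ (canonical GLM, dispersion one). The working model for $S$ given $X$ is the GLM with $b_2,c_2$; it may be misspecified, and $\gamma_0$ denotes a parameter with $E[(b_2'(X^T\gamma_0)-S)X]=0$. Let $\mathcal A,\mathcal B\subset\mathbb R^p$ be compact, $\beta_0\in\mathcal B$, $\gamma_0\in\mathcal A$. For each $N$, let $\pi_i=\pi_{N,i}\in(0,1]$, $i\le N$, be functions of $(S_j,X_j)_{j\le N}$ with $\sum_{i\le N}\pi_i=n$, where $n=n_N$ is deterministic. Given $(X_j,Y_j,S_j)_{j\le N}$, the indicators $R_i=R_{N,i}$, $i\le N$, are independent Bernoulli$(\pi_i)$ variables. Put $$S^*_N(\beta)=\sum_{i=1}^N\frac{R_i}{\pi_i}(Y_i-b_1'(\beta^TX_i))X_i,\quad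 S^*_N(\gamma)=\sum_{i=1}^N\frac{R_i}{\pi_i}(S_i-b_2'(\gamma^TX_i))X_i,\quad S_N(\gamma)=\sum_{i=1}^N(S_i-b_2'(\gamma^TX_i))X_i .$$ Let $\hat\beta_n,\hat\gamma_n,\hat\gamma_N$ be random vectors which, with probability tending to one as $N\to\infty$, satisfy $\hat\beta_n\in\mathcal B$, $S^*_N(\hat\beta_n)=0$, $\hat\gamma_n\in\mathcal A$, $S^*_N(\hat\gamma_n)=0$, $\hat\gamma_N\in\mathcal A$, $S_N(\hat\gamma_N)=0$. With $I(\beta)=-E[b_1''(X^T\beta)XX^T]$ and $I(\gamma)=-E[b_2''(X^T\gamma)XX^T]$, the blocks of the asymptotic covariance matrix of $n^{1/2}(\hat\beta_n-\beta_0,\hat\gamma_n-\hat\gamma_N)$ are $$\Sigma_{12}=\lim_{N\to\infty}\tfrac n{N^2}I(\beta_0)^{-1}\operatorname{Cov}\big(S^*_N(\beta_0),S^*_N(\gamma_0)-S_N(\gamma_0)\big)I(\gamma_0)^{-1},$$ $$\Sigma_{22}=\lim_{N\to\infty}\tfrac n{N^2}I(\gamma_0)^{-1}\operatorname{Cov}\big(S^*_N(\gamma_0)-S_N(\gamma_0)\big)I(\gamma_0)^{-1}.$$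 Their empirical estimates $\hat\Sigma_{12},\hat\Sigma_{22}$ are $$\tfrac n{N^2}\hat I_1^{-1}\sum_{i\le N}\hat u_i\hat v_i^T\,\hat I_2^{-1},\qquad \tfrac n{N^2}\hat I_2^{-1}\sum_{i\le N}\hat v_i\hat v_i^T\,\hat I_2^{-1},$$ where $\hat u_i=\frac{R_i}{\pi_i}(Y_i-b_1'(\hat\beta_n^TX_i))X_i$, $\hat v_i=\big(\frac{R_i}{\pi_i}-1\big)(S_i-b_2'(\hat\gamma_n^TX_i))X_i$, $\hat I_1=-\frac1N\sum_{i\le N}b_1''(\hat\beta_n^TX_i)X_iX_i^T$, $\hat I_2=-\frac1N\sum_{i\le N}b_2''(\hat\gamma_n^TX_i)X_iX_i^T$. **Theorem 1.** Assume: 1. either $b_1''$ and $b_2''$ are bounded, or $X$ is almost surely bounded; 2. $E[XX^T]$ is finite, $g_1(\beta)=E[\{b_1'(X^T\beta)-Y\}X]$ is finite for every $\beta\in\mathcal B$ and $g_2(\gamma)=E[\{b_2'(X^T\gamma)-S\}X]$ is finite for every $\gamma\in\mathcal A$; 3. for the normalized sampling weights $\pi_i/n$ (which have sum one), all $1\le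 j\le p$, all $\beta\in\mathcal B$ and all $\gamma\in\mathcal A$, as $N\to\infty$, $$\sum_{i=1}^NE\Big[\frac{\{b_1'(X_i^T\beta)-Y_i\}^2}{\pi_i/n}x_{ij}^2\Big]=o(N^2n),\qquad \sum_{i=1}^NE\Big[\frac{\{b_2'(X_i^T\gamma)-S_i\}^2}{\pi_i/n}x_{ij}^2\Big]=o(N^2n);$$ 4. for every $\epsilon>0$, $\inf\{\|g_1(\beta)\|:\beta\in\mathcal B,\|\beta-\beta_0\|\ge\epsilon\}>0$ and $\inf\{\|g_2(\gamma)\|:\gamma\in\mathcal A,\|\gamma-\gamma_0\|\ge\epsilon\}>0$; 5. the limits $\Sigma_{12}$ and $\Sigma_{22}$ exist and are finite, and $\Sigma_{22}$ is positive definite; 6. $E\|X\|^4<\infty$. Then the augmented estimator $\hat\beta_A=\hat\beta_n-\hat\Sigma_{12}\hat\Sigma_{22}^{-1}(\hat\gamma_n-\hat\gamma_N)$ converges to $\beta_0$ in probability as $N\to\infty$, in each of the following cases: (a) $\hat\Sigma_{12},\hat\Sigma_{22}$ are the empirical estimates above, $\beta_0$ and $\gamma_0$ are interior points of $\mathcal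 B$ and $\mathcal A$, and $n/N\to0$; (b) $\hat\Sigma_{12},\hat\Sigma_{22}$ are any other estimates of $\Sigma_{12},\Sigma_{22}$ that are consistent, i.e. converge to them in probability. -/

import Mathlib

open MeasureTheory ProbabilityTheory Filter Topology Asymptotics Matrix

noncomputable section

namespace SurrogateGLM

/-- Covariate and parameter space: `ℝᵖ` with its Euclidean norm. -/
abbrev Vec (p : ℕ) : Type := EuclideanSpace ℝ (Fin p)

/-- `y ↦ exp (y θ - b θ) c y`, `θ ∈ ℝ`, is a family of probability densities with respect to `ν`:
the one-parameter exponential family (dispersion one) with cumulant function `b`. -/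
structure IsCanonicalFamily (ν : Measure ℝ) (b c : ℝ → ℝ) : Prop where
  measurable : Measurable c
  nonneg : ∀ y, 0 ≤ c y
  lintegral_eq_one :
    ∀ θ : ℝ, ∫⁻ y, ENNReal.ofReal (Real.exp (y * θ - b θ) * c y) ∂ν = 1

variable {Ω : Type*} [MeasurableSpace Ω] {p : ℕ}

/-- Given `X`, the variable `Y` follows the generalized linear model with canonical link and
parameter `β`: its conditional density is `exp (y βᵀx - b (βᵀx)) c y` with respect to `ν`. -/
def FollowsGLM (P : Measure Ω) [IsFiniteMeasure P] (ν : Measure ℝ) (b c : ℝ → ℝ) (β : Vec p)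
    (X : Ω → Vec p) (Y : Ω → ℝ) : Prop :=
  ∀ᵐ x ∂(P.map X), condDistrib Y X P x =
    ν.withDensity fun y =>
      ENNReal.ofReal (Real.exp (y * inner ℝ β x - b (inner ℝ β x)) * c y)

/-- The triples `(Xᵢ, Yᵢ, Sᵢ)`, `i ∈ ℕ`, are independent and identically distributed. -/
structure IsIIDSample (P : Measure Ω) (X : ℕ → Ω → Vec p) (Y S : ℕ → Ω → ℝ) : Prop where
  measurable_X : ∀ i, Measurable (X i)
  measurable_Y : ∀ i, Measurable (Y i)
  measurable_S : ∀ i, Measurable (S i)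
  indep : iIndepFun (fun i ω => (X i ω, Y i ω, S i ω)) P
  identDistrib : ∀ i, IdentDistrib (fun ω => (X i ω, Y i ω, S i ω))
    (fun ω => (X 0 ω, Y 0 ω, S 0 ω)) P P

/-- Response-free Poisson sampling with expected subsample size `n N`. For each `N`, the inclusion
probabilities `π N i` are functions of the surrogates and covariates of the `N` units, they lie in
`(0, 1]` and add up to `n N`; given all the data of the `N` units, the inclusion indicators `R N i`
are independent Bernoulli variables with success probabilities `π N i`. -/
structure IsPoissonSampling (P : Measure Ω) (X : ℕ → Ω → Vec p) (Y S : ℕ → Ω → ℝ) (n : ℕ → ℝ)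
    (π : (N : ℕ) → Fin N → Ω → ℝ) (R : (N : ℕ) → Fin N → Ω → Bool) : Prop where
  measurable_R : ∀ N i, Measurable (R N i)
  measurable_π : ∀ N i, Measurable[MeasurableSpace.comap
    (fun ω (j : Fin N) => (S j ω, X j ω)) inferInstance] (π N i)
  pos : ∀ N i, ∀ᵐ ω ∂P, 0 < π N i ω
  le_one : ∀ N i, ∀ᵐ ω ∂P, π N i ω ≤ 1
  sum_eq : ∀ N, ∀ᵐ ω ∂P, ∑ i, π N i ω = n N
  cond_law : ∀ (N : ℕ) (r : Fin N → Bool),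
    P[({ω | ∀ i, R N i ω = r i}.indicator fun _ => (1 : ℝ)) |
        MeasurableSpace.comap (fun ω (j : Fin N) => (X j ω, Y j ω, S j ω)) inferInstance]
      =ᵐ[P] fun ω => ∏ i, (if r i then π N i ω else 1 - π N i ω)

/-- The inverse-probability weight `Rᵢ / πᵢ`. -/
def ipw (π : (N : ℕ) → Fin N → Ω → ℝ) (R : (N : ℕ) → Fin N → Ω → Bool)
    (N : ℕ) (i : Fin N) (ω : Ω) : ℝ :=
  (if R N i ω then 1 else 0) / π N i ω

/-- The score contribution `(z - b' (θᵀx)) x` of a unit with outcome `z` and covariates `x`. -/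
def scoreTerm (b : ℝ → ℝ) (θ x : Vec p) (z : ℝ) : Vec p :=
  (z - deriv b (inner ℝ θ x)) • x

/-- The full-data score `∑_{i ≤ N} (Zᵢ - b' (θᵀXᵢ)) Xᵢ`. -/
def fullScore (b : ℝ → ℝ) (X : ℕ → Ω → Vec p) (Z : ℕ → Ω → ℝ)
    (N : ℕ) (θ : Vec p) (ω : Ω) : Vec p :=
  ∑ i : Fin N, scoreTerm b θ (X i ω) (Z i ω)

/-- The re-weighted score `∑_{i ≤ N} (Rᵢ / πᵢ) (Zᵢ - b' (θᵀXᵢ)) Xᵢ`. -/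
def weightedScore (b : ℝ → ℝ) (X : ℕ → Ω → Vec p) (Z : ℕ → Ω → ℝ)
    (π : (N : ℕ) → Fin N → Ω → ℝ) (R : (N : ℕ) → Fin N → Ω → Bool)
    (N : ℕ) (θ : Vec p) (ω : Ω) : Vec p :=
  ∑ i : Fin N, ipw π R N i ω • scoreTerm b θ (X i ω) (Z i ω)

/-- The population function `θ ↦ E[(b' (Xᵀθ) - Z) X]`. -/
def popScore (P : Measure Ω) (b : ℝ → ℝ) (X : Ω → Vec p) (Z : Ω → ℝ) (θ : Vec p) : Vec p :=
  ∫ ω, (deriv b (inner ℝ θ (X ω)) - Z ω) • X ω ∂P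

/-- `θ₀` is the well-separated zero of `g` on `K`. -/
def WellSeparated (g : Vec p → Vec p) (θ₀ : Vec p) (K : Set (Vec p)) : Prop :=
  ∀ ε > 0, ∃ δ > 0, ∀ θ ∈ K, ε ≤ ‖θ - θ₀‖ → δ ≤ ‖g θ‖

/-- The weighted second moments
`∑_{i ≤ N} E[(b' (Xᵢᵀθ) - Zᵢ)² / (πᵢ / n) * xᵢⱼ²]` are finite and `o(N² n)`, for `θ ∈ K` and every
coordinate `j`. The numbers `πᵢ / n` are the sampling weights normalized to have sum one. -/
def WeightedMoments (P : Measure Ω) (b : ℝ → ℝ) (X : ℕ → Ω → Vec p) (Z : ℕ → Ω → ℝ) (n : ℕ → ℝ)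
    (π : (N : ℕ) → Fin N → Ω → ℝ) (K : Set (Vec p)) : Prop :=
  ∀ θ ∈ K, ∀ j : Fin p,
    (∀ᶠ N in atTop, ∀ i : Fin N, Integrable (fun ω =>
      (deriv b (inner ℝ θ (X i ω)) - Z i ω) ^ 2 / (π N i ω / n N) * X i ω j ^ 2) P) ∧
    (fun N => ∑ i : Fin N, ∫ ω,
      (deriv b (inner ℝ θ (X i ω)) - Z i ω) ^ 2 / (π N i ω / n N) * X i ω j ^ 2 ∂P)
        =o[atTop] fun N : ℕ => (N : ℝ) ^ 2 * n N

/-- `θhat` is a sequence of random vectors which, with probability tending to one, lie in `K` and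
solve the estimating equation `Ψ N θ ω = 0`. -/
def IsEstimator (P : Measure Ω) (Ψ : ℕ → Vec p → Ω → Vec p) (K : Set (Vec p))
    (θhat : ℕ → Ω → Vec p) : Prop :=
  (∀ N, Measurable (θhat N)) ∧
    Tendsto (fun N => P {ω | θhat N ω ∈ K ∧ Ψ N (θhat N ω) ω = 0}ᶜ) atTop (𝓝 0)

/-- The matrix `I(θ) = -E[b'' (Xᵀθ) X Xᵀ]`. -/
def info (P : Measure Ω) (b : ℝ → ℝ) (X : Ω → Vec p) (θ : Vec p) : Matrix (Fin p) (Fin p) ℝ :=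
  Matrix.of fun j k => -∫ ω, deriv (deriv b) (inner ℝ θ (X ω)) * (X ω j * X ω k) ∂P

/-- The cross-covariance matrix of two random vectors. -/
def crossCov (P : Measure Ω) (U V : Ω → Vec p) : Matrix (Fin p) (Fin p) ℝ :=
  Matrix.of fun j k => cov[fun ω => U ω j, fun ω => V ω k; P]

/-- The covariance block of `n^{1/2} (β̂ₙ - β, γ̂ₙ - γ̂_N)`, in its linearized form, that belongs to
the pair `(β̂ₙ, γ̂ₙ - γ̂_N)`:
`(n / N²) I(β)⁻¹ Cov(S*_N(β), S*_N(γ) - S_N(γ)) I(γ)⁻¹`. -/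
def sigma12 (P : Measure Ω) (b₁ b₂ : ℝ → ℝ) (X : ℕ → Ω → Vec p) (Y S : ℕ → Ω → ℝ) (n : ℕ → ℝ)
    (π : (N : ℕ) → Fin N → Ω → ℝ) (R : (N : ℕ) → Fin N → Ω → Bool) (β γ : Vec p) (N : ℕ) :
    Matrix (Fin p) (Fin p) ℝ :=
  (n N / (N : ℝ) ^ 2) • ((info P b₁ (X 0) β)⁻¹ *
    crossCov P (weightedScore b₁ X Y π R N β)
      (fun ω => weightedScore b₂ X S π R N γ ω - fullScore b₂ X S N γ ω) *
    (info P b₂ (X 0) γ)⁻¹)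

/-- The covariance block that belongs to `γ̂ₙ - γ̂_N`:
`(n / N²) I(γ)⁻¹ Cov(S*_N(γ) - S_N(γ), S*_N(γ) - S_N(γ)) I(γ)⁻¹`. -/
def sigma22 (P : Measure Ω) (b₂ : ℝ → ℝ) (X : ℕ → Ω → Vec p) (S : ℕ → Ω → ℝ) (n : ℕ → ℝ)
    (π : (N : ℕ) → Fin N → Ω → ℝ) (R : (N : ℕ) → Fin N → Ω → Bool) (γ : Vec p) (N : ℕ) :
    Matrix (Fin p) (Fin p) ℝ :=
  (n N / (N : ℝ) ^ 2) • ((info P b₂ (X 0) γ)⁻¹ *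
    crossCov P (fun ω => weightedScore b₂ X S π R N γ ω - fullScore b₂ X S N γ ω)
      (fun ω => weightedScore b₂ X S π R N γ ω - fullScore b₂ X S N γ ω) *
    (info P b₂ (X 0) γ)⁻¹)

/-- The empirical version of `info`: `-(1 / N) ∑_{i ≤ N} b'' (Xᵢᵀθ) Xᵢ Xᵢᵀ`. -/
def empInfo (b : ℝ → ℝ) (X : ℕ → Ω → Vec p) (N : ℕ) (θ : Vec p) (ω : Ω) :
    Matrix (Fin p) (Fin p) ℝ :=
  Matrix.of fun j k =>
    -((N : ℝ)⁻¹ * ∑ i : Fin N, deriv (deriv b) (inner ℝ θ (X i ω)) * (X i ω j * X i ω k))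

/-- The empirical estimate of `sigma12`: the covariance of the score sums is replaced by the sum of
the products of their estimated summands. -/
def empSigma12 (b₁ b₂ : ℝ → ℝ) (X : ℕ → Ω → Vec p) (Y S : ℕ → Ω → ℝ) (n : ℕ → ℝ)
    (π : (N : ℕ) → Fin N → Ω → ℝ) (R : (N : ℕ) → Fin N → Ω → Bool)
    (βhat γhat : ℕ → Ω → Vec p) (N : ℕ) (ω : Ω) : Matrix (Fin p) (Fin p) ℝ :=
  (n N / (N : ℝ) ^ 2) • ((empInfo b₁ X N (βhat N ω) ω)⁻¹ *
    (∑ i : Fin N, Matrix.vecMulVec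
      (ipw π R N i ω • scoreTerm b₁ (βhat N ω) (X i ω) (Y i ω)).ofLp
      ((ipw π R N i ω - 1) • scoreTerm b₂ (γhat N ω) (X i ω) (S i ω)).ofLp) *
    (empInfo b₂ X N (γhat N ω) ω)⁻¹)

/-- The empirical estimate of `sigma22`. -/
def empSigma22 (b₂ : ℝ → ℝ) (X : ℕ → Ω → Vec p) (S : ℕ → Ω → ℝ) (n : ℕ → ℝ)
    (π : (N : ℕ) → Fin N → Ω → ℝ) (R : (N : ℕ) → Fin N → Ω → Bool)
    (γhat : ℕ → Ω → Vec p) (N : ℕ) (ω : Ω) : Matrix (Fin p) (Fin p) ℝ :=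
  (n N / (N : ℝ) ^ 2) • ((empInfo b₂ X N (γhat N ω) ω)⁻¹ *
    (∑ i : Fin N, Matrix.vecMulVec
      ((ipw π R N i ω - 1) • scoreTerm b₂ (γhat N ω) (X i ω) (S i ω)).ofLp
      ((ipw π R N i ω - 1) • scoreTerm b₂ (γhat N ω) (X i ω) (S i ω)).ofLp) *
    (empInfo b₂ X N (γhat N ω) ω)⁻¹)

/-- Entrywise convergence in probability of random matrices to a fixed matrix. -/
def ConsistentFor (P : Measure Ω) (Mhat : ℕ → Ω → Matrix (Fin p) (Fin p) ℝ)
    (M : Matrix (Fin p) (Fin p) ℝ) : Prop :=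
  ∀ j k, TendstoInMeasure P (fun N ω => Mhat N ω j k) atTop fun _ => M j k

/-- The augmented estimator `β̂ₙ - Σ̂₁₂ Σ̂₂₂⁻¹ (γ̂ₙ - γ̂_N)`. -/
def augmented (βhat γhat γfull : ℕ → Ω → Vec p) (M₁₂ M₂₂ : ℕ → Ω → Matrix (Fin p) (Fin p) ℝ)
    (N : ℕ) (ω : Ω) : Vec p :=
  βhat N ω - WithLp.toLp 2 ((M₁₂ N ω * (M₂₂ N ω)⁻¹) *ᵥ (γhat N ω - γfull N ω).ofLp)

end SurrogateGLM

end

open SurrogateGLM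

/-!
The augmented estimator is `β̂ₙ` minus a correction, so the two things to show are that `β̂ₙ` is
consistent and that the correction `Σ̂₁₂ Σ̂₂₂⁻¹ (γ̂ₙ - γ̂_N)` vanishes in probability.

*Consistency.* Given the data, the weighted score minus the full-data score is a sum of
independent centred terms whose variance is `o(N²)` by the moment condition, so the weighted
mean score converges pointwise to minus the population score (`tendsto_wmean_ipw`). The
curvature bound makes the mean score Lipschitz in the parameter with a tight constant, the
convergence is therefore uniform on the compact parameter set, and the zeros of the mean score
approach the well-separated zero of the population score (`tendsto_of_wellSeparated`). The same
argument with unit weights covers `γ̂_N`. With consistent estimates of the covariance blocks the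
correction then vanishes by continuity of the matrix inverse.

*Empirical covariance estimates.* The argument does not pass through consistency of these
estimates; it uses that the coefficient `Σ̂₁₂ Σ̂₂₂⁻¹` is, up to information matrices, the least
squares coefficient of the estimated score contributions `ûᵢ` on the `v̂ᵢ`. By Cauchy-Schwarz
(`dotProduct_regression_le`) the correction is at most a constant times
`(∑ ‖ûᵢ‖²)^{1/2} ‖γ̂ₙ - γ̂_N‖ / λ^{1/2}`, where `λ` is the least eigenvalue of `∑ v̂ᵢ v̂ᵢᵀ`. Three bounds finish the
proof:

* `∑ ‖ûᵢ‖² = o_p(N²)`, because `b₁'` is monotone and so the squared scores near the interior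
  point `β₀` are dominated by those at the vertices of a cube, to which the moment condition
  applies (`tendsto_sum_norm_sq_scoreTerm`);
* `λ` is at least of the order `N² / n`, by Cauchy-Schwarz over the about `n` sampled units,
  where `n / N → 0` makes `Rᵢ / πᵢ - 1` as good as `Rᵢ / πᵢ`
  (`exists_quadratic_le_card_mul_sum`);
* `‖γ̂ₙ - γ̂_N‖ = O_p(n^{-1/2})`, because the sampling error of the score at `γ₀` is
  `O_p(N n^{-1/2})` by the convergence of its covariance, and the weighted scores have curvature of
  order `N` (`bddInProb_mul_norm_sub_full_sq`). The law of large numbers for that curvature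
  again comes from the moment condition, as differences of scores dominate `h(X) X Xᵀ` for a
  positive function `h`.

Invertibility of the information matrices is not assumed. It holds because the population score
cannot be constant along a line through a well-separated interior zero, and because `b''` is the
variance of an exponential family and so has no zero unless it vanishes identically.
-/

open SurrogateGLM

/-! ### Convergence and boundedness in probability -/

section InProbability

variable {Ω : Type*} [MeasurableSpace Ω] {P : Measure Ω}

/-- The filter of the events that hold with probability tending to one: a set `E ⊆ ℕ × Ω`, seen as
a sequence of events `E_N = {ω | (N, ω) ∈ E}`, belongs to it when the outer measure of the
complement of `E_N` tends to zero. Convergence in probability is convergence along this filter, so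
that the continuous mapping theorem comes for free. -/
def whp (P : Measure Ω) : Filter (ℕ × Ω) where
  sets := {E | Tendsto (fun N => P {ω | (N, ω) ∉ E}) atTop (𝓝 0)}
  univ_sets := by simp
  sets_of_superset := by
    intro E F hE hEF
    refine tendsto_of_tendsto_of_tendsto_of_le_of_le tendsto_const_nhds hE (fun _ => zero_le) ?_
    intro N
    exact measure_mono fun ω hω h => hω (hEF h)
  inter_sets := by
    intro E F hE hF
    have h := Tendsto.add hE hF
    rw [add_zero] at h
    refine tendsto_of_tendsto_of_tendsto_of_le_of_le tendsto_const_nhds h (fun _ => zero_le) ?_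
    intro N
    refine (measure_mono ?_).trans (measure_union_le _ _)
    intro ω hω
    simp only [Set.mem_ofPred_eq, Set.mem_inter_iff, Set.mem_union] at *
    tauto

lemma eventually_whp_iff {p : ℕ × Ω → Prop} :
    (∀ᶠ q in whp P, p q) ↔ Tendsto (fun N => P {ω | ¬ p (N, ω)}) atTop (𝓝 0) := Iff.rfl

lemma eventually_whp_of_ae {p : ℕ × Ω → Prop} (h : ∀ᶠ N in atTop, ∀ᵐ ω ∂P, p (N, ω)) :
    ∀ᶠ q in whp P, p q := by
  rw [eventually_whp_iff]
  refine tendsto_const_nhds.congr' ?_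
  filter_upwards [h] with N hN
  exact (ae_iff.1 hN).symm

lemma tendsto_fst_whp : Tendsto Prod.fst (whp P) atTop := by
  intro s hs
  have hs' : ∀ᶠ N in atTop, N ∈ s := hs
  exact eventually_whp_of_ae (hs'.mono fun N hN => Eventually.of_forall fun ω => hN)

lemma eventually_whp_of_measure_le {p : ℕ × Ω → Prop}
    (h : ∀ η : ENNReal, 0 < η → ∀ᶠ N in atTop, P {ω | ¬ p (N, ω)} ≤ η) : ∀ᶠ q in whp P, p q := by
  rw [eventually_whp_iff, ENNReal.tendsto_nhds_zero]
  exact h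

lemma Filter.Eventually.measure_not_le {p : ℕ × Ω → Prop} (h : ∀ᶠ q in whp P, p q) {η : ENNReal}
    (hη : 0 < η) : ∀ᶠ N in atTop, P {ω | ¬ p (N, ω)} ≤ η :=
  ENNReal.tendsto_nhds_zero.1 (eventually_whp_iff.1 h) η hη

instance [NeZero P] : (whp P).NeBot := by
  refine ⟨fun h => ?_⟩
  have h1 : ∀ᶠ q in whp P, False := by rw [h]; trivial
  rw [eventually_whp_iff] at h1
  simp only [not_false_eq_true, Set.ofPred_true] at h1
  have := tendsto_nhds_unique h1 tendsto_const_nhds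
  exact NeZero.ne P (Measure.measure_univ_eq_zero.1 this.symm)

lemma tendstoInMeasure_iff_whp {E : Type*} [SeminormedAddCommGroup E] {f : ℕ → Ω → E} {c : E} :
    TendstoInMeasure P f atTop (fun _ => c) ↔
      Tendsto (fun q : ℕ × Ω => f q.1 q.2) (whp P) (𝓝 c) := by
  rw [tendstoInMeasure_iff_dist, Metric.tendsto_nhds]
  refine forall₂_congr fun ε hε => ?_
  rw [eventually_whp_iff]
  simp only [not_lt]

/-- A sequence of random variables is bounded in probability (tight). -/
def BddInProb (P : Measure Ω) (f : ℕ × Ω → ℝ) : Prop :=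
  ∀ η : ENNReal, 0 < η → ∃ C : ℝ, 0 < C ∧ ∀ᶠ N in atTop, P {ω | ¬ |f (N, ω)| ≤ C} ≤ η

namespace BddInProb

variable {f g h : ℕ × Ω → ℝ}

lemma mono (hf : BddInProb P f) (h : ∀ᶠ q in whp P, |g q| ≤ |f q|) : BddInProb P g := by
  intro η hη
  have hη2 : 0 < η / 2 := ENNReal.half_pos hη.ne'
  obtain ⟨C, hC, h1⟩ := hf (η / 2) hη2
  refine ⟨C, hC, ?_⟩
  filter_upwards [h1, h.measure_not_le hη2] with N h1 h2
  calc P {ω | ¬ |g (N, ω)| ≤ C}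
      ≤ P ({ω | ¬ |f (N, ω)| ≤ C} ∪ {ω | ¬ |g (N, ω)| ≤ |f (N, ω)|}) := by
        refine measure_mono fun ω hω => ?_
        simp only [Set.mem_ofPred_eq, Set.mem_union] at *
        by_contra hcon
        push Not at hcon
        exact hω (hcon.2.trans hcon.1)
    _ ≤ η / 2 + η / 2 := (measure_union_le _ _).trans (add_le_add h1 h2)
    _ = η := ENNReal.add_halves η

lemma combine (hf : BddInProb P f) (hg : BddInProb P g)
    (hh : ∀ C D : ℝ, 0 < C → 0 < D → ∃ B : ℝ, 0 < B ∧ ∀ q, |f q| ≤ C → |g q| ≤ D → |h q| ≤ B) :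
    BddInProb P h := by
  intro η hη
  have hη2 : 0 < η / 2 := ENNReal.half_pos hη.ne'
  obtain ⟨C, hC, h1⟩ := hf (η / 2) hη2
  obtain ⟨D, hD, h2⟩ := hg (η / 2) hη2
  obtain ⟨B, hB, h3⟩ := hh C D hC hD
  refine ⟨B, hB, ?_⟩
  filter_upwards [h1, h2] with N h1 h2
  calc P {ω | ¬ |h (N, ω)| ≤ B}
      ≤ P ({ω | ¬ |f (N, ω)| ≤ C} ∪ {ω | ¬ |g (N, ω)| ≤ D}) := by
        refine measure_mono fun ω hω => ?_
        simp only [Set.mem_ofPred_eq, Set.mem_union] at *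
        by_contra hcon
        push Not at hcon
        exact hω (h3 _ hcon.1 hcon.2)
    _ ≤ η / 2 + η / 2 := (measure_union_le _ _).trans (add_le_add h1 h2)
    _ = η := ENNReal.add_halves η

lemma add (hf : BddInProb P f) (hg : BddInProb P g) : BddInProb P (fun q => f q + g q) :=
  hf.combine hg fun C D hC hD => ⟨C + D, by positivity, fun q h1 h2 =>
    (abs_add_le _ _).trans (add_le_add h1 h2)⟩

lemma mul (hf : BddInProb P f) (hg : BddInProb P g) : BddInProb P (fun q => f q * g q) :=
  hf.combine hg fun C D hC hD => ⟨C * D, by positivity, fun q h1 h2 => by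
    rw [abs_mul]; exact mul_le_mul h1 h2 (abs_nonneg _) hC.le⟩

lemma const (c : ℝ) : BddInProb P (fun _ => c) := by
  intro η hη
  refine ⟨|c| + 1, by positivity, Eventually.of_forall fun N => ?_⟩
  simp [show |c| ≤ |c| + 1 by linarith]

lemma sum {ι : Type*} (s : Finset ι) {f : ι → ℕ × Ω → ℝ} (hf : ∀ i ∈ s, BddInProb P (f i)) :
    BddInProb P (fun q => ∑ i ∈ s, f i q) := by
  classical
  induction s using Finset.induction_on with
  | empty => simpa using const (P := P) 0
  | insert a s ha ih =>
    simp only [Finset.sum_insert ha]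
    exact (hf a (by simp)).add (ih fun i hi => hf i (by simp [hi]))

lemma of_tendsto {c : ℝ} (hf : Tendsto f (whp P) (𝓝 c)) : BddInProb P f := by
  refine (const (|c| + 1)).mono ?_
  have h := hf.abs.eventually (gt_mem_nhds (show |c| < |c| + 1 by linarith))
  filter_upwards [h] with q hq
  rw [abs_of_nonneg (by positivity : (0 : ℝ) ≤ |c| + 1)]
  exact hq.le

/-- `O_p(1) · o_p(1) = o_p(1)`. -/
lemma mul_tendsto_zero (hf : BddInProb P f) (hg : Tendsto g (whp P) (𝓝 0)) :
    Tendsto (fun q => f q * g q) (whp P) (𝓝 0) := by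
  rw [Metric.tendsto_nhds]
  intro ε hε
  refine eventually_whp_of_measure_le fun η hη => ?_
  have hη2 : 0 < η / 2 := ENNReal.half_pos hη.ne'
  obtain ⟨C, hC, h1⟩ := hf (η / 2) hη2
  have h2 := ((Metric.tendsto_nhds.1 hg) (ε / C) (by positivity)).measure_not_le hη2
  filter_upwards [h1, h2] with N h1 h2
  calc P {ω | ¬ dist (f (N, ω) * g (N, ω)) 0 < ε}
      ≤ P ({ω | ¬ |f (N, ω)| ≤ C} ∪ {ω | ¬ dist (g (N, ω)) 0 < ε / C}) := by
        refine measure_mono fun ω hω => ?_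
        simp only [Set.mem_ofPred_eq, Set.mem_union, Real.dist_eq, sub_zero] at *
        by_contra hcon
        push Not at hcon
        refine hω ?_
        rw [abs_mul]
        calc |f (N, ω)| * |g (N, ω)| ≤ C * |g (N, ω)| :=
              mul_le_mul_of_nonneg_right hcon.1 (abs_nonneg _)
          _ < C * (ε / C) := mul_lt_mul_of_pos_left hcon.2 hC
          _ = ε := by field_simp
    _ ≤ η / 2 + η / 2 := (measure_union_le _ _).trans (add_le_add h1 h2)
    _ = η := ENNReal.add_halves η

/-- Markov's inequality: a sequence of nonnegative variables with bounded means is tight. -/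
lemma of_lintegral {F : ℕ → Ω → ℝ} (hm : ∀ N, Measurable (F N)) (h0 : ∀ N, ∀ᵐ ω ∂P, 0 ≤ F N ω)
    {C : ENNReal} (hC : C ≠ ⊤) (h : ∀ᶠ N in atTop, ∫⁻ ω, ENNReal.ofReal (F N ω) ∂P ≤ C) :
    BddInProb P (fun q => F q.1 q.2) := by
  intro η hη
  rcases eq_or_ne η ⊤ with rfl | hη'
  · exact ⟨1, one_pos, by simp⟩
  refine ⟨(C / η).toReal + 1, by positivity, ?_⟩
  filter_upwards [h] with N hN
  have hCη : C / η ≠ ⊤ := ENNReal.div_ne_top hC hη.ne'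
  have hpos : ENNReal.ofReal ((C / η).toReal + 1) ≠ 0 := by
    rw [Ne, ENNReal.ofReal_eq_zero, not_le]; positivity
  calc P {ω | ¬ |F N ω| ≤ (C / η).toReal + 1}
      ≤ P {ω | ENNReal.ofReal ((C / η).toReal + 1) ≤ ENNReal.ofReal (F N ω)} := by
        refine measure_mono_ae ?_
        filter_upwards [h0 N] with ω h0 hω
        have hω : ¬ |F N ω| ≤ (C / η).toReal + 1 := hω
        rw [abs_of_nonneg h0] at hω
        exact ENNReal.ofReal_le_ofReal (not_le.1 hω).le
    _ ≤ (∫⁻ ω, ENNReal.ofReal (F N ω) ∂P) / ENNReal.ofReal ((C / η).toReal + 1) :=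
        meas_ge_le_lintegral_div (hm N).ennreal_ofReal.aemeasurable hpos ENNReal.ofReal_ne_top
    _ ≤ C / ENNReal.ofReal ((C / η).toReal + 1) := ENNReal.div_le_div_right hN _
    _ ≤ η := by
        refine ENNReal.div_le_of_le_mul ?_
        rw [mul_comm, ENNReal.ofReal_add ENNReal.toReal_nonneg zero_le_one,
          ENNReal.ofReal_toReal hCη]
        calc C = C / η * η := (ENNReal.div_mul_cancel hη.ne' hη').symm
          _ ≤ _ := by gcongr; exact le_self_add

end BddInProb

lemma tendsto_whp_zero_of_lintegral {F : ℕ → Ω → ℝ} (hm : ∀ N, Measurable (F N))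
    (h0 : ∀ N, ∀ᵐ ω ∂P, 0 ≤ F N ω)
    (h : Tendsto (fun N => ∫⁻ ω, ENNReal.ofReal (F N ω) ∂P) atTop (𝓝 0)) :
    Tendsto (fun q : ℕ × Ω => F q.1 q.2) (whp P) (𝓝 0) := by
  rw [Metric.tendsto_nhds]
  intro ε hε
  rw [eventually_whp_iff]
  have hε' : ENNReal.ofReal ε ≠ 0 := by rw [Ne, ENNReal.ofReal_eq_zero, not_le]; exact hε
  have h2 := ENNReal.Tendsto.div_const h (Or.inr hε')
  rw [ENNReal.zero_div] at h2
  refine tendsto_of_tendsto_of_tendsto_of_le_of_le tendsto_const_nhds h2 (fun _ => zero_le) ?_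
  intro N
  refine (measure_mono_ae ?_).trans
    (meas_ge_le_lintegral_div (hm N).ennreal_ofReal.aemeasurable hε' ENNReal.ofReal_ne_top)
  filter_upwards [h0 N] with ω h0 hω
  have hω : ¬ dist (F N ω) 0 < ε := hω
  rw [Real.dist_eq, sub_zero, abs_of_nonneg h0] at hω
  exact ENNReal.ofReal_le_ofReal (not_lt.1 hω)

lemma tendsto_zero_of_sq_tendsto_zero {ι : Type*} {l : Filter ι} {f : ι → ℝ}
    (h : Tendsto (fun q => f q ^ 2) l (𝓝 0)) : Tendsto f l (𝓝 0) := by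
  have := h.sqrt
  simp only [Real.sqrt_sq_eq_abs, Real.sqrt_zero] at this
  exact (tendsto_zero_iff_abs_tendsto_zero f).2 this

end InProbability

/-! ### Cumulant functions of canonical families -/

section Cumulant

namespace SurrogateGLM.IsCanonicalFamily

variable {ν : Measure ℝ} {b c : ℝ → ℝ}

/-- The cumulant function `b` is the cumulant generating function of the measure with density `c`,
which is finite everywhere. -/
lemma cgf_eq (h : IsCanonicalFamily ν b c) :
    b = cgf id (ν.withDensity fun y => ENNReal.ofReal (c y)) ∧
      integrableExpSet id (ν.withDensity fun y => ENNReal.ofReal (c y)) = Set.univ := by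
  set μ := ν.withDensity fun y => ENNReal.ofReal (c y) with hμ
  have key : ∀ θ, ∫⁻ y, ENNReal.ofReal (Real.exp (θ * y)) ∂μ = ENNReal.ofReal (Real.exp (b θ)) := by
    intro θ
    rw [hμ, lintegral_withDensity_eq_lintegral_mul _ h.measurable.ennreal_ofReal (by fun_prop)]
    have h1 : ∀ y, ((fun y => ENNReal.ofReal (c y)) * fun y => ENNReal.ofReal (Real.exp (θ * y))) y
        = ENNReal.ofReal (Real.exp (b θ)) *
          ENNReal.ofReal (Real.exp (y * θ - b θ) * c y) := by
      intro y
      rw [Pi.mul_apply, ← ENNReal.ofReal_mul (h.nonneg y),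
        ← ENNReal.ofReal_mul (Real.exp_pos _).le, ← mul_assoc, ← Real.exp_add]
      congr 1
      rw [mul_comm]
      congr 2
      ring
    simp only [h1]
    rw [lintegral_const_mul' _ _ ENNReal.ofReal_ne_top, h.lintegral_eq_one θ, mul_one]
  have hint : ∀ θ, Integrable (fun y : ℝ => Real.exp (θ * id y)) μ := by
    intro θ
    refine ⟨by fun_prop, ?_⟩
    rw [hasFiniteIntegral_iff_ofReal (Eventually.of_forall fun y => (Real.exp_pos _).le)]
    simp only [id]
    rw [key θ]
    exact ENNReal.ofReal_lt_top
  refine ⟨?_, Set.eq_univ_of_forall fun θ => hint θ⟩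
  funext θ
  rw [cgf, mgf, integral_eq_lintegral_of_nonneg_ae
    (Eventually.of_forall fun y => (Real.exp_pos _).le) (hint θ).1]
  simp only [id]
  rw [key θ, ENNReal.toReal_ofReal (Real.exp_pos _).le, Real.log_exp]

lemma contDiff (h : IsCanonicalFamily ν b c) : ContDiff ℝ ⊤ b := by
  obtain ⟨h1, h2⟩ := h.cgf_eq
  rw [h1, contDiff_iff_contDiffAt]
  intro t
  exact (analyticAt_cgf (by rw [h2, interior_univ]; trivial)).contDiffAt.of_le le_top

lemma differentiable_deriv (h : IsCanonicalFamily ν b c) : Differentiable ℝ (deriv b) :=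
  (h.contDiff.of_le le_top : ContDiff ℝ 2 b).differentiable_deriv_two

lemma continuous_deriv (h : IsCanonicalFamily ν b c) : Continuous (deriv b) :=
  h.differentiable_deriv.continuous

lemma continuous_deriv_deriv (h : IsCanonicalFamily ν b c) : Continuous (deriv (deriv b)) := by
  have := (h.contDiff.of_le le_top : ContDiff ℝ 2 b).continuous_iteratedDeriv 2 le_rfl
  rwa [iteratedDeriv_succ, iteratedDeriv_one] at this

/-- `b''` is a variance function: it is positive everywhere, unless the family is degenerate. -/
lemma deriv_deriv_pos_or (h : IsCanonicalFamily ν b c) :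
    (∀ t, 0 < deriv (deriv b) t) ∨ (∀ t, deriv (deriv b) t = 0) := by
  obtain ⟨h1, h2⟩ := h.cgf_eq
  set μ := ν.withDensity fun y => ENNReal.ofReal (c y) with hμ
  have ht : ∀ t, t ∈ interior (integrableExpSet id μ) := fun t => by
    rw [h2, interior_univ]; trivial
  have hvar : ∀ t, deriv (deriv b) t = Var[id; μ.tilted (t * id ·)] := by
    intro t
    rw [variance_tilted_mul (ht t), iteratedDeriv_succ, iteratedDeriv_one, ← h1]
  by_cases hall : ∀ t, 0 < deriv (deriv b) t
  · exact Or.inl hall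
  right
  push Not at hall
  obtain ⟨t, htle⟩ := hall
  have hint : ∀ s, Integrable (fun y : ℝ => Real.exp (s * id y)) μ := fun s =>
    integrable_of_mem_integrableExpSet (by rw [h2]; trivial)
  have hL2 : MemLp id 2 (μ.tilted (t * id ·)) := by
    exact_mod_cast memLp_tilted_mul (ht t) 2
  have h0 : Var[id; μ.tilted (t * id ·)] = 0 :=
    le_antisymm (hvar t ▸ htle) (variance_nonneg _ _)
  have hev : evariance id (μ.tilted (t * id ·)) = 0 := by
    have hne : MeasureTheory.IsFiniteMeasure (μ.tilted (t * id ·)) := inferInstance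
    have hlt := hL2.evariance_lt_top
    rw [variance, ENNReal.toReal_eq_zero_iff] at h0
    exact h0.resolve_right hlt.ne
  rw [evariance_eq_zero_iff hL2.1.aemeasurable] at hev
  have hae : ∀ᵐ y ∂μ, id y = (∫ x, id x ∂(μ.tilted (t * id ·))) :=
    (absolutelyContinuous_tilted (hint t)).ae_le hev
  intro s
  rw [hvar s, variance_congr ((tilted_absolutelyContinuous μ _).ae_le hae)]
  by_cases hμ0 : μ = 0
  · rw [hμ0]; simp [variance, evariance]
  · have : NeZero μ := ⟨hμ0⟩
    have := isProbabilityMeasure_tilted (hint s)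
    simp only [id] at this
    simp [variance, evariance]

lemma deriv_deriv_nonneg (h : IsCanonicalFamily ν b c) (t : ℝ) : 0 ≤ deriv (deriv b) t := by
  rcases h.deriv_deriv_pos_or with h | h
  · exact (h t).le
  · exact (h t).ge

lemma monotone_deriv (h : IsCanonicalFamily ν b c) : Monotone (deriv b) :=
  monotone_of_deriv_nonneg h.differentiable_deriv h.deriv_deriv_nonneg

end SurrogateGLM.IsCanonicalFamily

end Cumulant

/-! ### Expectations under Poisson sampling -/

section BernoulliSums

/-- Expectation, over independent Bernoulli indicators, of an additive function of them. -/
lemma sum_prod_bool_mul_sum (N : ℕ) (q : Fin N → Bool → ℝ) (hq : ∀ i, q i true + q i false = 1)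
    (u : Fin N → Bool → ℝ) (c : ℝ) :
    ∑ r : Fin N → Bool, (∏ i, q i (r i)) * (c + ∑ i, u i (r i)) =
      c + ∑ i, (q i true * u i true + q i false * u i false) := by
  induction N generalizing c with
  | zero => simp
  | succ N ih =>
    rw [← (Fin.consEquiv fun _ => Bool).sum_comp, Fintype.sum_prod_type]
    simp only [Fin.consEquiv_apply, Fin.prod_univ_succ, Fin.sum_univ_succ, Fin.cons_zero,
      Fin.cons_succ, Fintype.sum_bool]
    have h : ∀ x : Bool, ∑ r : Fin N → Bool, q 0 x * (∏ i : Fin N, q i.succ (r i)) *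
        (c + (u 0 x + ∑ i : Fin N, u i.succ (r i))) = q 0 x * ((c + u 0 x) +
          ∑ i : Fin N, (q i.succ true * u i.succ true + q i.succ false * u i.succ false)) := by
      intro x
      rw [← ih (fun i => q i.succ) (fun i => hq i.succ) (fun i => u i.succ), Finset.mul_sum]
      refine Finset.sum_congr rfl fun r _ => ?_
      ring
    rw [h true, h false]
    linear_combination (c + ∑ i : Fin N,
      (q i.succ true * u i.succ true + q i.succ false * u i.succ false)) * hq 0

/-- Second moment, over independent Bernoulli indicators, of a sum of centred functions of the
single indicators. -/
lemma sum_prod_bool_mul_sq (N : ℕ) (q : Fin N → Bool → ℝ) (hq : ∀ i, q i true + q i false = 1)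
    (u : Fin N → Bool → ℝ) (hu : ∀ i, q i true * u i true + q i false * u i false = 0) (c : ℝ) :
    ∑ r : Fin N → Bool, (∏ i, q i (r i)) * (c + ∑ i, u i (r i)) ^ 2 =
      c ^ 2 + ∑ i, (q i true * u i true ^ 2 + q i false * u i false ^ 2) := by
  induction N generalizing c with
  | zero => simp
  | succ N ih =>
    rw [← (Fin.consEquiv fun _ => Bool).sum_comp, Fintype.sum_prod_type]
    simp only [Fin.consEquiv_apply, Fin.prod_univ_succ, Fin.sum_univ_succ, Fin.cons_zero,
      Fin.cons_succ, Fintype.sum_bool]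
    have h : ∀ x : Bool, ∑ r : Fin N → Bool, q 0 x * (∏ i : Fin N, q i.succ (r i)) *
        (c + (u 0 x + ∑ i : Fin N, u i.succ (r i))) ^ 2 = q 0 x * ((c + u 0 x) ^ 2 +
          ∑ i : Fin N, (q i.succ true * u i.succ true ^ 2 +
            q i.succ false * u i.succ false ^ 2)) := by
      intro x
      rw [← ih (fun i => q i.succ) (fun i => hq i.succ) (fun i => u i.succ) (fun i => hu i.succ),
        Finset.mul_sum]
      refine Finset.sum_congr rfl fun r _ => ?_
      ring
    rw [h true, h false]
    linear_combination (c ^ 2 + ∑ i : Fin N,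
      (q i.succ true * u i.succ true ^ 2 + q i.succ false * u i.succ false ^ 2)) * hq 0 +
        2 * c * hu 0

end BernoulliSums

section Sampling

variable {Ω : Type*} [MeasurableSpace Ω] {p : ℕ} {P : Measure Ω}
  {X : ℕ → Ω → Vec p} {Y S : ℕ → Ω → ℝ} {n : ℕ → ℝ}
  {π : (N : ℕ) → Fin N → Ω → ℝ} {R : (N : ℕ) → Fin N → Ω → Bool}

/-- The `i`-th unit, as one random element. -/
def unit (X : ℕ → Ω → Vec p) (Y S : ℕ → Ω → ℝ) (i : ℕ) (ω : Ω) : Vec p × ℝ × ℝ :=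
  (X i ω, Y i ω, S i ω)

/-- The information carried by the first `N` units. -/
@[reducible]
def dataSigma (X : ℕ → Ω → Vec p) (Y S : ℕ → Ω → ℝ) (N : ℕ) : MeasurableSpace Ω :=
  MeasurableSpace.comap (fun ω (j : Fin N) => (X j ω, Y j ω, S j ω)) inferInstance

/-- The indicator `Rᵢ` as a real number. -/
def ind (R : (N : ℕ) → Fin N → Ω → Bool) (N : ℕ) (i : Fin N) (ω : Ω) : ℝ :=
  if R N i ω then 1 else 0

namespace SurrogateGLM.IsIIDSample

lemma measurable_unit (h : IsIIDSample P X Y S) (i : ℕ) : Measurable (unit X Y S i) :=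
  (h.measurable_X i).prodMk ((h.measurable_Y i).prodMk (h.measurable_S i))

lemma dataSigma_le (h : IsIIDSample P X Y S) (N : ℕ) :
    dataSigma X Y S N ≤ (inferInstance : MeasurableSpace Ω) := by
  refine Measurable.comap_le ?_
  exact measurable_pi_lambda _ fun j => h.measurable_unit j

end SurrogateGLM.IsIIDSample

omit [MeasurableSpace Ω] in
lemma measurable_unit_dataSigma {N : ℕ} (i : Fin N) :
    Measurable[dataSigma X Y S N] (unit X Y S i) := by
  have h : unit X Y S i = (fun v : Fin N → Vec p × ℝ × ℝ => v i) ∘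
      (fun ω (j : Fin N) => (X j ω, Y j ω, S j ω)) := rfl
  rw [h]
  exact (measurable_pi_apply i).comp (comap_measurable _)

namespace SurrogateGLM.IsPoissonSampling

variable (hs : IsPoissonSampling P X Y S n π R)
include hs

lemma measurable_π_dataSigma (N : ℕ) (i : Fin N) : Measurable[dataSigma X Y S N] (π N i) := by
  refine (hs.measurable_π N i).mono ?_ le_rfl
  have h : (fun ω (j : Fin N) => (S j ω, X j ω)) =
      (fun (v : Fin N → Vec p × ℝ × ℝ) (j : Fin N) => ((v j).2.2, (v j).1)) ∘
      (fun ω (j : Fin N) => (X j ω, Y j ω, S j ω)) := rfl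
  rw [h, ← MeasurableSpace.comap_comp]
  exact MeasurableSpace.comap_mono (Measurable.comap_le (by fun_prop))

lemma measurable_π_ambient (hiid : IsIIDSample P X Y S) (N : ℕ) (i : Fin N) :
    Measurable (π N i) :=
  (hs.measurable_π_dataSigma N i).mono (hiid.dataSigma_le N) le_rfl

lemma measurable_ind (N : ℕ) (i : Fin N) : Measurable (ind R N i) :=
  (measurable_of_finite (fun x : Bool => if x then (1 : ℝ) else 0)).comp (hs.measurable_R N i)

lemma measurable_ipw (hiid : IsIIDSample P X Y S) (N : ℕ) (i : Fin N) :
    Measurable (ipw π R N i) :=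
  (hs.measurable_ind N i).div (hs.measurable_π_ambient hiid N i)

lemma measurable_prob (N : ℕ) (r : Fin N → Bool) :
    Measurable[dataSigma X Y S N]
      (fun ω => ∏ i, (if r i then π N i ω else 1 - π N i ω)) := by
  refine Finset.measurable_fun_prod _ fun i _ => ?_
  by_cases hr : r i
  · simpa [hr] using hs.measurable_π_dataSigma N i
  · simp only [hr]
    exact measurable_const.sub (hs.measurable_π_dataSigma N i)

lemma setLIntegral_eq [IsFiniteMeasure P] (hiid : IsIIDSample P X Y S) (N : ℕ) (r : Fin N → Bool)
    {f : Ω → ENNReal} (hf : Measurable[dataSigma X Y S N] f) :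
    ∫⁻ ω in {ω | ∀ i, R N i ω = r i}, f ω ∂P =
      ∫⁻ ω, ENNReal.ofReal (∏ i, (if r i then π N i ω else 1 - π N i ω)) * f ω ∂P := by
  have hG := hiid.dataSigma_le N
  set E : Set Ω := {ω | ∀ i, R N i ω = r i} with hE
  have hEm : MeasurableSet E := by
    have : E = ⋂ i, (R N i) ⁻¹' {r i} := by ext ω; simp [hE]
    rw [this]
    exact MeasurableSet.iInter fun i => hs.measurable_R N i (measurableSet_singleton _)
  set q : Ω → ℝ := fun ω => ∏ i, (if r i then π N i ω else 1 - π N i ω) with hq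
  have hqm : Measurable q := (hs.measurable_prob N r).mono hG le_rfl
  have hq0 : 0 ≤ᵐ[P] q := by
    have h1 : ∀ᵐ ω ∂P, ∀ i, 0 < π N i ω := ae_all_iff.2 (hs.pos N)
    have h2 : ∀ᵐ ω ∂P, ∀ i, π N i ω ≤ 1 := ae_all_iff.2 (hs.le_one N)
    filter_upwards [h1, h2] with ω h1 h2
    refine Finset.prod_nonneg fun i _ => ?_
    split_ifs
    · exact (h1 i).le
    · linarith [h2 i]
  have htrim : (P.restrict E).trim hG = (P.withDensity fun ω => ENNReal.ofReal (q ω)).trim hG := by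
    refine @Measure.ext _ (dataSigma X Y S N) _ _ fun s hsm => ?_
    have hsm' : MeasurableSet s := hG s hsm
    rw [trim_measurableSet_eq hG hsm, trim_measurableSet_eq hG hsm, Measure.restrict_apply hsm',
      withDensity_apply _ hsm']
    have h1 : Integrable (E.indicator fun _ => (1 : ℝ)) P :=
      (integrable_const 1).indicator hEm
    have h2 := setIntegral_condExp hG h1 hsm
    have h3 : ∫ ω in s, q ω ∂P = ∫ ω in s, E.indicator (fun _ => (1 : ℝ)) ω ∂P := by
      rw [← h2]
      exact integral_congr_ae (ae_restrict_of_ae (hs.cond_law N r).symm)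
    have hqi : Integrable q P :=
      (integrable_condExp (m := dataSigma X Y S N) (f := E.indicator fun _ => (1 : ℝ))
        (μ := P)).congr (hs.cond_law N r)
    rw [← ofReal_integral_eq_lintegral_ofReal hqi.integrableOn (ae_restrict_of_ae hq0), h3,
      integral_indicator hEm, Measure.restrict_restrict hEm, setIntegral_const, smul_eq_mul, mul_one,
      Set.inter_comm, ofReal_measureReal]
  calc ∫⁻ ω in E, f ω ∂P = ∫⁻ ω, f ω ∂((P.restrict E).trim hG) := (lintegral_trim hG hf).symm
    _ = ∫⁻ ω, f ω ∂(P.withDensity fun ω => ENNReal.ofReal (q ω)) := by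
        rw [htrim, lintegral_trim hG hf]
    _ = ∫⁻ ω, ENNReal.ofReal (q ω) * f ω ∂P := by
        rw [lintegral_withDensity_eq_lintegral_mul _ hqm.ennreal_ofReal (hf.mono hG le_rfl)]
        rfl

/-- Integrating out the indicators: the mean of a nonnegative function of the indicators and of the
data is the mean of its average over the conditional law of the indicators. -/
lemma lintegral_eq [IsFiniteMeasure P] (hiid : IsIIDSample P X Y S) (N : ℕ)
    {Φ : (Fin N → Bool) → Ω → ℝ} (hΦ : ∀ r, Measurable[dataSigma X Y S N] (Φ r))
    (h0 : ∀ᵐ ω ∂P, ∀ r, 0 ≤ Φ r ω) :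
    ∫⁻ ω, ENNReal.ofReal (Φ (fun i => R N i ω) ω) ∂P =
      ∫⁻ ω, ENNReal.ofReal
        (∑ r : Fin N → Bool, (∏ i, (if r i then π N i ω else 1 - π N i ω)) * Φ r ω) ∂P := by
  have hG := hiid.dataSigma_le N
  have hEm : ∀ r : Fin N → Bool, MeasurableSet {ω | ∀ i, R N i ω = r i} := by
    intro r
    have : {ω | ∀ i, R N i ω = r i} = ⋂ i, (R N i) ⁻¹' {r i} := by ext ω; simp
    rw [this]
    exact MeasurableSet.iInter fun i => hs.measurable_R N i (measurableSet_singleton _)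
  have h1 : ∀ᵐ ω ∂P, ∀ i, 0 < π N i ω := ae_all_iff.2 (hs.pos N)
  have h2 : ∀ᵐ ω ∂P, ∀ i, π N i ω ≤ 1 := ae_all_iff.2 (hs.le_one N)
  have hL : ∀ ω, ENNReal.ofReal (Φ (fun i => R N i ω) ω) =
      ∑ r : Fin N → Bool, {ω | ∀ i, R N i ω = r i}.indicator
        (fun ω => ENNReal.ofReal (Φ r ω)) ω := by
    intro ω
    rw [Finset.sum_eq_single (fun i => R N i ω)]
    · rw [Set.indicator_of_mem]
      exact fun i => rfl
    · intro r _ hr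
      refine Set.indicator_of_notMem ?_ _
      exact fun h => hr (funext fun i => (h i).symm)
    · simp
  simp only [hL]
  rw [lintegral_finsetSum _ fun r _ => (((hΦ r).mono hG le_rfl).ennreal_ofReal.indicator (hEm r))]
  have hR : ∫⁻ ω, ENNReal.ofReal
        (∑ r : Fin N → Bool, (∏ i, (if r i then π N i ω else 1 - π N i ω)) * Φ r ω) ∂P =
      ∫⁻ ω, ∑ r : Fin N → Bool, ENNReal.ofReal (∏ i, (if r i then π N i ω else 1 - π N i ω)) *
        ENNReal.ofReal (Φ r ω) ∂P := by
    refine lintegral_congr_ae ?_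
    filter_upwards [h1, h2, h0] with ω h1 h2 h0
    have hp : ∀ r : Fin N → Bool, 0 ≤ ∏ i, (if r i then π N i ω else 1 - π N i ω) := by
      intro r
      refine Finset.prod_nonneg fun i _ => ?_
      split_ifs
      · exact (h1 i).le
      · linarith [h2 i]
    rw [ENNReal.ofReal_sum_of_nonneg fun r _ => mul_nonneg (hp r) (h0 r)]
    exact Finset.sum_congr rfl fun r _ => ENNReal.ofReal_mul (hp r)
  have hm : ∀ r ∈ (Finset.univ : Finset (Fin N → Bool)), Measurable fun ω =>
      ENNReal.ofReal (∏ i, (if r i then π N i ω else 1 - π N i ω)) * ENNReal.ofReal (Φ r ω) :=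
    fun r _ => ((hs.measurable_prob N r).mono hG le_rfl).ennreal_ofReal.mul
      ((hΦ r).mono hG le_rfl).ennreal_ofReal
  rw [hR, lintegral_finsetSum _ hm]
  refine Finset.sum_congr rfl fun r _ => ?_
  rw [lintegral_indicator (hEm r)]
  exact hs.setLIntegral_eq hiid N r (hΦ r).ennreal_ofReal

/-- Mean of an additive function of the indicators. -/
lemma lintegral_sum_eq [IsFiniteMeasure P] (hiid : IsIIDSample P X Y S) (N : ℕ)
    {u : Fin N → Bool → Ω → ℝ} (hu : ∀ i x, Measurable[dataSigma X Y S N] (u i x))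
    (h0 : ∀ᵐ ω ∂P, ∀ i x, 0 ≤ u i x ω) :
    ∫⁻ ω, ENNReal.ofReal (∑ i, u i (R N i ω) ω) ∂P =
      ∫⁻ ω, ENNReal.ofReal
        (∑ i, (π N i ω * u i true ω + (1 - π N i ω) * u i false ω)) ∂P := by
  rw [hs.lintegral_eq hiid N (Φ := fun r ω => ∑ i, u i (r i) ω)
    (fun r => Finset.measurable_fun_sum _ fun i _ => hu i (r i))
    (by filter_upwards [h0] with ω h0 r using Finset.sum_nonneg fun i _ => h0 i _)]
  refine lintegral_congr fun ω => ?_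
  congr 1
  have h := sum_prod_bool_mul_sum N (fun i x => if x then π N i ω else 1 - π N i ω)
    (fun i => by simp) (fun i x => u i x ω) 0
  simpa using h

lemma lintegral_sum_ind [IsProbabilityMeasure P] (hiid : IsIIDSample P X Y S) (N : ℕ) :
    ∫⁻ ω, ENNReal.ofReal (∑ i, ind R N i ω) ∂P = ENNReal.ofReal (n N) := by
  rw [show ∫⁻ ω, ENNReal.ofReal (∑ i, ind R N i ω) ∂P = _ from hs.lintegral_sum_eq hiid N
    (u := fun i x _ => if x then 1 else 0) (fun i x => measurable_const)
    (Eventually.of_forall fun ω i x => by cases x <;> simp)]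
  have : ∫⁻ _ : Ω, ENNReal.ofReal (n N) ∂P = ENNReal.ofReal (n N) := by simp
  rw [← this]
  refine lintegral_congr_ae ?_
  filter_upwards [hs.sum_eq N] with ω h
  rw [← h]
  simp

/-- Inverse-probability weighting is unbiased. -/
lemma lintegral_sum_ipw_mul [IsFiniteMeasure P] (hiid : IsIIDSample P X Y S) (N : ℕ)
    {f : Vec p × ℝ × ℝ → ℝ} (hf : Measurable f) (h0 : ∀ z, 0 ≤ f z) :
    ∫⁻ ω, ENNReal.ofReal (∑ i : Fin N, ipw π R N i ω * f (unit X Y S i ω)) ∂P =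
      ∫⁻ ω, ENNReal.ofReal (∑ i : Fin N, f (unit X Y S i ω)) ∂P := by
  have h1 : ∀ᵐ ω ∂P, ∀ i, 0 < π N i ω := ae_all_iff.2 (hs.pos N)
  rw [show ∫⁻ ω, ENNReal.ofReal (∑ i : Fin N, ipw π R N i ω * f (unit X Y S i ω)) ∂P = _ from
    hs.lintegral_sum_eq hiid N
    (u := fun i x ω => (if x then 1 else 0) / π N i ω * f (unit X Y S i ω))
    (fun i x => (measurable_const.div (hs.measurable_π_dataSigma N i)).mul
      (hf.comp (measurable_unit_dataSigma i)))
    (by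
      filter_upwards [h1] with ω h1 i x
      exact mul_nonneg (div_nonneg (by cases x <;> simp) (h1 i).le) (h0 _))]
  refine lintegral_congr_ae ?_
  filter_upwards [h1] with ω h1
  congr 1
  refine Finset.sum_congr rfl fun i _ => ?_
  have := (h1 i).ne'
  simp
  field_simp

lemma lintegral_sum_ipw_sq_mul_sq [IsFiniteMeasure P] (hiid : IsIIDSample P X Y S) (N : ℕ)
    {f : Vec p × ℝ × ℝ → ℝ} (hf : Measurable f) :
    ∫⁻ ω, ENNReal.ofReal (∑ i : Fin N, ipw π R N i ω ^ 2 * f (unit X Y S i ω) ^ 2) ∂P =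
      ∫⁻ ω, ENNReal.ofReal (∑ i : Fin N, f (unit X Y S i ω) ^ 2 / π N i ω) ∂P := by
  have h1 : ∀ᵐ ω ∂P, ∀ i, 0 < π N i ω := ae_all_iff.2 (hs.pos N)
  rw [show ∫⁻ ω, ENNReal.ofReal (∑ i : Fin N, ipw π R N i ω ^ 2 * f (unit X Y S i ω) ^ 2) ∂P = _
    from hs.lintegral_sum_eq hiid N
    (u := fun i x ω => ((if x then 1 else 0) / π N i ω) ^ 2 * f (unit X Y S i ω) ^ 2)
    (fun i x => ((measurable_const.div (hs.measurable_π_dataSigma N i)).pow_const 2).mul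
      ((hf.comp (measurable_unit_dataSigma i)).pow_const 2))
    (by
      filter_upwards [h1] with ω h1 i x
      positivity)]
  refine lintegral_congr_ae ?_
  filter_upwards [h1] with ω h1
  congr 1
  refine Finset.sum_congr rfl fun i _ => ?_
  have := (h1 i).ne'
  simp
  field_simp

/-- The sampling error `∑ (Rᵢ / πᵢ - 1) fᵢ` has conditional mean zero and conditional variance
`∑ (1 / πᵢ - 1) fᵢ²`. Both facts are read off from the second moments about two constants `c`. -/
lemma lintegral_sq_sum_ipw_sub_one [IsProbabilityMeasure P] (hiid : IsIIDSample P X Y S) (N : ℕ)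
    {f : Vec p × ℝ × ℝ → ℝ} (hf : Measurable f) (c : ℝ) :
    ∫⁻ ω, ENNReal.ofReal ((c + ∑ i : Fin N, (ipw π R N i ω - 1) * f (unit X Y S i ω)) ^ 2) ∂P =
      ENNReal.ofReal (c ^ 2) +
      ∫⁻ ω, ENNReal.ofReal (∑ i : Fin N, (1 / π N i ω - 1) * f (unit X Y S i ω) ^ 2) ∂P := by
  have h1 : ∀ᵐ ω ∂P, ∀ i, 0 < π N i ω := ae_all_iff.2 (hs.pos N)
  have h2 : ∀ᵐ ω ∂P, ∀ i, π N i ω ≤ 1 := ae_all_iff.2 (hs.le_one N)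
  have hum : ∀ (i : Fin N) (x : Bool), Measurable[dataSigma X Y S N]
      (fun ω => ((if x then 1 else 0) / π N i ω - 1) * f (unit X Y S i ω)) := fun i x =>
    ((measurable_const.div (hs.measurable_π_dataSigma N i)).sub measurable_const).mul
      (hf.comp (measurable_unit_dataSigma i))
  rw [show ∫⁻ ω, ENNReal.ofReal
      ((c + ∑ i : Fin N, (ipw π R N i ω - 1) * f (unit X Y S i ω)) ^ 2) ∂P = _ from
    hs.lintegral_eq hiid N
      (Φ := fun r ω => (c + ∑ i : Fin N,
        ((if r i then 1 else 0) / π N i ω - 1) * f (unit X Y S i ω)) ^ 2)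
      (fun r => (measurable_const.add (Finset.measurable_fun_sum _ fun i _ => hum i (r i))).pow_const 2)
      (Eventually.of_forall fun ω r => sq_nonneg _)]
  have hc : ∫⁻ _ : Ω, ENNReal.ofReal (c ^ 2) ∂P = ENNReal.ofReal (c ^ 2) := by simp
  rw [← hc, ← lintegral_add_left measurable_const]
  refine lintegral_congr_ae ?_
  filter_upwards [h1, h2] with ω h1 h2
  have h3 : ∀ i, 0 ≤ 1 / π N i ω - 1 := fun i => by
    rw [sub_nonneg]; exact one_le_one_div (h1 i) (h2 i)
  rw [← ENNReal.ofReal_add (sq_nonneg c)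
    (Finset.sum_nonneg fun i _ => mul_nonneg (h3 i) (sq_nonneg _))]
  congr 1
  rw [sum_prod_bool_mul_sq N (fun i x => if x then π N i ω else 1 - π N i ω) (fun i => by simp)
    (fun i x => ((if x then 1 else 0) / π N i ω - 1) * f (unit X Y S i ω))]
  · congr 1
    refine Finset.sum_congr rfl fun i _ => ?_
    have := (h1 i).ne'
    simp
    field_simp
    ring
  · intro i
    have := (h1 i).ne'
    simp
    field_simp
    ring

end SurrogateGLM.IsPoissonSampling

end Sampling

/-! ### Laws of large numbers for full-data and weighted means -/

section LawsOfLargeNumbers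

variable {Ω : Type*} [MeasurableSpace Ω] {p : ℕ} {P : Measure Ω}
  {X : ℕ → Ω → Vec p} {Y S : ℕ → Ω → ℝ} {n : ℕ → ℝ}
  {π : (N : ℕ) → Fin N → Ω → ℝ} {R : (N : ℕ) → Fin N → Ω → Bool}
  {f g : Vec p × ℝ × ℝ → ℝ}

/-- The weighted mean `N⁻¹ ∑ wᵢ f(Xᵢ, Yᵢ, Sᵢ)`. -/
noncomputable def wmean (X : ℕ → Ω → Vec p) (Y S : ℕ → Ω → ℝ) (w : (N : ℕ) → Fin N → Ω → ℝ)
    (f : Vec p × ℝ × ℝ → ℝ) (q : ℕ × Ω) : ℝ :=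
  (q.1 : ℝ)⁻¹ * ∑ i : Fin q.1, w q.1 i q.2 * f (unit X Y S i q.2)

/-- The constant weights of the full-data means. -/
def unitWeight (N : ℕ) (_ : Fin N) (_ : Ω) : ℝ := 1

/-- The sampling variance `N⁻² ∑ E[f(Xᵢ, Yᵢ, Sᵢ)² / πᵢ]` of a weighted mean tends to zero. -/
def SmallVar (P : Measure Ω) (X : ℕ → Ω → Vec p) (Y S : ℕ → Ω → ℝ)
    (π : (N : ℕ) → Fin N → Ω → ℝ) (f : Vec p × ℝ × ℝ → ℝ) : Prop :=
  Tendsto (fun N : ℕ => ∫⁻ ω, ENNReal.ofReal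
    (((N : ℝ)⁻¹) ^ 2 * ∑ i : Fin N, f (unit X Y S i ω) ^ 2 / π N i ω) ∂P) atTop (𝓝 0)

namespace SurrogateGLM.IsIIDSample

variable (hiid : IsIIDSample P X Y S)
include hiid

lemma identDistrib_comp (hf : Measurable f) (i : ℕ) :
    IdentDistrib (fun ω => f (unit X Y S i ω)) (fun ω => f (unit X Y S 0 ω)) P P :=
  (hiid.identDistrib i).comp hf

lemma indepFun_comp (hf : Measurable f) {i j : ℕ} (hij : i ≠ j) :
    IndepFun (fun ω => f (unit X Y S i ω)) (fun ω => f (unit X Y S j ω)) P :=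
  (hiid.indep.indepFun hij).comp hf hf

/-- Almost sure properties of the first unit are shared by all units. -/
lemma ae_forall {s : Set (Vec p × ℝ × ℝ)} (hs : MeasurableSet s)
    (h : ∀ᵐ ω ∂P, unit X Y S 0 ω ∈ s) : ∀ᵐ ω ∂P, ∀ i, unit X Y S i ω ∈ s := by
  rw [ae_all_iff]
  intro i
  exact (hiid.identDistrib i).symm.ae_snd (p := fun z => z ∈ s) hs h

lemma lintegral_sum (hf : Measurable f) (h0 : ∀ z, 0 ≤ f z) (N : ℕ) :
    ∫⁻ ω, ENNReal.ofReal (∑ i : Fin N, f (unit X Y S i ω)) ∂P =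
      N * ∫⁻ ω, ENNReal.ofReal (f (unit X Y S 0 ω)) ∂P := by
  have h1 : ∀ ω, ENNReal.ofReal (∑ i : Fin N, f (unit X Y S i ω)) =
      ∑ i : Fin N, ENNReal.ofReal (f (unit X Y S i ω)) := fun ω =>
    ENNReal.ofReal_sum_of_nonneg fun i _ => h0 _
  simp only [h1]
  have hm : ∀ i ∈ (Finset.univ : Finset (Fin N)),
      Measurable fun ω => ENNReal.ofReal (f (unit X Y S i ω)) := fun i _ =>
    (hf.comp (hiid.measurable_unit i)).ennreal_ofReal
  rw [lintegral_finsetSum _ hm]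
  have h2 : ∀ i : Fin N, ∫⁻ ω, ENNReal.ofReal (f (unit X Y S i ω)) ∂P =
      ∫⁻ ω, ENNReal.ofReal (f (unit X Y S 0 ω)) ∂P := fun i =>
    ((hiid.identDistrib_comp hf i).comp (u := ENNReal.ofReal) ENNReal.measurable_ofReal).lintegral_eq
  simp [h2]

lemma tendsto_wmean_unitWeight [IsProbabilityMeasure P] (hf : Measurable f)
    (hint : Integrable (fun ω => f (unit X Y S 0 ω)) P) :
    Tendsto (wmean X Y S unitWeight f) (whp P) (𝓝 (∫ ω, f (unit X Y S 0 ω) ∂P)) := by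
  have h := strong_law_ae_real (fun i ω => f (unit X Y S i ω)) hint
    (fun i j hij => hiid.indepFun_comp hf hij) (hiid.identDistrib_comp hf)
  have h2 := tendstoInMeasure_of_tendsto_ae (μ := P)
    (f := fun N ω => (∑ i ∈ Finset.range N, f (unit X Y S i ω)) / N)
    (g := fun _ => ∫ ω, f (unit X Y S 0 ω) ∂P)
    (fun N => ((Finset.measurable_fun_sum _ fun i _ =>
      hf.comp (hiid.measurable_unit i)).div_const _).aestronglyMeasurable) h
  rw [tendstoInMeasure_iff_whp] at h2
  refine h2.congr fun q => ?_
  rw [wmean, div_eq_inv_mul, ← Fin.sum_univ_eq_sum_range (fun i => f (unit X Y S i q.2))]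
  simp [unitWeight]

end SurrogateGLM.IsIIDSample

lemma SmallVar.of_sq_le {ι : Type*} {s : Finset ι} {F : ι → Vec p × ℝ × ℝ → ℝ}
    (hiid : IsIIDSample P X Y S) (hs : IsPoissonSampling P X Y S n π R)
    (hFm : ∀ k ∈ s, Measurable (F k))
    (hF : ∀ k ∈ s, SmallVar P X Y S π (F k)) {C : ℝ} (hC : 0 ≤ C)
    (h : ∀ᵐ ω ∂P, ∀ i, g (unit X Y S i ω) ^ 2 ≤ C * ∑ k ∈ s, F k (unit X Y S i ω) ^ 2) :
    SmallVar P X Y S π g := by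
  have h1 := ENNReal.Tendsto.const_mul (a := ENNReal.ofReal C)
    (tendsto_finsetSum s hF) (Or.inr ENNReal.ofReal_ne_top)
  simp only [Finset.sum_const_zero, mul_zero] at h1
  refine tendsto_of_tendsto_of_tendsto_of_le_of_le tendsto_const_nhds h1 (fun _ => zero_le) ?_
  intro N
  have hm : ∀ k ∈ s, Measurable (fun ω => ENNReal.ofReal
      (((N : ℝ)⁻¹) ^ 2 * ∑ i : Fin N, F k (unit X Y S i ω) ^ 2 / π N i ω)) := fun k hk =>
    ((Finset.measurable_fun_sum _ fun (i : Fin N) _ =>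
      (((hFm k hk).comp (hiid.measurable_unit i)).pow_const 2).div
        (hs.measurable_π_ambient hiid N i)).const_mul _).ennreal_ofReal
  have h2 : ∀ᵐ ω ∂P, ∀ i, 0 < π N i ω := ae_all_iff.2 (hs.pos N)
  simp only
  rw [← lintegral_finsetSum _ hm, ← lintegral_const_mul' _ _ ENNReal.ofReal_ne_top]
  refine lintegral_mono_ae ?_
  filter_upwards [h, h2] with ω h h2
  have h3 : ∀ k, 0 ≤ ((N : ℝ)⁻¹) ^ 2 * ∑ i : Fin N, F k (unit X Y S i ω) ^ 2 / π N i ω := fun k =>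
    mul_nonneg (sq_nonneg _) (Finset.sum_nonneg fun i _ => div_nonneg (sq_nonneg _) (h2 i).le)
  rw [← ENNReal.ofReal_sum_of_nonneg fun k _ => h3 k, ← ENNReal.ofReal_mul hC]
  refine ENNReal.ofReal_le_ofReal ?_
  rw [← Finset.mul_sum, mul_left_comm]
  refine mul_le_mul_of_nonneg_left ?_ (sq_nonneg _)
  rw [Finset.sum_comm, Finset.mul_sum]
  refine Finset.sum_le_sum fun i _ => ?_
  rw [← Finset.sum_div, ← mul_div_assoc]
  exact div_le_div_of_nonneg_right (h i) (h2 i).le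

namespace SurrogateGLM.IsPoissonSampling

variable (hs : IsPoissonSampling P X Y S n π R)
include hs

lemma n_pos [IsProbabilityMeasure P] {N : ℕ} (hN : 1 ≤ N) : 0 < n N := by
  have h1 : ∀ᵐ ω ∂P, ∀ i, 0 < π N i ω := ae_all_iff.2 (hs.pos N)
  obtain ⟨ω, h1, h2⟩ := (h1.and (hs.sum_eq N)).exists
  rw [← h2]
  have : Nonempty (Fin N) := ⟨⟨0, hN⟩⟩
  exact Finset.sum_pos (fun i _ => h1 i) Finset.univ_nonempty

lemma n_le [IsProbabilityMeasure P] (N : ℕ) : n N ≤ N := by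
  have h1 : ∀ᵐ ω ∂P, ∀ i, π N i ω ≤ 1 := ae_all_iff.2 (hs.le_one N)
  obtain ⟨ω, h1, h2⟩ := (h1.and (hs.sum_eq N)).exists
  rw [← h2]
  calc ∑ i, π N i ω ≤ ∑ _i : Fin N, (1 : ℝ) := Finset.sum_le_sum fun i _ => h1 i
    _ = N := by simp

lemma ae_ipw_nonneg (N : ℕ) : ∀ᵐ ω ∂P, ∀ i, 0 ≤ ipw π R N i ω := by
  have h1 : ∀ᵐ ω ∂P, ∀ i, 0 < π N i ω := ae_all_iff.2 (hs.pos N)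
  filter_upwards [h1] with ω h1 i
  unfold ipw
  have := h1 i
  positivity

/-- The moment condition on a coordinate of the score says that it has small sampling variance. -/
lemma smallVar_of_weightedMoments [IsProbabilityMeasure P] {b : ℝ → ℝ} {out : Vec p × ℝ × ℝ → ℝ}
    {K : Set (Vec p)} {θ : Vec p} (hθ : θ ∈ K)
    (hmom : WeightedMoments P b X (fun i ω => out (unit X Y S i ω)) n π K) (j : Fin p) :
    SmallVar P X Y S π (fun z => (out z - deriv b (inner ℝ θ z.1)) * z.1 j) := by
  obtain ⟨h1, h2⟩ := hmom θ hθ j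
  have h3 := ENNReal.tendsto_ofReal h2.tendsto_div_nhds_zero
  rw [ENNReal.ofReal_zero] at h3
  refine h3.congr' ?_
  filter_upwards [h1, eventually_ge_atTop 1] with N h1 hN
  have hn := hs.n_pos hN
  have hN' : (0 : ℝ) < N := by exact_mod_cast hN
  have hpos : ∀ᵐ ω ∂P, ∀ i, 0 < π N i ω := ae_all_iff.2 (hs.pos N)
  rw [← integral_finsetSum _ fun i _ => h1 i, ← integral_div,
    ofReal_integral_eq_lintegral_ofReal ((integrable_finsetSum _ fun i _ => h1 i).div_const _)]
  · refine lintegral_congr fun ω => ?_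
    congr 1
    rw [Finset.sum_div, Finset.mul_sum]
    refine Finset.sum_congr rfl fun i _ => ?_
    simp only [unit]
    rw [div_div_eq_mul_div]
    field_simp
    ring
  · filter_upwards [hpos] with ω hpos
    refine div_nonneg (Finset.sum_nonneg fun i _ => ?_) (by positivity)
    have := hpos i
    positivity

variable (hiid : IsIIDSample P X Y S)
include hiid

lemma measurable_sum_ipw_mul (hf : Measurable f) (N : ℕ) :
    Measurable fun ω => ∑ i : Fin N, ipw π R N i ω * f (unit X Y S i ω) :=
  Finset.measurable_fun_sum _ fun i _ =>
    (hs.measurable_ipw hiid N i).mul (hf.comp (hiid.measurable_unit i))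

/-- Weighted law of large numbers: the sampling error of the weighted mean has vanishing variance,
and what remains is the full-data mean. -/
lemma tendsto_wmean_ipw [IsProbabilityMeasure P] (hf : Measurable f)
    (hint : Integrable (fun ω => f (unit X Y S 0 ω)) P) (hsv : SmallVar P X Y S π f) :
    Tendsto (wmean X Y S (ipw π R) f) (whp P) (𝓝 (∫ ω, f (unit X Y S 0 ω) ∂P)) := by
  have hm : ∀ N : ℕ, Measurable fun ω => ((N : ℝ)⁻¹ *
      ∑ i : Fin N, (ipw π R N i ω - 1) * f (unit X Y S i ω)) ^ 2 := fun N =>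
    ((Finset.measurable_fun_sum _ fun i _ => ((hs.measurable_ipw hiid N i).sub_const 1).mul
      (hf.comp (hiid.measurable_unit i))).const_mul _).pow_const 2
  have h1 : Tendsto (fun q : ℕ × Ω => (q.1 : ℝ)⁻¹ *
      ∑ i : Fin q.1, (ipw π R q.1 i q.2 - 1) * f (unit X Y S i q.2)) (whp P) (𝓝 0) := by
    refine tendsto_zero_of_sq_tendsto_zero ?_
    refine tendsto_whp_zero_of_lintegral (F := fun N ω => ((N : ℝ)⁻¹ *
      ∑ i : Fin N, (ipw π R N i ω - 1) * f (unit X Y S i ω)) ^ 2) hm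
      (fun N => Eventually.of_forall fun ω => sq_nonneg _) ?_
    refine tendsto_of_tendsto_of_tendsto_of_le_of_le tendsto_const_nhds hsv (fun _ => zero_le) ?_
    intro N
    have h2 : ∀ᵐ ω ∂P, ∀ i, 0 < π N i ω := ae_all_iff.2 (hs.pos N)
    have h3 := hs.lintegral_sq_sum_ipw_sub_one hiid N hf 0
    simp only [zero_add, ne_eq, OfNat.ofNat_ne_zero, not_false_eq_true, zero_pow,
      ENNReal.ofReal_zero] at h3
    simp only [mul_pow, ENNReal.ofReal_mul (sq_nonneg ((N : ℝ)⁻¹))]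
    rw [lintegral_const_mul' _ _ ENNReal.ofReal_ne_top,
      lintegral_const_mul' _ _ ENNReal.ofReal_ne_top, h3]
    gcongr _ * ?_
    refine lintegral_mono_ae ?_
    filter_upwards [h2] with ω h2
    refine ENNReal.ofReal_le_ofReal (Finset.sum_le_sum fun i _ => ?_)
    rw [one_div, div_eq_inv_mul]
    exact mul_le_mul_of_nonneg_right (by linarith) (sq_nonneg _)
  have h4 := h1.add (hiid.tendsto_wmean_unitWeight hf hint)
  rw [zero_add] at h4
  refine h4.congr fun q => ?_
  rw [wmean, wmean, ← mul_add, ← Finset.sum_add_distrib]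
  congr 1
  refine Finset.sum_congr rfl fun i _ => ?_
  simp only [unitWeight]
  ring

lemma bddInProb_wmean_ipw [IsProbabilityMeasure P] (hf : Measurable f) (h0 : ∀ z, 0 ≤ f z)
    (hint : Integrable (fun ω => f (unit X Y S 0 ω)) P) :
    BddInProb P (wmean X Y S (ipw π R) f) := by
  have hC : ∫⁻ ω, ENNReal.ofReal (f (unit X Y S 0 ω)) ∂P ≠ ⊤ := hint.lintegral_lt_top.ne
  refine BddInProb.of_lintegral (F := fun N ω => wmean X Y S (ipw π R) f (N, ω))
    (fun N => (hs.measurable_sum_ipw_mul hiid hf N).const_mul (N : ℝ)⁻¹) ?_ hC ?_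
  · intro N
    filter_upwards [hs.ae_ipw_nonneg N] with ω h
    exact mul_nonneg (by positivity) (Finset.sum_nonneg fun i _ => mul_nonneg (h i) (h0 _))
  · filter_upwards [eventually_ge_atTop 1] with N hN
    have hN' : (0 : ℝ) < N := by exact_mod_cast hN
    simp only [wmean, ENNReal.ofReal_mul (inv_nonneg.2 hN'.le)]
    rw [lintegral_const_mul' _ _ ENNReal.ofReal_ne_top, hs.lintegral_sum_ipw_mul hiid N hf h0,
      hiid.lintegral_sum hf h0, ← mul_assoc, ENNReal.ofReal_inv_of_pos hN', ENNReal.ofReal_natCast,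
      ENNReal.inv_mul_cancel (by exact_mod_cast hN'.ne') (ENNReal.natCast_ne_top N), one_mul]

lemma integrable_sq_of_weightedMoments [IsProbabilityMeasure P] {b : ℝ → ℝ}
    (hb : Measurable (deriv b)) {out : Vec p × ℝ × ℝ → ℝ} (hout : Measurable out)
    {K : Set (Vec p)} {θ : Vec p} (hθ : θ ∈ K)
    (hmom : WeightedMoments P b X (fun i ω => out (unit X Y S i ω)) n π K) (j : Fin p) :
    Integrable (fun ω => ((out (unit X Y S 0 ω) - deriv b (inner ℝ θ (X 0 ω))) * X 0 ω j) ^ 2) P ∧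
    ∀ᶠ N in atTop, ∀ i : Fin N, Integrable (fun ω =>
      ((out (unit X Y S i ω) - deriv b (inner ℝ θ (X i ω))) * X i ω j) ^ 2 / π N i ω) P := by
  obtain ⟨h1, -⟩ := hmom θ hθ j
  have h2 : ∀ᶠ N in atTop, ∀ i : Fin N, Integrable (fun ω =>
      ((out (unit X Y S i ω) - deriv b (inner ℝ θ (X i ω))) * X i ω j) ^ 2 / π N i ω) P := by
    filter_upwards [h1, eventually_ge_atTop 1] with N h1 hN i
    have hn := hs.n_pos hN
    refine ((h1 i).div_const (n N)).congr (Eventually.of_forall fun ω => ?_)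
    simp only
    rw [div_div_eq_mul_div]
    field_simp
    ring
  refine ⟨?_, h2⟩
  obtain ⟨N, h3, hN⟩ := (h2.and (eventually_ge_atTop 1)).exists
  refine (h3 ⟨0, hN⟩).mono ?_ ?_
  · have hX := hiid.measurable_X 0
    have hu := hiid.measurable_unit 0
    exact (((hout.comp hu).sub (hb.comp (by fun_prop))).mul (by fun_prop)).pow_const 2
      |>.aestronglyMeasurable
  · filter_upwards [hs.pos N ⟨0, hN⟩, hs.le_one N ⟨0, hN⟩] with ω h4 h5
    rw [Real.norm_of_nonneg (sq_nonneg _), Real.norm_of_nonneg (by positivity)]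
    exact le_div_self (sq_nonneg _) h4 h5

end SurrogateGLM.IsPoissonSampling

end LawsOfLargeNumbers

/-! ### Consistency of the solutions of the score equations -/

section Consistency

variable {Ω : Type*} [MeasurableSpace Ω] {p : ℕ} {P : Measure Ω}

/-- Consistency of approximate zeros: if `Ψ_N → -g` in probability pointwise on the compact set `K`,
`Ψ_N` is Lipschitz on `K` with a tight constant, and `θ₀` is a well-separated zero of `g`, then zeros
of `Ψ_N` in `K` converge to `θ₀`. A finite net of `K` makes the convergence uniform. -/
lemma tendsto_of_wellSeparated {K : Set (Vec p)} (hK : IsCompact K) {g : Vec p → Vec p}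
    {θ₀ : Vec p} (hsep : WellSeparated g θ₀ K) {Ψ : Vec p → ℕ × Ω → Vec p}
    (hΨ : ∀ θ ∈ K, Tendsto (Ψ θ) (whp P) (𝓝 (-g θ))) {W : ℕ × Ω → ℝ} (hW : BddInProb P W)
    (hLip : ∀ᶠ q in whp P, ∀ θ ∈ K, ∀ θ' ∈ K, ‖Ψ θ q - Ψ θ' q‖ ≤ W q * ‖θ - θ'‖)
    {L : ℝ} (hL : 0 ≤ L) (hg : ∀ θ ∈ K, ∀ θ' ∈ K, ‖g θ - g θ'‖ ≤ L * ‖θ - θ'‖)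
    {θhat : ℕ × Ω → Vec p} (hθ : ∀ᶠ q in whp P, θhat q ∈ K ∧ Ψ (θhat q) q = 0) :
    Tendsto θhat (whp P) (𝓝 θ₀) ∧ Tendsto (fun q => g (θhat q)) (whp P) (𝓝 0) := by
  have hg0 : Tendsto (fun q => g (θhat q)) (whp P) (𝓝 0) := by
    rw [Metric.tendsto_nhds]
    intro ε hε
    refine eventually_whp_of_measure_le fun η hη => ?_
    have hη2 : 0 < η / 2 := ENNReal.half_pos hη.ne'
    obtain ⟨C, hC, h1⟩ := hW (η / 2) hη2
    have hρ : 0 < ε / (3 * (C + L + 1)) := by positivity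
    obtain ⟨t, htK, htf, ht⟩ := hK.finite_cover_balls hρ
    have h2 : ∀ᶠ q in whp P, ∀ k ∈ t, ‖Ψ k q + g k‖ < ε / 3 := by
      refine (eventually_all_finite htf).2 fun k hk => ?_
      have h3 := (hΨ k (htK hk)).add_const (g k)
      rw [neg_add_cancel] at h3
      have h4 := h3.norm
      rw [norm_zero] at h4
      exact h4.eventually (gt_mem_nhds (by positivity))
    filter_upwards [h1, ((h2.and hLip).and hθ).measure_not_le hη2] with N h1 h2
    have hsub : {ω | ¬ dist (g (θhat (N, ω))) 0 < ε} ⊆ {ω | ¬ |W (N, ω)| ≤ C} ∪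
        {ω | ¬ (((∀ k ∈ t, ‖Ψ k (N, ω) + g k‖ < ε / 3) ∧ ∀ θ ∈ K, ∀ θ' ∈ K,
          ‖Ψ θ (N, ω) - Ψ θ' (N, ω)‖ ≤ W (N, ω) * ‖θ - θ'‖) ∧
          θhat (N, ω) ∈ K ∧ Ψ (θhat (N, ω)) (N, ω) = 0)} := by
      intro ω hω
      by_contra hcon
      simp only [Set.mem_union, Set.mem_ofPred_eq, not_or, not_not] at hcon
      obtain ⟨hWC, ⟨hnet, hlip⟩, hmem, hzero⟩ := hcon
      refine hω ?_
      rw [dist_zero_right]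
      obtain ⟨k, hkt, hk⟩ := Set.mem_iUnion₂.1 (ht hmem)
      rw [Metric.mem_ball, dist_eq_norm] at hk
      have e1 := hlip k (htK hkt) _ hmem
      have e2 := hg _ hmem k (htK hkt)
      rw [hzero, sub_zero, norm_sub_rev] at e1
      have e3 : g (θhat (N, ω)) =
          (g (θhat (N, ω)) - g k) + ((Ψ k (N, ω) + g k) - Ψ k (N, ω)) := by abel
      have e4 : W (N, ω) * ‖θhat (N, ω) - k‖ ≤ C * ‖θhat (N, ω) - k‖ :=
        mul_le_mul_of_nonneg_right ((le_abs_self _).trans hWC) (norm_nonneg _)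
      have e5 : (C + L) * ‖θhat (N, ω) - k‖ ≤ ε / 3 := by
        calc (C + L) * ‖θhat (N, ω) - k‖ ≤ (C + L + 1) * (ε / (3 * (C + L + 1))) := by
              exact mul_le_mul (by linarith) hk.le (norm_nonneg _) (by positivity)
          _ = ε / 3 := by field_simp
      calc ‖g (θhat (N, ω))‖
          ≤ ‖g (θhat (N, ω)) - g k‖ + (‖Ψ k (N, ω) + g k‖ + ‖Ψ k (N, ω)‖) := by
            conv_lhs => rw [e3]
            exact (norm_add_le _ _).trans (add_le_add le_rfl (norm_sub_le _ _))
        _ < ε := by linarith [hnet k hkt]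
    calc P {ω | ¬ dist (g (θhat (N, ω))) 0 < ε} ≤ η / 2 + η / 2 :=
          ((measure_mono hsub).trans (measure_union_le _ _)).trans (add_le_add h1 h2)
      _ = η := ENNReal.add_halves η
  refine ⟨?_, hg0⟩
  rw [Metric.tendsto_nhds]
  intro ε hε
  obtain ⟨δ, hδ, h⟩ := hsep ε hε
  filter_upwards [hθ, (Metric.tendsto_nhds.1 hg0) δ hδ] with q h1 h2
  rw [dist_eq_norm]
  rw [dist_zero_right] at h2
  by_contra hcon
  exact absurd (h _ h1.1 (not_lt.1 hcon)) (not_le.2 h2)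

end Consistency

section Scores

variable {Ω : Type*} [MeasurableSpace Ω] {p : ℕ} {P : Measure Ω}
  {X : ℕ → Ω → Vec p} {Y S : ℕ → Ω → ℝ} {n : ℕ → ℝ}
  {π : (N : ℕ) → Fin N → Ω → ℝ} {R : (N : ℕ) → Fin N → Ω → Bool}
  {b : ℝ → ℝ} {out : Vec p × ℝ × ℝ → ℝ} {w : (N : ℕ) → Fin N → Ω → ℝ}

/-- The `j`-th coordinate of the score contribution of a unit; `out` selects the outcome. -/
noncomputable def scoreCoord (b : ℝ → ℝ) (out : Vec p × ℝ × ℝ → ℝ) (θ : Vec p) (j : Fin p)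
    (z : Vec p × ℝ × ℝ) : ℝ :=
  (out z - deriv b (inner ℝ θ z.1)) * z.1 j

/-- The weighted mean of the score contributions. -/
noncomputable def meanScore (X : ℕ → Ω → Vec p) (Y S : ℕ → Ω → ℝ) (w : (N : ℕ) → Fin N → Ω → ℝ)
    (b : ℝ → ℝ) (out : Vec p × ℝ × ℝ → ℝ) (θ : Vec p) (q : ℕ × Ω) : Vec p :=
  (q.1 : ℝ)⁻¹ • ∑ i : Fin q.1, w q.1 i q.2 •
    scoreTerm b θ (unit X Y S i q.2).1 (out (unit X Y S i q.2))

omit [MeasurableSpace Ω] in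
lemma meanScore_apply (θ : Vec p) (q : ℕ × Ω) (j : Fin p) :
    meanScore X Y S w b out θ q j = wmean X Y S w (scoreCoord b out θ j) q := by
  simp [meanScore, wmean, scoreCoord, scoreTerm, Finset.mul_sum]

lemma measurable_scoreCoord (hb : Measurable (deriv b)) (hout : Measurable out) (θ : Vec p)
    (j : Fin p) : Measurable (scoreCoord b out θ j) :=
  (hout.sub (hb.comp (by fun_prop))).mul (by fun_prop)

lemma tendsto_vec {ι : Type*} {l : Filter ι} {F : ι → Vec p} {v : Vec p}
    (h : ∀ j, Tendsto (fun q => F q j) l (𝓝 (v j))) : Tendsto F l (𝓝 v) := by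
  have h1 : Tendsto (fun q => (F q).ofLp) l (𝓝 v.ofLp) := tendsto_pi_nhds.2 h
  exact ((PiLp.continuous_toLp 2 _).tendsto v.ofLp).comp h1

lemma integrable_scoreCoord {θ : Vec p}
    (hint : Integrable (fun ω => (deriv b (inner ℝ θ (X 0 ω)) - out (unit X Y S 0 ω)) • X 0 ω) P)
    (j : Fin p) : Integrable (fun ω => scoreCoord b out θ j (unit X Y S 0 ω)) P := by
  have h1 := ((EuclideanSpace.proj (𝕜 := ℝ) j).integrable_comp hint).neg
  refine h1.congr (Eventually.of_forall fun ω => ?_)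
  simp [scoreCoord, unit]
  ring

lemma popScore_apply {θ : Vec p}
    (hint : Integrable (fun ω => (deriv b (inner ℝ θ (X 0 ω)) - out (unit X Y S 0 ω)) • X 0 ω) P)
    (j : Fin p) : popScore P b (X 0) (fun ω => out (unit X Y S 0 ω)) θ j =
      -∫ ω, scoreCoord b out θ j (unit X Y S 0 ω) ∂P := by
  have h1 := (EuclideanSpace.proj (𝕜 := ℝ) j).integral_comp_comm hint
  rw [← integral_neg]
  refine h1.symm.trans (integral_congr_ae (Eventually.of_forall fun ω => ?_))
  simp [scoreCoord, unit]
  ring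

/-- One bound for `b''` serves all the linear predictors `θᵀXᵢ` with `‖θ‖ ≤ r`, whether because `b''`
is bounded or because the covariates are. -/
lemma exists_curvature_bound [IsProbabilityMeasure P] (hiid : IsIIDSample P X Y S)
    (hb : Continuous (deriv (deriv b))) (r : ℝ)
    (h : (∃ C, ∀ t, |deriv (deriv b) t| ≤ C) ∨ ∃ C, ∀ᵐ ω ∂P, ‖X 0 ω‖ ≤ C) :
    ∃ L, 0 ≤ L ∧ ∀ᵐ ω ∂P, ∀ i, ∀ t, |t| ≤ r * ‖X i ω‖ → |deriv (deriv b) t| ≤ L := by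
  rcases h with ⟨C, hC⟩ | ⟨C, hC⟩
  · exact ⟨C, (abs_nonneg _).trans (hC 0), Eventually.of_forall fun ω i t _ => hC t⟩
  · have h1 : ∀ᵐ ω ∂P, ∀ i, ‖X i ω‖ ≤ C :=
      hiid.ae_forall (s := {z | ‖z.1‖ ≤ C}) (measurableSet_le (by fun_prop) (by fun_prop)) hC
    obtain ⟨L, hL⟩ := (isCompact_Icc (a := -(|r| * C)) (b := |r| * C)).exists_bound_of_continuousOn
      hb.continuousOn
    refine ⟨max L 0, le_max_right _ _, ?_⟩
    filter_upwards [h1] with ω h1 i t ht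
    refine (hL t (abs_le.1 (ht.trans ?_))).trans (le_max_left _ _)
    calc r * ‖X i ω‖ ≤ |r| * ‖X i ω‖ :=
          mul_le_mul_of_nonneg_right (le_abs_self r) (norm_nonneg _)
      _ ≤ |r| * C := mul_le_mul_of_nonneg_left (h1 i) (abs_nonneg _)

lemma abs_inner_le_of_norm_le {θ x : Vec p} {r : ℝ} (hθ : ‖θ‖ ≤ r) :
    |inner ℝ θ x| ≤ r * ‖x‖ :=
  (abs_real_inner_le_norm θ x).trans (mul_le_mul_of_nonneg_right hθ (norm_nonneg _))

lemma abs_deriv_inner_sub_le (hb : Differentiable ℝ (deriv b)) {θ θ' x : Vec p} {r L : ℝ}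
    (hL : ∀ t, |t| ≤ r * ‖x‖ → |deriv (deriv b) t| ≤ L) (hθ : ‖θ‖ ≤ r) (hθ' : ‖θ'‖ ≤ r) :
    |deriv b (inner ℝ θ x) - deriv b (inner ℝ θ' x)| ≤ L * (‖θ - θ'‖ * ‖x‖) := by
  have hL0 : 0 ≤ L := (abs_nonneg _).trans (hL _ (abs_inner_le_of_norm_le hθ))
  have h := (convex_Icc (-(r * ‖x‖)) (r * ‖x‖)).norm_image_sub_le_of_norm_deriv_le
    (f := deriv b) (C := L) (fun t _ => hb t) (fun t ht => hL t (abs_le.2 ht))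
    (abs_le.1 (abs_inner_le_of_norm_le (x := x) hθ'))
    (abs_le.1 (abs_inner_le_of_norm_le (x := x) hθ))
  rw [Real.norm_eq_abs, Real.norm_eq_abs, ← inner_sub_left] at h
  exact h.trans (mul_le_mul_of_nonneg_left (abs_real_inner_le_norm _ _) hL0)

lemma norm_scoreTerm_sub_le (hb : Differentiable ℝ (deriv b)) {θ θ' x : Vec p} {r L y : ℝ}
    (hL : ∀ t, |t| ≤ r * ‖x‖ → |deriv (deriv b) t| ≤ L) (hθ : ‖θ‖ ≤ r) (hθ' : ‖θ'‖ ≤ r) :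
    ‖scoreTerm b θ x y - scoreTerm b θ' x y‖ ≤ L * ‖x‖ ^ 2 * ‖θ - θ'‖ := by
  have h := abs_deriv_inner_sub_le hb hL hθ' hθ
  rw [norm_sub_rev] at h
  rw [scoreTerm, scoreTerm, ← sub_smul, norm_smul, Real.norm_eq_abs, sub_sub_sub_cancel_left]
  calc |deriv b (inner ℝ θ' x) - deriv b (inner ℝ θ x)| * ‖x‖
      ≤ L * (‖θ - θ'‖ * ‖x‖) * ‖x‖ := mul_le_mul_of_nonneg_right h (norm_nonneg _)
    _ = L * ‖x‖ ^ 2 * ‖θ - θ'‖ := by ring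

omit [MeasurableSpace Ω] in
lemma norm_meanScore_sub_le (hb : Differentiable ℝ (deriv b)) {θ θ' : Vec p} {r L : ℝ}
    {q : ℕ × Ω} (hw : ∀ i, 0 ≤ w q.1 i q.2)
    (hL : ∀ i, ∀ t, |t| ≤ r * ‖X i q.2‖ → |deriv (deriv b) t| ≤ L)
    (hθ : ‖θ‖ ≤ r) (hθ' : ‖θ'‖ ≤ r) :
    ‖meanScore X Y S w b out θ q - meanScore X Y S w b out θ' q‖ ≤
      (L * wmean X Y S w (fun z => ‖z.1‖ ^ 2) q) * ‖θ - θ'‖ := by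
  rw [meanScore, meanScore, ← smul_sub, ← Finset.sum_sub_distrib, norm_smul,
    Real.norm_of_nonneg (by positivity), wmean]
  calc (q.1 : ℝ)⁻¹ * ‖∑ i : Fin q.1, (w q.1 i q.2 • scoreTerm b θ (unit X Y S i q.2).1
          (out (unit X Y S i q.2)) - w q.1 i q.2 • scoreTerm b θ' (unit X Y S i q.2).1
          (out (unit X Y S i q.2)))‖
      ≤ (q.1 : ℝ)⁻¹ * ∑ i : Fin q.1, w q.1 i q.2 * (L * ‖X i q.2‖ ^ 2 * ‖θ - θ'‖) := by
        refine mul_le_mul_of_nonneg_left ((norm_sum_le _ _).trans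
          (Finset.sum_le_sum fun i _ => ?_)) (by positivity)
        rw [← smul_sub, norm_smul, Real.norm_of_nonneg (hw i)]
        exact mul_le_mul_of_nonneg_left (norm_scoreTerm_sub_le hb (hL i) hθ hθ') (hw i)
    _ = L * ((q.1 : ℝ)⁻¹ * ∑ i : Fin q.1, w q.1 i q.2 * ‖(unit X Y S i q.2).1‖ ^ 2) *
          ‖θ - θ'‖ := by
        simp only [Finset.mul_sum, Finset.sum_mul]
        refine Finset.sum_congr rfl fun i _ => ?_
        simp only [unit]
        ring

lemma norm_popScore_sub_le (hb : Differentiable ℝ (deriv b)) {Z : Ω → ℝ} {X₀ : Ω → Vec p}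
    {θ θ' : Vec p} {r L : ℝ}
    (hL : ∀ᵐ ω ∂P, ∀ t, |t| ≤ r * ‖X₀ ω‖ → |deriv (deriv b) t| ≤ L)
    (hX : Integrable (fun ω => ‖X₀ ω‖ ^ 2) P)
    (hint : Integrable (fun ω => (deriv b (inner ℝ θ (X₀ ω)) - Z ω) • X₀ ω) P)
    (hint' : Integrable (fun ω => (deriv b (inner ℝ θ' (X₀ ω)) - Z ω) • X₀ ω) P)
    (hθ : ‖θ‖ ≤ r) (hθ' : ‖θ'‖ ≤ r) :
    ‖popScore P b X₀ Z θ - popScore P b X₀ Z θ'‖ ≤ (L * ∫ ω, ‖X₀ ω‖ ^ 2 ∂P) * ‖θ - θ'‖ := by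
  rw [popScore, popScore, ← integral_sub hint hint']
  have h1 : (L * ∫ ω, ‖X₀ ω‖ ^ 2 ∂P) * ‖θ - θ'‖ = ∫ ω, L * ‖X₀ ω‖ ^ 2 * ‖θ - θ'‖ ∂P := by
    rw [integral_mul_const, integral_const_mul]
  rw [h1]
  refine norm_integral_le_of_norm_le ((hX.const_mul L).mul_const _) ?_
  filter_upwards [hL] with ω hL
  have h := norm_scoreTerm_sub_le (y := Z ω) hb hL hθ' hθ
  rw [norm_sub_rev θ θ']
  refine le_trans (le_of_eq ?_) h
  rw [scoreTerm, scoreTerm, ← sub_smul, ← sub_smul, sub_sub_sub_cancel_right,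
    sub_sub_sub_cancel_left]

/-- The weights `wᵢ` behave like sampling weights for the score of `b`: they are nonnegative, the
weighted second moments of the covariates are tight, and the weighted means of the score coordinates
obey the law of large numbers on `K`. -/
structure GoodWeights (P : Measure Ω) (X : ℕ → Ω → Vec p) (Y S : ℕ → Ω → ℝ)
    (w : (N : ℕ) → Fin N → Ω → ℝ) (b : ℝ → ℝ) (out : Vec p × ℝ × ℝ → ℝ) (K : Set (Vec p)) :
    Prop where
  nonneg : ∀ N, ∀ᵐ ω ∂P, ∀ i, 0 ≤ w N i ω
  bdd : BddInProb P (wmean X Y S w fun z => ‖z.1‖ ^ 2)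
  lln : ∀ θ ∈ K, ∀ j, Tendsto (wmean X Y S w (scoreCoord b out θ j)) (whp P)
    (𝓝 (∫ ω, scoreCoord b out θ j (unit X Y S 0 ω) ∂P))

lemma goodWeights_unitWeight [IsProbabilityMeasure P] (hiid : IsIIDSample P X Y S)
    (hb : Measurable (deriv b)) (hout : Measurable out) {K : Set (Vec p)}
    (hX : Integrable (fun ω => ‖X 0 ω‖ ^ 2) P)
    (hint : ∀ θ ∈ K, Integrable
      (fun ω => (deriv b (inner ℝ θ (X 0 ω)) - out (unit X Y S 0 ω)) • X 0 ω) P) :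
    GoodWeights P X Y S unitWeight b out K where
  nonneg N := Eventually.of_forall fun ω i => zero_le_one
  bdd := BddInProb.of_tendsto
    (hiid.tendsto_wmean_unitWeight (f := fun z => ‖z.1‖ ^ 2) (by fun_prop) hX)
  lln θ hθ j := hiid.tendsto_wmean_unitWeight (measurable_scoreCoord hb hout θ j)
    (integrable_scoreCoord (hint θ hθ) j)

lemma goodWeights_ipw [IsProbabilityMeasure P] (hiid : IsIIDSample P X Y S)
    (hs : IsPoissonSampling P X Y S n π R)
    (hb : Measurable (deriv b)) (hout : Measurable out) {K : Set (Vec p)}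
    (hX : Integrable (fun ω => ‖X 0 ω‖ ^ 2) P)
    (hint : ∀ θ ∈ K, Integrable
      (fun ω => (deriv b (inner ℝ θ (X 0 ω)) - out (unit X Y S 0 ω)) • X 0 ω) P)
    (hmom : WeightedMoments P b X (fun i ω => out (unit X Y S i ω)) n π K) :
    GoodWeights P X Y S (ipw π R) b out K where
  nonneg N := hs.ae_ipw_nonneg N
  bdd := hs.bddInProb_wmean_ipw hiid (f := fun z => ‖z.1‖ ^ 2) (by fun_prop)
    (fun z => sq_nonneg _) hX
  lln θ hθ j := hs.tendsto_wmean_ipw hiid (measurable_scoreCoord hb hout θ j)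
    (integrable_scoreCoord (hint θ hθ) j) (hs.smallVar_of_weightedMoments hθ hmom j)

/-- Consistency of the solution of a weighted score equation. The law of large numbers also shows
that the population score vanishes at `θ₀`. -/
lemma GoodWeights.consistent [IsProbabilityMeasure P] (hiid : IsIIDSample P X Y S)
    {K : Set (Vec p)} (hw : GoodWeights P X Y S w b out K) (hK : IsCompact K)
    (hb : Differentiable ℝ (deriv b)) (hb' : Continuous (deriv (deriv b)))
    (hbdd : (∃ C, ∀ t, |deriv (deriv b) t| ≤ C) ∨ ∃ C, ∀ᵐ ω ∂P, ‖X 0 ω‖ ≤ C)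
    (hX : Integrable (fun ω => ‖X 0 ω‖ ^ 2) P)
    (hint : ∀ θ ∈ K, Integrable
      (fun ω => (deriv b (inner ℝ θ (X 0 ω)) - out (unit X Y S 0 ω)) • X 0 ω) P)
    {θ₀ : Vec p} (hθ₀ : θ₀ ∈ K)
    (hsep : WellSeparated (popScore P b (X 0) fun ω => out (unit X Y S 0 ω)) θ₀ K)
    {θhat : ℕ × Ω → Vec p}
    (hθ : ∀ᶠ q in whp P, θhat q ∈ K ∧ meanScore X Y S w b out (θhat q) q = 0) :
    Tendsto θhat (whp P) (𝓝 θ₀) ∧ popScore P b (X 0) (fun ω => out (unit X Y S 0 ω)) θ₀ = 0 := by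
  obtain ⟨r, hr⟩ := hK.isBounded.exists_norm_le
  obtain ⟨L, hL0, hL⟩ := exists_curvature_bound hiid hb' r hbdd
  have hpop : ∀ θ ∈ K, ∀ θ' ∈ K, ‖popScore P b (X 0) (fun ω => out (unit X Y S 0 ω)) θ -
      popScore P b (X 0) (fun ω => out (unit X Y S 0 ω)) θ'‖ ≤
        (L * ∫ ω, ‖X 0 ω‖ ^ 2 ∂P) * ‖θ - θ'‖ := fun θ h θ' h' =>
    norm_popScore_sub_le hb (hL.mono fun ω h => h 0) hX (hint θ h) (hint θ' h') (hr θ h) (hr θ' h')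
  have hM0 : 0 ≤ L * ∫ ω, ‖X 0 ω‖ ^ 2 ∂P :=
    mul_nonneg hL0 (integral_nonneg fun ω => sq_nonneg _)
  have hlip : ∀ᶠ q in whp P, ∀ θ ∈ K, ∀ θ' ∈ K,
      ‖meanScore X Y S w b out θ q - meanScore X Y S w b out θ' q‖ ≤
        (L * wmean X Y S w (fun z => ‖z.1‖ ^ 2) q) * ‖θ - θ'‖ := by
    refine eventually_whp_of_ae (Eventually.of_forall fun N => ?_)
    filter_upwards [hw.nonneg N, hL] with ω h1 h2 θ h θ' h'
    exact norm_meanScore_sub_le (q := (N, ω)) hb h1 h2 (hr θ h) (hr θ' h')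
  obtain ⟨h1, h2⟩ := tendsto_of_wellSeparated hK hsep (Ψ := meanScore X Y S w b out)
    (fun θ h => tendsto_vec fun j => by
      rw [PiLp.neg_apply, popScore_apply (hint θ h), neg_neg]
      simpa only [meanScore_apply] using hw.lln θ h j)
    ((BddInProb.const L).mul hw.bdd) hlip hM0 hpop hθ
  refine ⟨h1, ?_⟩
  have h3 : Tendsto (fun q => popScore P b (X 0) (fun ω => out (unit X Y S 0 ω)) (θhat q) -
      popScore P b (X 0) (fun ω => out (unit X Y S 0 ω)) θ₀) (whp P) (𝓝 0) := by
    have h4 : Tendsto (fun q => (L * ∫ ω, ‖X 0 ω‖ ^ 2 ∂P) * ‖θhat q - θ₀‖) (whp P) (𝓝 0) := by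
      have := ((h1.sub_const θ₀).norm).const_mul (L * ∫ ω, ‖X 0 ω‖ ^ 2 ∂P)
      simpa using this
    refine squeeze_zero_norm' ?_ h4
    filter_upwards [hθ] with q hq
    exact hpop _ hq.1 _ hθ₀
  have h5 := h2.sub h3
  simp only [sub_sub_cancel, sub_zero] at h5
  exact tendsto_nhds_unique tendsto_const_nhds h5

end Scores

/-! ### The augmented estimator with consistent covariance estimates -/

section Augmented

variable {Ω : Type*} [MeasurableSpace Ω] {p : ℕ} {P : Measure Ω}
  {X : ℕ → Ω → Vec p} {Y S : ℕ → Ω → ℝ} {n : ℕ → ℝ}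
  {π : (N : ℕ) → Fin N → Ω → ℝ} {R : (N : ℕ) → Fin N → Ω → Bool}
  {b : ℝ → ℝ} {out : Vec p × ℝ × ℝ → ℝ}

lemma integrable_norm_sq {X₀ : Ω → Vec p}
    (h : ∀ j k, Integrable (fun ω => X₀ ω j * X₀ ω k) P) :
    Integrable (fun ω => ‖X₀ ω‖ ^ 2) P := by
  refine (integrable_finsetSum Finset.univ fun j _ => h j j).congr
    (Eventually.of_forall fun ω => ?_)
  simp only [EuclideanSpace.real_norm_sq_eq]
  exact Finset.sum_congr rfl fun j _ => (sq _).symm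

lemma eventually_meanScore_ipw_eq_zero {K : Set (Vec p)} {θhat : ℕ → Ω → Vec p}
    (h : IsEstimator P (weightedScore b X (fun i ω => out (unit X Y S i ω)) π R) K θhat) :
    ∀ᶠ q in whp P, θhat q.1 q.2 ∈ K ∧
      meanScore X Y S (ipw π R) b out (θhat q.1 q.2) q = 0 := by
  have h1 : ∀ᶠ q in whp P, θhat q.1 q.2 ∈ K ∧
      weightedScore b X (fun i ω => out (unit X Y S i ω)) π R q.1 (θhat q.1 q.2) q.2 = 0 := h.2
  filter_upwards [h1] with q hq
  refine ⟨hq.1, ?_⟩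
  have : meanScore X Y S (ipw π R) b out (θhat q.1 q.2) q = (q.1 : ℝ)⁻¹ •
    weightedScore b X (fun i ω => out (unit X Y S i ω)) π R q.1 (θhat q.1 q.2) q.2 := rfl
  rw [this, hq.2, smul_zero]

lemma eventually_meanScore_unitWeight_eq_zero {K : Set (Vec p)} {θhat : ℕ → Ω → Vec p}
    (h : IsEstimator P (fullScore b X (fun i ω => out (unit X Y S i ω))) K θhat) :
    ∀ᶠ q in whp P, θhat q.1 q.2 ∈ K ∧
      meanScore X Y S unitWeight b out (θhat q.1 q.2) q = 0 := by
  have h1 : ∀ᶠ q in whp P, θhat q.1 q.2 ∈ K ∧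
      fullScore b X (fun i ω => out (unit X Y S i ω)) q.1 (θhat q.1 q.2) q.2 = 0 := h.2
  filter_upwards [h1] with q hq
  refine ⟨hq.1, ?_⟩
  have : meanScore X Y S unitWeight b out (θhat q.1 q.2) q = (q.1 : ℝ)⁻¹ •
      fullScore b X (fun i ω => out (unit X Y S i ω)) q.1 (θhat q.1 q.2) q.2 := by
    simp only [meanScore, fullScore, unitWeight, one_smul]
    rfl
  rw [this, hq.2, smul_zero]

lemma tendsto_matrix {ι : Type*} {l : Filter ι} {F : ι → Matrix (Fin p) (Fin p) ℝ}
    {M : Matrix (Fin p) (Fin p) ℝ} (h : ∀ j k, Tendsto (fun q => F q j k) l (𝓝 (M j k))) :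
    Tendsto F l (𝓝 M) := by
  refine tendsto_pi_nhds.2 fun j => ?_
  exact tendsto_pi_nhds.2 fun k => h j k

lemma tendsto_matrix_inv {ι : Type*} {l : Filter ι} {F : ι → Matrix (Fin p) (Fin p) ℝ}
    {M : Matrix (Fin p) (Fin p) ℝ} (h : Tendsto F l (𝓝 M)) (hM : M.det ≠ 0) :
    Tendsto (fun q => (F q)⁻¹) l (𝓝 M⁻¹) := by
  simp only [Matrix.inv_def, Ring.inverse_eq_inv']
  have h1 : Tendsto (fun q => (F q).det) l (𝓝 M.det) :=
    ((continuous_id.matrix_det).tendsto M).comp h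
  have h2 : Tendsto (fun q => (F q).adjugate) l (𝓝 M.adjugate) :=
    ((continuous_id.matrix_adjugate).tendsto M).comp h
  exact (h1.inv₀ hM).smul h2

lemma tendstoInMeasure_augmented {βhat γhat γfull : ℕ → Ω → Vec p}
    {M₁₂ M₂₂ : ℕ → Ω → Matrix (Fin p) (Fin p) ℝ} {β₀ : Vec p}
    (hβ : Tendsto (fun q : ℕ × Ω => βhat q.1 q.2) (whp P) (𝓝 β₀))
    (h : Tendsto (fun q : ℕ × Ω => WithLp.toLp 2 ((M₁₂ q.1 q.2 * (M₂₂ q.1 q.2)⁻¹) *ᵥ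
      (γhat q.1 q.2 - γfull q.1 q.2).ofLp)) (whp P) (𝓝 (0 : Vec p))) :
    TendstoInMeasure P (augmented βhat γhat γfull M₁₂ M₂₂) atTop fun _ => β₀ := by
  rw [tendstoInMeasure_iff_whp]
  have h1 := hβ.sub h
  rw [sub_zero] at h1
  exact h1

lemma tendstoInMeasure_augmented_of_consistent {βhat γhat γfull : ℕ → Ω → Vec p}
    {M₁₂ M₂₂ : ℕ → Ω → Matrix (Fin p) (Fin p) ℝ} {β₀ γ₀ : Vec p}
    {V₁₂ V₂₂ : Matrix (Fin p) (Fin p) ℝ} (hV : V₂₂.det ≠ 0)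
    (hβ : Tendsto (fun q : ℕ × Ω => βhat q.1 q.2) (whp P) (𝓝 β₀))
    (hγ : Tendsto (fun q : ℕ × Ω => γhat q.1 q.2) (whp P) (𝓝 γ₀))
    (hγ' : Tendsto (fun q : ℕ × Ω => γfull q.1 q.2) (whp P) (𝓝 γ₀))
    (h₁ : ConsistentFor P M₁₂ V₁₂) (h₂ : ConsistentFor P M₂₂ V₂₂) :
    TendstoInMeasure P (augmented βhat γhat γfull M₁₂ M₂₂) atTop fun _ => β₀ := by
  refine tendstoInMeasure_augmented hβ ?_
  have h1 : Tendsto (fun q : ℕ × Ω => M₁₂ q.1 q.2) (whp P) (𝓝 V₁₂) :=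
    tendsto_matrix fun j k =>
      (tendstoInMeasure_iff_whp (f := fun N ω => M₁₂ N ω j k) (c := V₁₂ j k)).1 (h₁ j k)
  have h2 : Tendsto (fun q : ℕ × Ω => M₂₂ q.1 q.2) (whp P) (𝓝 V₂₂) :=
    tendsto_matrix fun j k =>
      (tendstoInMeasure_iff_whp (f := fun N ω => M₂₂ N ω j k) (c := V₂₂ j k)).1 (h₂ j k)
  have h3 := h1.mul (tendsto_matrix_inv h2 hV)
  have h4 := hγ.sub hγ'
  rw [sub_self] at h4
  have h5 : Tendsto (fun q : ℕ × Ω => (γhat q.1 q.2 - γfull q.1 q.2).ofLp) (whp P)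
      (𝓝 (0 : Vec p).ofLp) := ((PiLp.continuous_ofLp 2 _).tendsto _).comp h4
  have h6 : Continuous fun z : Matrix (Fin p) (Fin p) ℝ × (Fin p → ℝ) => z.1 *ᵥ z.2 :=
    continuous_fst.matrix_mulVec continuous_snd
  have h7 := (h6.tendsto _).comp (h3.prodMk_nhds h5)
  have h8 := ((PiLp.continuous_toLp 2 (fun _ : Fin p => ℝ)).tendsto _).comp h7
  simpa [Function.comp_def] using h8

end Augmented

/-! ### Curvature of the score and rates of convergence -/

section Curvature

variable {Ω : Type*} [MeasurableSpace Ω] {p : ℕ} {P : Measure Ω}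
  {X : ℕ → Ω → Vec p} {Y S : ℕ → Ω → ℝ} {n : ℕ → ℝ}
  {π : (N : ℕ) → Fin N → Ω → ℝ} {R : (N : ℕ) → Fin N → Ω → Bool}
  {b : ℝ → ℝ} {out : Vec p × ℝ × ℝ → ℝ} {w : (N : ℕ) → Fin N → Ω → ℝ}

lemma abs_coord_le_norm (a : Vec p) (j : Fin p) : |a j| ≤ ‖a‖ := by
  simpa using PiLp.norm_apply_le a j

/-- Quadratic forms that converge entrywise to a positive definite form are eventually bounded below
by a fixed multiple of the squared norm. -/
lemma exists_quadratic_lower_bound {ι : Type*} {l : Filter ι} {Q : Fin p → Fin p → ι → ℝ}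
    {M : Fin p → Fin p → ℝ} (hQ : ∀ j k, Tendsto (Q j k) l (𝓝 (M j k)))
    (hM : ∀ a : Vec p, a ≠ 0 → 0 < ∑ j, ∑ k, M j k * (a j * a k)) :
    ∃ c > 0, ∀ᶠ q in l, ∀ a : Vec p, c * ‖a‖ ^ 2 ≤ ∑ j, ∑ k, Q j k q * (a j * a k) := by
  obtain ⟨m, hm, hmin⟩ : ∃ m > 0, ∀ a : Vec p, m * ‖a‖ ^ 2 ≤ ∑ j, ∑ k, M j k * (a j * a k) := by
    have hcont : Continuous fun a : Vec p => ∑ j, ∑ k, M j k * (a j * a k) := by fun_prop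
    rcases (Metric.sphere (0 : Vec p) 1).eq_empty_or_nonempty with he | hne
    · refine ⟨1, one_pos, fun a => ?_⟩
      have ha : a = 0 := by
        by_contra ha
        have : (‖a‖⁻¹ • a) ∈ Metric.sphere (0 : Vec p) 1 := by
          simp [norm_smul, norm_ne_zero_iff.2 ha]
        rw [he] at this
        exact this
      simp [ha]
    · obtain ⟨a₀, ha₀, hmin⟩ := (isCompact_sphere (0 : Vec p) 1).exists_isMinOn hne
        hcont.continuousOn
      have ha0' : ‖a₀‖ = 1 := by simpa using ha₀
      refine ⟨_, hM a₀ (norm_ne_zero_iff.1 (by rw [ha0']; exact one_ne_zero)), fun a => ?_⟩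
      by_cases ha : a = 0
      · simp [ha]
      have hna : ‖a‖ ≠ 0 := norm_ne_zero_iff.2 ha
      have h1 : (‖a‖⁻¹ • a) ∈ Metric.sphere (0 : Vec p) 1 := by simp [norm_smul, hna]
      have h2 := hmin h1
      simp only [Set.mem_ofPred_eq] at h2
      have h3 : ∑ j, ∑ k, M j k * ((‖a‖⁻¹ • a) j * (‖a‖⁻¹ • a) k) =
          (‖a‖ ^ 2)⁻¹ * ∑ j, ∑ k, M j k * (a j * a k) := by
        simp only [Finset.mul_sum]
        refine Finset.sum_congr rfl fun j _ => Finset.sum_congr rfl fun k _ => ?_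
        simp only [PiLp.smul_apply, smul_eq_mul]
        field_simp
      rw [h3] at h2
      calc _ ≤ (‖a‖ ^ 2)⁻¹ * (∑ j, ∑ k, M j k * (a j * a k)) * ‖a‖ ^ 2 :=
            mul_le_mul_of_nonneg_right h2 (sq_nonneg _)
        _ = _ := by field_simp
  refine ⟨m / 2, by positivity, ?_⟩
  have h1 : Tendsto (fun q => ∑ j, ∑ k, |Q j k q - M j k|) l (𝓝 0) := by
    have : Tendsto (fun q => ∑ j, ∑ k, |Q j k q - M j k|) l (𝓝 (∑ _j : Fin p, ∑ _k : Fin p, 0)) :=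
      tendsto_finsetSum _ fun j _ => tendsto_finsetSum _ fun k _ => by
        have := ((hQ j k).sub_const (M j k)).abs
        simpa using this
    simpa using this
  filter_upwards [h1.eventually (gt_mem_nhds (half_pos hm))] with q hq a
  have h2 : ∑ j, ∑ k, M j k * (a j * a k) - ∑ j, ∑ k, Q j k q * (a j * a k) ≤
      (∑ j, ∑ k, |Q j k q - M j k|) * ‖a‖ ^ 2 := by
    rw [← Finset.sum_sub_distrib, Finset.sum_mul]
    refine Finset.sum_le_sum fun j _ => ?_
    rw [← Finset.sum_sub_distrib, Finset.sum_mul]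
    refine Finset.sum_le_sum fun k _ => ?_
    rw [← sub_mul, abs_sub_comm]
    refine (le_abs_self _).trans ?_
    rw [abs_mul, abs_mul, sq]
    exact mul_le_mul_of_nonneg_left (mul_le_mul (abs_coord_le_norm a j) (abs_coord_le_norm a k)
      (abs_nonneg _) (norm_nonneg _)) (abs_nonneg _)
  have h3 : (∑ j, ∑ k, |Q j k q - M j k|) * ‖a‖ ^ 2 ≤ m / 2 * ‖a‖ ^ 2 :=
    mul_le_mul_of_nonneg_right hq.le (sq_nonneg _)
  linarith [hmin a]

/-- A lower bound for the curvature `b''` at all the linear predictors `θᵀx` with `‖θ‖ ≤ r`. -/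
structure IsCurvatureMinorant (b : ℝ → ℝ) (r : ℝ) (h : Vec p → ℝ) : Prop where
  measurable : Measurable h
  pos : ∀ x, 0 < h x
  le_zero : ∀ x, h x ≤ deriv (deriv b) 0
  le : ∀ x t, |t| ≤ r * ‖x‖ → h x ≤ deriv (deriv b) t

lemma exists_isCurvatureMinorant (hb : Continuous (deriv (deriv b)))
    (hpos : ∀ t, 0 < deriv (deriv b) t) {r : ℝ} (hr : 0 ≤ r) :
    ∃ h : Vec p → ℝ, IsCurvatureMinorant b r h := by
  -- the minimum of `b''` over an interval that depends on `‖x‖` rounded up, to keep measurability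
  have h1 : ∀ k : ℕ, ∃ c > 0, ∀ t, |t| ≤ r * k → c ≤ deriv (deriv b) t := by
    intro k
    obtain ⟨t₀, -, ht₀⟩ := (isCompact_Icc (a := -(r * k)) (b := r * k)).exists_isMinOn
      (Set.nonempty_Icc.2 (by have : 0 ≤ r * k := by positivity
                              linarith)) hb.continuousOn
    exact ⟨_, hpos t₀, fun t ht => ht₀ (abs_le.1 ht)⟩
  choose c hc hct using h1
  refine ⟨fun x => c ⌈‖x‖⌉₊, ?_, fun x => hc _, fun x => hct _ 0 ?_, fun x t ht => hct _ t ?_⟩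
  · exact (measurable_from_nat (f := c)).comp (Nat.measurable_ceil.comp measurable_norm)
  · simp only [abs_zero]; positivity
  · exact ht.trans (mul_le_mul_of_nonneg_left (Nat.le_ceil _) hr)

lemma inner_eq_sum (a x : Vec p) : inner ℝ a x = ∑ j, a j * x j := by
  simp [PiLp.inner_apply, mul_comm]

lemma inner_sq_eq_sum (a x : Vec p) : inner ℝ a x ^ 2 = ∑ j, ∑ k, x j * x k * (a j * a k) := by
  rw [inner_eq_sum, sq, Finset.sum_mul_sum]
  exact Finset.sum_congr rfl fun j _ => Finset.sum_congr rfl fun k _ => by ring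

omit [MeasurableSpace Ω] in
lemma wmean_sum {ι : Type*} (s : Finset ι) (f : ι → Vec p × ℝ × ℝ → ℝ) (q : ℕ × Ω) :
    wmean X Y S w (fun z => ∑ k ∈ s, f k z) q = ∑ k ∈ s, wmean X Y S w (f k) q := by
  simp only [wmean, Finset.mul_sum]
  rw [Finset.sum_comm]

omit [MeasurableSpace Ω] in
lemma wmean_mul_const (f : Vec p × ℝ × ℝ → ℝ) (c : ℝ) (q : ℕ × Ω) :
    wmean X Y S w (fun z => f z * c) q = wmean X Y S w f q * c := by
  simp only [wmean, Finset.mul_sum, Finset.sum_mul]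
  exact Finset.sum_congr rfl fun i _ => by ring

omit [MeasurableSpace Ω] in
lemma wmean_mono {f g : Vec p × ℝ × ℝ → ℝ} {q : ℕ × Ω} (hw : ∀ i, 0 ≤ w q.1 i q.2)
    (h : ∀ i, f (unit X Y S i q.2) ≤ g (unit X Y S i q.2)) :
    wmean X Y S w f q ≤ wmean X Y S w g q :=
  mul_le_mul_of_nonneg_left (Finset.sum_le_sum fun i _ => mul_le_mul_of_nonneg_left (h i) (hw i))
    (by positivity)

/-- A positive definite limit of the weighted means of `ρ vvᵀ` bounds the weighted quadratic forms
from below. -/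
lemma exists_wmean_sq_lower_bound [IsProbabilityMeasure P] {ρ : Vec p × ℝ × ℝ → ℝ}
    {v : Vec p × ℝ × ℝ → Vec p} (hρ : ∀ z, 0 < ρ z)
    (hlln : ∀ j k, Tendsto (wmean X Y S w fun z => ρ z * (v z j * v z k)) (whp P)
      (𝓝 (∫ ω, ρ (unit X Y S 0 ω) * (v (unit X Y S 0 ω) j * v (unit X Y S 0 ω) k) ∂P)))
    (hint : ∀ j k, Integrable (fun ω =>
      ρ (unit X Y S 0 ω) * (v (unit X Y S 0 ω) j * v (unit X Y S 0 ω) k)) P)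
    (hnd : ∀ a : Vec p, a ≠ 0 → ¬ ∀ᵐ ω ∂P, inner ℝ a (v (unit X Y S 0 ω)) = 0) :
    ∃ c > 0, ∀ᶠ q in whp P, ∀ a : Vec p,
      c * ‖a‖ ^ 2 ≤ wmean X Y S w (fun z => ρ z * inner ℝ a (v z) ^ 2) q := by
  have hexp : ∀ (a : Vec p) (z : Vec p × ℝ × ℝ), ρ z * inner ℝ a (v z) ^ 2 =
      ∑ j, ∑ k, ρ z * (v z j * v z k) * (a j * a k) := by
    intro a z
    rw [inner_sq_eq_sum, Finset.mul_sum]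
    refine Finset.sum_congr rfl fun j _ => ?_
    rw [Finset.mul_sum]
    exact Finset.sum_congr rfl fun k _ => by ring
  obtain ⟨c, hc, h⟩ := exists_quadratic_lower_bound hlln (fun a ha => by
    have h1 : ∑ j, ∑ k, (∫ ω, ρ (unit X Y S 0 ω) *
        (v (unit X Y S 0 ω) j * v (unit X Y S 0 ω) k) ∂P) * (a j * a k) =
        ∫ ω, ρ (unit X Y S 0 ω) * inner ℝ a (v (unit X Y S 0 ω)) ^ 2 ∂P := by
      simp only [hexp]
      rw [integral_finsetSum _ fun j _ => integrable_finsetSum _ fun k _ =>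
        (hint j k).mul_const _]
      refine Finset.sum_congr rfl fun j _ => ?_
      rw [integral_finsetSum _ fun k _ => (hint j k).mul_const _]
      exact Finset.sum_congr rfl fun k _ => (integral_mul_const _ _).symm
    rw [h1]
    have hi : Integrable (fun ω => ρ (unit X Y S 0 ω) * inner ℝ a (v (unit X Y S 0 ω)) ^ 2) P := by
      simp only [hexp]
      exact integrable_finsetSum _ fun j _ => integrable_finsetSum _ fun k _ =>
        (hint j k).mul_const _
    have h0 : 0 ≤ᵐ[P] fun ω => ρ (unit X Y S 0 ω) * inner ℝ a (v (unit X Y S 0 ω)) ^ 2 :=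
      Eventually.of_forall fun ω => mul_nonneg (hρ _).le (sq_nonneg _)
    refine lt_of_le_of_ne (integral_nonneg_of_ae h0) fun heq => hnd a ha ?_
    filter_upwards [(integral_eq_zero_iff_of_nonneg_ae h0 hi).1 heq.symm] with ω hω
    simpa [(hρ _).ne'] using hω)
  refine ⟨c, hc, ?_⟩
  filter_upwards [h] with q hq a
  refine (hq a).trans (le_of_eq ?_)
  simp only [hexp, wmean_sum, wmean_mul_const]

/-- A well-separated interior zero of the population score has a nearby point, in every direction,
where the population score does not vanish. -/
lemma exists_popScore_ne_zero {K : Set (Vec p)} {θ₀ : Vec p} {g : Vec p → Vec p}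
    (hint : θ₀ ∈ interior K) (hsep : WellSeparated g θ₀ K) {a : Vec p} (ha : a ≠ 0) :
    ∃ t : ℝ, θ₀ + t • a ∈ K ∧ g (θ₀ + t • a) ≠ 0 := by
  obtain ⟨ε, hε, hball⟩ := Metric.mem_nhds_iff.1 (mem_interior_iff_mem_nhds.1 hint)
  have hna : 0 < ‖a‖ := norm_pos_iff.2 ha
  have hmem : θ₀ + (ε / (2 * ‖a‖)) • a ∈ K := by
    refine hball ?_
    rw [Metric.mem_ball, dist_eq_norm, add_sub_cancel_left, norm_smul,
      Real.norm_of_nonneg (by positivity)]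
    have : ε / (2 * ‖a‖) * ‖a‖ = ε / 2 := by field_simp
    linarith
  obtain ⟨δ, hδ, h⟩ := hsep (ε / 2) (by positivity)
  refine ⟨_, hmem, fun h0 => ?_⟩
  have h1 := h _ hmem (by
    rw [add_sub_cancel_left, norm_smul, Real.norm_of_nonneg (by positivity)]
    exact le_of_eq (by field_simp))
  rw [h0, norm_zero] at h1
  linarith

lemma not_ae_inner_eq_zero {K : Set (Vec p)} {θ₀ : Vec p} {X₀ : Ω → Vec p} {Z : Ω → ℝ}
    (hint : θ₀ ∈ interior K) (hsep : WellSeparated (popScore P b X₀ Z) θ₀ K)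
    (h0 : popScore P b X₀ Z θ₀ = 0) {a : Vec p} (ha : a ≠ 0) :
    ¬ ∀ᵐ ω ∂P, inner ℝ a (X₀ ω) = 0 := by
  intro h
  obtain ⟨t, -, ht⟩ := exists_popScore_ne_zero hint hsep ha
  refine ht (h0 ▸ integral_congr_ae ?_)
  filter_upwards [h] with ω hω
  rw [inner_add_left, inner_smul_left, hω, mul_zero, add_zero]

lemma deriv_deriv_pos_of_wellSeparated {ν : Measure ℝ} {c : ℝ → ℝ} (hfam : IsCanonicalFamily ν b c)
    (hp : p ≠ 0) {K : Set (Vec p)} {θ₀ : Vec p} {X₀ : Ω → Vec p} {Z : Ω → ℝ}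
    (hint : θ₀ ∈ interior K) (hsep : WellSeparated (popScore P b X₀ Z) θ₀ K)
    (h0 : popScore P b X₀ Z θ₀ = 0) (t : ℝ) : 0 < deriv (deriv b) t := by
  rcases hfam.deriv_deriv_pos_or with h | h
  · exact h t
  exfalso
  have : NeZero p := ⟨hp⟩
  obtain ⟨t, -, ht⟩ := exists_popScore_ne_zero (a := EuclideanSpace.single 0 (1 : ℝ)) hint hsep
    (by simp)
  refine ht (h0 ▸ ?_)
  simp only [popScore]
  have hc := is_const_of_deriv_eq_zero hfam.differentiable_deriv h
  exact integral_congr_ae (Eventually.of_forall fun ω => by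
    simp only [hc (inner ℝ (θ₀ + t • EuclideanSpace.single 0 (1 : ℝ)) (X₀ ω)) (inner ℝ θ₀ (X₀ ω))])

namespace IsCurvatureMinorant

variable {h : Vec p → ℝ} {r : ℝ} (hh : IsCurvatureMinorant b r h) (hb : Differentiable ℝ (deriv b))
include hh

lemma integrable_mul (hX : Integrable (fun ω => ‖X 0 ω‖ ^ 2) P) (hXm : Measurable (X 0))
    (j k : Fin p) : Integrable (fun ω => h (X 0 ω) * (X 0 ω j * X 0 ω k)) P := by
  refine (hX.const_mul (deriv (deriv b) 0)).mono
    ((hh.measurable.comp hXm).mul (by fun_prop)).aestronglyMeasurable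
    (Eventually.of_forall fun ω => ?_)
  have h1 := hh.le_zero (X 0 ω)
  have h2 := hh.pos (X 0 ω)
  rw [norm_mul, norm_mul, norm_mul, Real.norm_of_nonneg h2.le, Real.norm_of_nonneg (h2.le.trans h1),
    Real.norm_of_nonneg (sq_nonneg ‖X 0 ω‖), sq]
  exact mul_le_mul h1 (mul_le_mul (abs_coord_le_norm _ j) (abs_coord_le_norm _ k)
    (norm_nonneg _) (norm_nonneg _)) (by positivity) (h2.le.trans h1)

include hb

lemma mul_sq_le {θ θ' x : Vec p} (hθ : ‖θ‖ ≤ r) (hθ' : ‖θ'‖ ≤ r) :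
    h x * inner ℝ (θ - θ') x ^ 2 ≤
      (deriv b (inner ℝ θ x) - deriv b (inner ℝ θ' x)) * inner ℝ (θ - θ') x := by
  have key : ∀ s t : ℝ, |s| ≤ r * ‖x‖ → |t| ≤ r * ‖x‖ → s ≤ t →
      h x * (t - s) ≤ deriv b t - deriv b s := by
    intro s t hs ht hst
    refine (convex_Icc (-(r * ‖x‖)) (r * ‖x‖)).mul_sub_le_image_sub_of_le_deriv
      hb.continuous.continuousOn (fun t _ => (hb t).differentiableWithinAt) (fun u hu => ?_)
      s (abs_le.1 hs) t (abs_le.1 ht) hst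
    have hu' : u ∈ Set.Icc (-(r * ‖x‖)) (r * ‖x‖) := interior_subset hu
    exact hh.le x u (abs_le.2 hu')
  have h1 := abs_inner_le_of_norm_le (x := x) hθ
  have h2 := abs_inner_le_of_norm_le (x := x) hθ'
  rw [inner_sub_left]
  rcases le_total (inner ℝ θ' x : ℝ) (inner ℝ θ x) with h3 | h3
  · nlinarith [key _ _ h2 h1 h3]
  · nlinarith [key _ _ h1 h2 h3]

omit [MeasurableSpace Ω] in
/-- Strong monotonicity of the weighted score equation: a zero `θ` in the ball is as close to `θ'` as
the score at `θ'` is small, relative to the curvature. -/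
lemma mul_norm_sub_le {q : ℕ × Ω} (hw : ∀ i, 0 ≤ w q.1 i q.2) {c : ℝ}
    (hc : ∀ a : Vec p,
      c * ‖a‖ ^ 2 ≤ wmean X Y S w (fun z => h z.1 * inner ℝ a z.1 ^ 2) q)
    {θ θ' : Vec p} (hθ : ‖θ‖ ≤ r) (hθ' : ‖θ'‖ ≤ r)
    (hzero : meanScore X Y S w b out θ q = 0) :
    c * ‖θ - θ'‖ ≤ ‖meanScore X Y S w b out θ' q‖ := by
  have h1 : wmean X Y S w (fun z => h z.1 * inner ℝ (θ - θ') z.1 ^ 2) q ≤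
      inner ℝ (meanScore X Y S w b out θ' q - meanScore X Y S w b out θ q) (θ - θ') := by
    rw [meanScore, meanScore, ← smul_sub, ← Finset.sum_sub_distrib, real_inner_smul_left,
      sum_inner, wmean]
    refine mul_le_mul_of_nonneg_left (Finset.sum_le_sum fun i _ => ?_) (by positivity)
    rw [← smul_sub, real_inner_smul_left, scoreTerm, scoreTerm, ← sub_smul, real_inner_smul_left,
      sub_sub_sub_cancel_left, real_inner_comm (θ - θ')]
    exact mul_le_mul_of_nonneg_left (hh.mul_sq_le hb hθ hθ') (hw i)
  rw [hzero, sub_zero] at h1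
  have h2 := (hc (θ - θ')).trans (h1.trans (real_inner_le_norm _ _))
  rcases (norm_nonneg (θ - θ')).eq_or_lt with h3 | h3
  · rw [← h3, mul_zero]; exact norm_nonneg _
  · exact le_of_mul_le_mul_right (by linarith [sq ‖θ - θ'‖]) h3

/-- The moment condition on the scores controls the sampling variance of `h(X) XXᵀ`, because `h`
bounds the difference quotients of the scores from below. -/
lemma smallVar_mul [IsProbabilityMeasure P] (hiid : IsIIDSample P X Y S)
    (hs : IsPoissonSampling P X Y S n π R) (hout : Measurable out) {K : Set (Vec p)}
    (hK : ∀ θ ∈ K, ‖θ‖ ≤ r) {θ₀ : Vec p} (hint : θ₀ ∈ interior K)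
    (hmom : WeightedMoments P b X (fun i ω => out (unit X Y S i ω)) n π K) (j k : Fin p) :
    SmallVar P X Y S π (fun z => h z.1 * (z.1 j * z.1 k)) := by
  obtain ⟨ε, hε, hball⟩ := Metric.mem_nhds_iff.1 (mem_interior_iff_mem_nhds.1 hint)
  set θ₁ : Vec p := θ₀ + (ε / 2) • EuclideanSpace.single j (1 : ℝ) with hθ₁
  have hd : θ₁ - θ₀ = (ε / 2) • EuclideanSpace.single j (1 : ℝ) := by simp [hθ₁]
  have h0K : θ₀ ∈ K := interior_subset hint
  have h1K : θ₁ ∈ K := by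
    refine hball ?_
    rw [Metric.mem_ball, dist_eq_norm, hd, norm_smul, Real.norm_of_nonneg (by positivity)]
    simp
    linarith
  have hsv : ∀ θ ∈ ({θ₀, θ₁} : Set (Vec p)), SmallVar P X Y S π (scoreCoord b out θ k) := by
    intro θ hθ
    refine hs.smallVar_of_weightedMoments (K := K) ?_ hmom k
    rcases hθ with rfl | rfl <;> assumption
  refine SmallVar.of_sq_le (s := Finset.univ) (F := fun x : Bool =>
      scoreCoord b out (if x then θ₁ else θ₀) k) (C := (2 / ε) ^ 2 * 2) hiid hs
    (fun x _ => measurable_scoreCoord hb.continuous.measurable hout _ k)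
    (fun x _ => hsv _ (by cases x <;> simp)) (by positivity)
    (Eventually.of_forall fun ω i => ?_)
  set z := unit X Y S i ω
  have h1 := hh.mul_sq_le hb (x := z.1) (hK _ h1K) (hK _ h0K)
  have h2 : inner ℝ (θ₁ - θ₀) z.1 = ε / 2 * z.1 j := by
    rw [hd, real_inner_smul_left, EuclideanSpace.inner_single_left]
    simp
  rw [h2] at h1
  have h3 : h z.1 * |z.1 j| * (ε / 2) ≤
      |deriv b (inner ℝ θ₁ z.1) - deriv b (inner ℝ θ₀ z.1)| := by
    rcases eq_or_ne (z.1 j) 0 with h4 | h4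
    · rw [h4]; simp
    · have h5 : 0 < |ε / 2 * z.1 j| := abs_pos.2 (mul_ne_zero (by positivity) h4)
      refine le_of_mul_le_mul_right ?_ h5
      rw [← abs_mul]
      refine le_trans (le_of_eq ?_) (h1.trans (le_abs_self _))
      rw [abs_mul, abs_of_pos (half_pos hε), mul_pow, ← sq_abs (z.1 j)]
      ring
  have h6 : (h z.1 * (z.1 j * z.1 k)) ^ 2 ≤ (2 / ε) ^ 2 *
      ((deriv b (inner ℝ θ₁ z.1) - deriv b (inner ℝ θ₀ z.1)) * z.1 k) ^ 2 := by
    have hε' : 0 < 2 / ε := by positivity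
    rw [← mul_pow, sq_le_sq]
    calc |h z.1 * (z.1 j * z.1 k)| = 2 / ε * (h z.1 * |z.1 j| * (ε / 2)) * |z.1 k| := by
          rw [abs_mul, abs_mul, abs_of_pos (hh.pos _)]
          field_simp
      _ ≤ 2 / ε * |deriv b (inner ℝ θ₁ z.1) - deriv b (inner ℝ θ₀ z.1)| * |z.1 k| :=
          mul_le_mul_of_nonneg_right (mul_le_mul_of_nonneg_left h3 hε'.le) (abs_nonneg _)
      _ = _ := by rw [abs_mul, abs_mul, abs_of_pos hε', mul_assoc]
  refine h6.trans ?_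
  rw [mul_assoc]
  refine mul_le_mul_of_nonneg_left ?_ (sq_nonneg _)
  simp only [Fintype.sum_bool, scoreCoord, if_true, Bool.false_eq_true, if_false]
  have h7 := sq_nonneg ((out z - deriv b (inner ℝ θ₁ z.1)) * z.1 k +
    (out z - deriv b (inner ℝ θ₀ z.1)) * z.1 k)
  nlinarith [h7]

end IsCurvatureMinorant

end Curvature

/-! ### The sampling error of the surrogate score -/

section SamplingError

variable {Ω : Type*} [MeasurableSpace Ω] {p : ℕ} {P : Measure Ω}
  {X : ℕ → Ω → Vec p} {Y S : ℕ → Ω → ℝ} {n : ℕ → ℝ}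
  {π : (N : ℕ) → Fin N → Ω → ℝ} {R : (N : ℕ) → Fin N → Ω → Bool}
  {b : ℝ → ℝ} {out : Vec p × ℝ × ℝ → ℝ} {f : Vec p × ℝ × ℝ → ℝ}

/-- The sampling error `∑ (Rᵢ / πᵢ - 1) f(Xᵢ, Yᵢ, Sᵢ)` of a weighted sum. -/
noncomputable def samplingError (X : ℕ → Ω → Vec p) (Y S : ℕ → Ω → ℝ)
    (π : (N : ℕ) → Fin N → Ω → ℝ) (R : (N : ℕ) → Fin N → Ω → Bool)
    (f : Vec p × ℝ × ℝ → ℝ) (N : ℕ) (ω : Ω) : ℝ :=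
  ∑ i : Fin N, (ipw π R N i ω - 1) * f (unit X Y S i ω)

namespace SurrogateGLM.IsPoissonSampling

variable (hs : IsPoissonSampling P X Y S n π R) (hiid : IsIIDSample P X Y S)
include hs hiid

lemma measurable_samplingError (hf : Measurable f) (N : ℕ) :
    Measurable (samplingError X Y S π R f N) :=
  Finset.measurable_fun_sum _ fun i _ => ((hs.measurable_ipw hiid N i).sub_const 1).mul
    (hf.comp (hiid.measurable_unit i))

lemma memLp_samplingError [IsProbabilityMeasure P] (hf : Measurable f) {N : ℕ}
    (hint : ∀ i : Fin N, Integrable (fun ω => f (unit X Y S i ω) ^ 2 / π N i ω) P) :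
    MemLp (samplingError X Y S π R f N) 2 P ∧ ∫ ω, samplingError X Y S π R f N ω ∂P = 0 := by
  have hm := hs.measurable_samplingError hiid hf N
  have hpos : ∀ᵐ ω ∂P, ∀ i, 0 < π N i ω := ae_all_iff.2 (hs.pos N)
  have h1 := fun c => hs.lintegral_sq_sum_ipw_sub_one hiid N hf c
  set T := ∫⁻ ω, ENNReal.ofReal (∑ i : Fin N, (1 / π N i ω - 1) * f (unit X Y S i ω) ^ 2) ∂P with hT
  have hTfin : T ≠ ⊤ := by
    have h2 : Integrable (fun ω => ∑ i : Fin N, f (unit X Y S i ω) ^ 2 / π N i ω) P :=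
      integrable_finsetSum _ fun i _ => hint i
    refine ((lintegral_mono_ae ?_).trans_lt h2.lintegral_lt_top).ne
    filter_upwards [hpos] with ω hpos
    refine ENNReal.ofReal_le_ofReal (Finset.sum_le_sum fun i _ => ?_)
    rw [one_div, div_eq_inv_mul]
    exact mul_le_mul_of_nonneg_right (by linarith) (sq_nonneg _)
  have h3 : ∀ c : ℝ, Integrable (fun ω => (c + samplingError X Y S π R f N ω) ^ 2) P ∧
      ∫ ω, (c + samplingError X Y S π R f N ω) ^ 2 ∂P = c ^ 2 + T.toReal := by
    intro c
    have h4 : ∫⁻ ω, ENNReal.ofReal ((c + samplingError X Y S π R f N ω) ^ 2) ∂P =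
        ENNReal.ofReal (c ^ 2) + T := h1 c
    constructor
    · refine ⟨((hm.const_add c).pow_const 2).aestronglyMeasurable, ?_⟩
      rw [hasFiniteIntegral_iff_ofReal (Eventually.of_forall fun ω => sq_nonneg _), h4]
      exact ENNReal.add_lt_top.2 ⟨ENNReal.ofReal_lt_top, hTfin.lt_top⟩
    · rw [integral_eq_lintegral_of_nonneg_ae (Eventually.of_forall fun ω => sq_nonneg _)
        ((hm.const_add c).pow_const 2).aestronglyMeasurable, h4,
        ENNReal.toReal_add ENNReal.ofReal_ne_top hTfin, ENNReal.toReal_ofReal (sq_nonneg _)]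
  have hL2 : MemLp (samplingError X Y S π R f N) 2 P := by
    rw [memLp_two_iff_integrable_sq hm.aestronglyMeasurable]
    simpa using (h3 0).1
  refine ⟨hL2, ?_⟩
  have hi : Integrable (samplingError X Y S π R f N) P := hL2.integrable one_le_two
  have hi2 : Integrable (fun ω => samplingError X Y S π R f N ω ^ 2) P := by simpa using (h3 0).1
  have h5 : ∫ ω, (1 + samplingError X Y S π R f N ω) ^ 2 ∂P =
      1 + 2 * ∫ ω, samplingError X Y S π R f N ω ∂P +
        ∫ ω, samplingError X Y S π R f N ω ^ 2 ∂P := by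
    have : ∀ ω, (1 + samplingError X Y S π R f N ω) ^ 2 =
        1 + 2 * samplingError X Y S π R f N ω + samplingError X Y S π R f N ω ^ 2 := fun ω => by ring
    simp only [this]
    rw [integral_add (by exact (integrable_const _).add (hi.const_mul 2)) hi2,
      integral_add (integrable_const _) (hi.const_mul 2), integral_const_mul]
    simp
  have h6 := (h3 1).2
  have h7 := (h3 0).2
  simp only [zero_add, ne_eq, OfNat.ofNat_ne_zero, not_false_eq_true, zero_pow] at h7
  rw [h5, h7] at h6
  linarith

lemma crossCov_samplingError [IsProbabilityMeasure P] (hb : Measurable (deriv b))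
    (hout : Measurable out) {K : Set (Vec p)} {θ : Vec p} (hθ : θ ∈ K)
    (hmom : WeightedMoments P b X (fun i ω => out (unit X Y S i ω)) n π K) :
    ∀ᶠ N in atTop,
      (∀ j, MemLp (samplingError X Y S π R (scoreCoord b out θ j) N) 2 P) ∧
      ∀ j k, crossCov P
        (fun ω => weightedScore b X (fun i ω => out (unit X Y S i ω)) π R N θ ω -
          fullScore b X (fun i ω => out (unit X Y S i ω)) N θ ω)
        (fun ω => weightedScore b X (fun i ω => out (unit X Y S i ω)) π R N θ ω -
          fullScore b X (fun i ω => out (unit X Y S i ω)) N θ ω) j k =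
      ∫ ω, samplingError X Y S π R (scoreCoord b out θ j) N ω *
        samplingError X Y S π R (scoreCoord b out θ k) N ω ∂P := by
  have h1 : ∀ᶠ N in atTop, ∀ j, ∀ i : Fin N, Integrable (fun ω =>
      ((out (unit X Y S i ω) - deriv b (inner ℝ θ (X i ω))) * X i ω j) ^ 2 / π N i ω) P :=
    eventually_all.2 fun j => (hs.integrable_sq_of_weightedMoments hiid hb hout hθ hmom j).2
  filter_upwards [h1] with N h1
  have h2 := fun j => hs.memLp_samplingError hiid (measurable_scoreCoord hb hout θ j) (h1 j)
  refine ⟨fun j => (h2 j).1, fun j k => ?_⟩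
  have h3 : ∀ j ω, (weightedScore b X (fun i ω => out (unit X Y S i ω)) π R N θ ω -
      fullScore b X (fun i ω => out (unit X Y S i ω)) N θ ω) j =
      samplingError X Y S π R (scoreCoord b out θ j) N ω := by
    intro j ω
    simp only [weightedScore, fullScore, samplingError, ← Finset.sum_sub_distrib, scoreTerm,
      scoreCoord]
    simp only [WithLp.ofLp_sum, Finset.sum_apply, PiLp.sub_apply, PiLp.smul_apply, smul_eq_mul]
    exact Finset.sum_congr rfl fun i _ => by simp only [unit]; ring
  simp only [crossCov, Matrix.of_apply, h3, covariance, (h2 j).2, (h2 k).2, sub_zero]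

end SurrogateGLM.IsPoissonSampling

lemma det_ne_zero_of_posDef {V : Matrix (Fin p) (Fin p) ℝ} (h : V.PosDef) : V.det ≠ 0 :=
  h.det_pos.ne'

/-- A positive definite limit covariance forces the information matrix to be invertible: the matrix
inverse of a singular matrix is the zero matrix. -/
lemma det_info_ne_zero (hp : p ≠ 0) {γ₀ : Vec p} {V : Matrix (Fin p) (Fin p) ℝ} {Z : ℕ → Ω → ℝ}
    (hV : Tendsto (sigma22 P b X Z n π R γ₀) atTop (𝓝 V)) (hpd : V.PosDef) :
    (info P b (X 0) γ₀).det ≠ 0 := by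
  intro hdet
  have h1 : (info P b (X 0) γ₀)⁻¹ = 0 :=
    Matrix.nonsing_inv_apply_not_isUnit _ (by rw [hdet]; exact not_isUnit_zero)
  have h2 : sigma22 P b X Z n π R γ₀ = fun _ => 0 := by
    funext N
    simp [sigma22, h1]
  rw [h2] at hV
  have h3 : V = 0 := tendsto_nhds_unique hV tendsto_const_nhds
  have : NeZero p := ⟨hp⟩
  refine det_ne_zero_of_posDef hpd ?_
  rw [h3, Matrix.det_zero]

/-- The limit of the rescaled covariance matrices of the sampling error. -/
lemma tendsto_crossCov (hp : p ≠ 0) {γ₀ : Vec p} {V : Matrix (Fin p) (Fin p) ℝ} {Z : ℕ → Ω → ℝ}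
    (hV : Tendsto (sigma22 P b X Z n π R γ₀) atTop (𝓝 V)) (hpd : V.PosDef) :
    Tendsto (fun N : ℕ => (n N / (N : ℝ) ^ 2) • crossCov P
        (fun ω => weightedScore b X Z π R N γ₀ ω - fullScore b X Z N γ₀ ω)
        (fun ω => weightedScore b X Z π R N γ₀ ω - fullScore b X Z N γ₀ ω)) atTop
      (𝓝 (info P b (X 0) γ₀ * V * info P b (X 0) γ₀)) := by
  have hI : IsUnit (info P b (X 0) γ₀).det := (det_info_ne_zero hp hV hpd).isUnit
  have h1 := (hV.const_mul (info P b (X 0) γ₀)).mul_const (info P b (X 0) γ₀)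
  refine h1.congr fun N => ?_
  rw [sigma22, Matrix.mul_smul, Matrix.smul_mul]
  congr 1
  rw [← mul_assoc, ← mul_assoc, Matrix.mul_nonsing_inv _ hI, one_mul, mul_assoc,
    Matrix.nonsing_inv_mul _ hI, mul_one]

/-- The surrogate score is not degenerate in any direction, because the limit covariance of its
sampling error is positive definite. -/
lemma not_ae_inner_score_eq_zero [IsProbabilityMeasure P] (hp : p ≠ 0)
    (hiid : IsIIDSample P X Y S) (hs : IsPoissonSampling P X Y S n π R) (hb : Measurable (deriv b))
    (hout : Measurable out) {K : Set (Vec p)} {γ₀ : Vec p} (hγ₀ : γ₀ ∈ K)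
    (hmom : WeightedMoments P b X (fun i ω => out (unit X Y S i ω)) n π K)
    {V : Matrix (Fin p) (Fin p) ℝ}
    (hV : Tendsto (sigma22 P b X (fun i ω => out (unit X Y S i ω)) n π R γ₀) atTop (𝓝 V))
    (hpd : V.PosDef) {a : Vec p} (ha : a ≠ 0) :
    ¬ ∀ᵐ ω ∂P, inner ℝ a (scoreTerm b γ₀ (unit X Y S 0 ω).1 (out (unit X Y S 0 ω))) = 0 := by
  intro h
  have hsum : ∀ z : Vec p × ℝ × ℝ, inner ℝ a (scoreTerm b γ₀ z.1 (out z)) =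
      ∑ k, a k * scoreCoord b out γ₀ k z := fun z => by
    rw [inner_eq_sum]
    rfl
  have h1 : ∀ᵐ ω ∂P, ∀ i, ∑ k, a k * scoreCoord b out γ₀ k (unit X Y S i ω) = 0 := by
    refine hiid.ae_forall (s := {z | ∑ k, a k * scoreCoord b out γ₀ k z = 0}) ?_ ?_
    · exact measurableSet_eq_fun (Finset.measurable_fun_sum _ fun k _ =>
        (measurable_scoreCoord hb hout γ₀ k).const_mul _) measurable_const
    · filter_upwards [h] with ω hω
      rw [hsum] at hω
      exact hω
  have hzero : ∀ᶠ N in atTop, ∀ j, ((n N / (N : ℝ) ^ 2) • crossCov P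
        (fun ω => weightedScore b X (fun i ω => out (unit X Y S i ω)) π R N γ₀ ω -
          fullScore b X (fun i ω => out (unit X Y S i ω)) N γ₀ ω)
        (fun ω => weightedScore b X (fun i ω => out (unit X Y S i ω)) π R N γ₀ ω -
          fullScore b X (fun i ω => out (unit X Y S i ω)) N γ₀ ω) *ᵥ a.ofLp) j = 0 := by
    filter_upwards [hs.crossCov_samplingError hiid hb hout hγ₀ hmom] with N hN j
    obtain ⟨hL2, hC⟩ := hN
    rw [Pi.smul_apply, Matrix.mulVec, dotProduct]
    simp only [hC]
    have h2 : ∀ k, (∫ ω, samplingError X Y S π R (scoreCoord b out γ₀ j) N ω *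
        samplingError X Y S π R (scoreCoord b out γ₀ k) N ω ∂P) * a k =
        ∫ ω, samplingError X Y S π R (scoreCoord b out γ₀ j) N ω *
        samplingError X Y S π R (scoreCoord b out γ₀ k) N ω * a k ∂P := fun k =>
      (integral_mul_const _ _).symm
    simp only [h2]
    have hi : ∀ k ∈ (Finset.univ : Finset (Fin p)), Integrable (fun ω =>
        samplingError X Y S π R (scoreCoord b out γ₀ j) N ω *
          samplingError X Y S π R (scoreCoord b out γ₀ k) N ω * a k) P := fun k _ =>
      ((hL2 j).integrable_mul (hL2 k)).mul_const _
    rw [← integral_finsetSum _ hi]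
    have h3 : ∫ ω, ∑ k, samplingError X Y S π R (scoreCoord b out γ₀ j) N ω *
        samplingError X Y S π R (scoreCoord b out γ₀ k) N ω * a k ∂P = 0 := by
      refine integral_eq_zero_of_ae ?_
      filter_upwards [h1] with ω h1
      have h4 : ∑ k, samplingError X Y S π R (scoreCoord b out γ₀ k) N ω * a k = 0 := by
        simp only [samplingError, Finset.sum_mul]
        rw [Finset.sum_comm]
        refine Finset.sum_eq_zero fun i _ => ?_
        have h5 := h1 i
        calc ∑ k, (ipw π R N i ω - 1) * scoreCoord b out γ₀ k (unit X Y S i ω) * a k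
            = (ipw π R N i ω - 1) * ∑ k, a k * scoreCoord b out γ₀ k (unit X Y S i ω) := by
              rw [Finset.mul_sum]
              exact Finset.sum_congr rfl fun k _ => by ring
          _ = 0 := by rw [h5, mul_zero]
      simp only [mul_assoc, ← Finset.mul_sum, h4, mul_zero, Pi.zero_apply]
    rw [h3, smul_zero]
  have hlim := tendsto_crossCov hp hV hpd
  have h6 : ((info P b (X 0) γ₀ * V * info P b (X 0) γ₀) *ᵥ a.ofLp) = 0 := by
    have h7 : Continuous fun M : Matrix (Fin p) (Fin p) ℝ => M *ᵥ a.ofLp :=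
      continuous_id.matrix_mulVec continuous_const
    refine tendsto_nhds_unique ((h7.tendsto _).comp hlim) (tendsto_const_nhds.congr' ?_)
    filter_upwards [hzero] with N hN
    funext j
    simpa [Matrix.smul_mulVec] using (hN j).symm
  have hI := det_info_ne_zero hp hV hpd
  have h8 : (info P b (X 0) γ₀ * V * info P b (X 0) γ₀).det ≠ 0 := by
    rw [Matrix.det_mul, Matrix.det_mul]
    exact mul_ne_zero (mul_ne_zero hI (det_ne_zero_of_posDef hpd)) hI
  have h9 := Matrix.eq_zero_of_mulVec_eq_zero h8 h6
  exact ha (by ext j; simpa using congrFun h9 j)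

/-- The sampling error of the surrogate score at `γ₀` is of order `N / √n`. -/
lemma bddInProb_samplingError [IsProbabilityMeasure P] (hp : p ≠ 0)
    (hiid : IsIIDSample P X Y S) (hs : IsPoissonSampling P X Y S n π R) (hb : Measurable (deriv b))
    (hout : Measurable out) {K : Set (Vec p)} {γ₀ : Vec p} (hγ₀ : γ₀ ∈ K)
    (hmom : WeightedMoments P b X (fun i ω => out (unit X Y S i ω)) n π K)
    {V : Matrix (Fin p) (Fin p) ℝ}
    (hV : Tendsto (sigma22 P b X (fun i ω => out (unit X Y S i ω)) n π R γ₀) atTop (𝓝 V))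
    (hpd : V.PosDef) (j : Fin p) :
    BddInProb P (fun q => n q.1 / (q.1 : ℝ) ^ 2 *
      samplingError X Y S π R (scoreCoord b out γ₀ j) q.1 q.2 ^ 2) := by
  have h1 := tendsto_pi_nhds.1 (tendsto_pi_nhds.1 (tendsto_crossCov hp hV hpd) j) j
  have hn : ∀ N, 0 ≤ n N / (N : ℝ) ^ 2 := by
    intro N
    rcases Nat.eq_zero_or_pos N with rfl | hN
    · simp
    · exact div_nonneg (hs.n_pos hN).le (sq_nonneg _)
  refine BddInProb.of_lintegral (F := fun N ω => n N / (N : ℝ) ^ 2 *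
    samplingError X Y S π R (scoreCoord b out γ₀ j) N ω ^ 2)
    (C := ENNReal.ofReal ((info P b (X 0) γ₀ * V * info P b (X 0) γ₀) j j + 1))
    (fun N => ((hs.measurable_samplingError hiid (measurable_scoreCoord hb hout γ₀ j) N).pow_const
      2).const_mul _) (fun N => Eventually.of_forall fun ω => mul_nonneg (hn N) (sq_nonneg _))
    ENNReal.ofReal_ne_top ?_
  filter_upwards [hs.crossCov_samplingError hiid hb hout hγ₀ hmom,
    h1.eventually (gt_mem_nhds (lt_add_one _))] with N hN hlt
  obtain ⟨hL2, hC⟩ := hN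
  rw [Matrix.smul_apply, hC, smul_eq_mul] at hlt
  simp only [ENNReal.ofReal_mul (hn N)]
  rw [lintegral_const_mul' _ _ ENNReal.ofReal_ne_top,
    ← ofReal_integral_eq_lintegral_ofReal ((hL2 j).integrable_sq)
      (Eventually.of_forall fun ω => sq_nonneg _), ← ENNReal.ofReal_mul (hn N)]
  refine ENNReal.ofReal_le_ofReal (le_of_eq_of_le ?_ hlt.le)
  congr 2
  funext ω
  ring

/-- The full-data score at `γ₀` is a sum of independent centred variables, of order `√N ≤ N / √n`. -/
lemma bddInProb_fullScore [IsProbabilityMeasure P]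
    (hiid : IsIIDSample P X Y S) (hs : IsPoissonSampling P X Y S n π R) (hf : Measurable f)
    (h0 : ∫ ω, f (unit X Y S 0 ω) ∂P = 0)
    (hint : Integrable (fun ω => f (unit X Y S 0 ω) ^ 2) P) :
    BddInProb P (fun q => n q.1 * wmean X Y S unitWeight f q ^ 2) := by
  have hm : ∀ i, Measurable (fun ω => f (unit X Y S i ω)) := fun i =>
    hf.comp (hiid.measurable_unit i)
  have hL2 : ∀ i, MemLp (fun ω => f (unit X Y S i ω)) 2 P := fun i =>
    ((hiid.identDistrib_comp hf i).memLp_iff).2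
      ((memLp_two_iff_integrable_sq (hm 0).aestronglyMeasurable).2 hint)
  have hmean : ∀ i, ∫ ω, f (unit X Y S i ω) ∂P = 0 := fun i =>
    (hiid.identDistrib_comp hf i).integral_eq.trans h0
  have hn : ∀ N, 0 ≤ n N := by
    intro N
    rcases Nat.eq_zero_or_pos N with rfl | hN
    · obtain ⟨ω, h⟩ := (hs.sum_eq 0).exists
      simp at h
      exact h.le
    · exact (hs.n_pos hN).le
  have hvar : ∀ N : ℕ, ∫ ω, (∑ i ∈ Finset.range N, f (unit X Y S i ω)) ^ 2 ∂P =
      N * ∫ ω, f (unit X Y S 0 ω) ^ 2 ∂P := by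
    intro N
    have h1 := IndepFun.variance_sum (μ := P) (X := fun i ω => f (unit X Y S i ω))
      (s := Finset.range N) (fun i _ => hL2 i) (fun i _ j _ hij => hiid.indepFun_comp hf hij)
    have h2 : ∀ i, Var[fun ω => f (unit X Y S i ω); P] = ∫ ω, f (unit X Y S 0 ω) ^ 2 ∂P := by
      intro i
      rw [(hiid.identDistrib_comp hf i).variance_eq,
        variance_of_integral_eq_zero (hm 0).aemeasurable h0]
    rw [variance_of_integral_eq_zero] at h1
    · simpa [h2] using h1
    · exact (Finset.aemeasurable_sum _ fun i _ => (hm i).aemeasurable)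
    · simp only [Finset.sum_apply]
      rw [integral_finsetSum _ fun i _ => (hL2 i).integrable one_le_two]
      simp [hmean]
  have hsq : ∀ N : ℕ, Integrable (fun ω => (∑ i ∈ Finset.range N, f (unit X Y S i ω)) ^ 2) P :=
    fun N => (memLp_finsetSum _ fun i _ => hL2 i).integrable_sq
  have hw : ∀ q : ℕ × Ω, wmean X Y S unitWeight f q =
      (q.1 : ℝ)⁻¹ * ∑ i ∈ Finset.range q.1, f (unit X Y S i q.2) := by
    intro q
    rw [wmean, ← Fin.sum_univ_eq_sum_range (fun i => f (unit X Y S i q.2))]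
    simp [unitWeight]
  refine BddInProb.of_lintegral (F := fun N ω => n N * wmean X Y S unitWeight f (N, ω) ^ 2)
    (C := ENNReal.ofReal (∫ ω, f (unit X Y S 0 ω) ^ 2 ∂P)) (fun N => ?_)
    (fun N => Eventually.of_forall fun ω => mul_nonneg (hn N) (sq_nonneg _))
    ENNReal.ofReal_ne_top ?_
  · simp only [hw]
    exact (((Finset.measurable_fun_sum _ fun i _ => hm i).const_mul _).pow_const 2).const_mul _
  · filter_upwards [eventually_ge_atTop 1] with N hN
    have hN' : (0 : ℝ) < N := by exact_mod_cast hN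
    simp only [hw, mul_pow, ← mul_assoc]
    rw [← ofReal_integral_eq_lintegral_ofReal ((hsq N).const_mul _)
      (Eventually.of_forall fun ω => mul_nonneg (mul_nonneg (hn N) (sq_nonneg _)) (sq_nonneg _)),
      integral_const_mul, hvar]
    refine ENNReal.ofReal_le_ofReal ?_
    have h1 : n N / N ≤ 1 := (div_le_one hN').2 (hs.n_le N)
    calc n N * (N : ℝ)⁻¹ ^ 2 * (N * ∫ ω, f (unit X Y S 0 ω) ^ 2 ∂P)
        = n N / N * ∫ ω, f (unit X Y S 0 ω) ^ 2 ∂P := by field_simp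
      _ ≤ 1 * ∫ ω, f (unit X Y S 0 ω) ^ 2 ∂P :=
          mul_le_mul_of_nonneg_right h1 (integral_nonneg fun ω => sq_nonneg _)
      _ = _ := one_mul _

end SamplingError

/-! ### The empirical second moments of the estimated score contributions -/

section EmpiricalMoments

variable {Ω : Type*} [MeasurableSpace Ω] {p : ℕ} {P : Measure Ω}
  {X : ℕ → Ω → Vec p} {Y S : ℕ → Ω → ℝ} {n : ℕ → ℝ}
  {π : (N : ℕ) → Fin N → Ω → ℝ} {R : (N : ℕ) → Fin N → Ω → Bool}
  {b : ℝ → ℝ} {out : Vec p × ℝ × ℝ → ℝ} {f : Vec p × ℝ × ℝ → ℝ}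

lemma tendsto_sum_ipw_sq_mul_sq [IsProbabilityMeasure P] (hiid : IsIIDSample P X Y S)
    (hs : IsPoissonSampling P X Y S n π R) (hf : Measurable f) (hsv : SmallVar P X Y S π f) :
    Tendsto (fun q : ℕ × Ω => ((q.1 : ℝ)⁻¹) ^ 2 *
      ∑ i : Fin q.1, ipw π R q.1 i q.2 ^ 2 * f (unit X Y S i q.2) ^ 2) (whp P) (𝓝 0) := by
  refine tendsto_whp_zero_of_lintegral (F := fun N ω => ((N : ℝ)⁻¹) ^ 2 *
    ∑ i : Fin N, ipw π R N i ω ^ 2 * f (unit X Y S i ω) ^ 2) (fun N => ?_)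
    (fun N => Eventually.of_forall fun ω => by positivity) (hsv.congr fun N => ?_)
  · exact (Finset.measurable_fun_sum _ fun i _ => ((hs.measurable_ipw hiid N i).pow_const 2).mul
      ((hf.comp (hiid.measurable_unit i)).pow_const 2)).const_mul _
  · simp only [ENNReal.ofReal_mul (sq_nonneg ((N : ℝ)⁻¹))]
    rw [lintegral_const_mul' _ _ ENNReal.ofReal_ne_top,
      lintegral_const_mul' _ _ ENNReal.ofReal_ne_top, hs.lintegral_sum_ipw_sq_mul_sq hiid N hf]

/-- Since `b'` is monotone, the squared score at any `θ` near an interior point `θ₀` of `K` is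
dominated by the sum of the squared scores at the vertices of a cube around `θ₀` inside `K`. -/
lemma exists_scoreCoord_sq_le (hb : Monotone (deriv b)) {K : Set (Vec p)} {θ₀ : Vec p}
    (hint : θ₀ ∈ interior K) :
    ∃ δ > 0, ∃ V : (Fin p → Bool) → Vec p, (∀ σ, V σ ∈ K) ∧ ∀ θ, ‖θ - θ₀‖ ≤ δ → ∀ j z,
      scoreCoord b out θ j z ^ 2 ≤ ∑ σ, scoreCoord b out (V σ) j z ^ 2 := by
  set s : (Fin p → Bool) → Vec p := fun σ => WithLp.toLp 2 fun j => if σ j then 1 else -1 with hs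
  have h1 : ∀ᶠ t : ℝ in 𝓝 0, ∀ σ, θ₀ + t • s σ ∈ K := by
    refine eventually_all.2 fun σ => ?_
    have hc : Continuous fun t : ℝ => θ₀ + t • s σ := by fun_prop
    exact hc.continuousAt.eventually_mem (by simpa using mem_interior_iff_mem_nhds.1 hint)
  obtain ⟨δ, hK, hδ⟩ := ((h1.filter_mono nhdsWithin_le_nhds).and
    (self_mem_nhdsWithin (s := Set.Ioi (0 : ℝ)))).exists
  have hδ : 0 < δ := hδ
  refine ⟨δ, hδ, fun σ => θ₀ + δ • s σ, hK, fun θ hθ j z => ?_⟩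
  set x := z.1
  have h2 : |inner ℝ (θ - θ₀) x| ≤ δ * ∑ k, |x k| := by
    rw [inner_eq_sum, Finset.mul_sum]
    refine (Finset.abs_sum_le_sum_abs _ _).trans (Finset.sum_le_sum fun k _ => ?_)
    rw [abs_mul]
    exact mul_le_mul_of_nonneg_right ((abs_coord_le_norm _ k).trans hθ) (abs_nonneg _)
  rw [inner_sub_left, abs_le] at h2
  have h3 : ∀ σ, (inner ℝ (θ₀ + δ • s σ) x : ℝ) = inner ℝ θ₀ x +
      δ * ∑ k, (if σ k then 1 else -1) * x k := by
    intro σ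
    rw [inner_add_left, real_inner_smul_left, inner_eq_sum (s σ)]
  set σ₁ : Fin p → Bool := fun k => decide (0 ≤ x k) with hσ₁
  set σ₂ : Fin p → Bool := fun k => !decide (0 ≤ x k) with hσ₂
  have h4 : ∑ k, (if σ₁ k then (1 : ℝ) else -1) * x k = ∑ k, |x k| := by
    refine Finset.sum_congr rfl fun k _ => ?_
    by_cases hk : 0 ≤ x k
    · simp [hσ₁, hk, abs_of_nonneg hk]
    · simp [hσ₁, hk, abs_of_neg (not_le.1 hk)]
  have h5 : ∑ k, (if σ₂ k then (1 : ℝ) else -1) * x k = -∑ k, |x k| := by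
    rw [← Finset.sum_neg_distrib]
    refine Finset.sum_congr rfl fun k _ => ?_
    by_cases hk : 0 ≤ x k
    · simp [hσ₂, hk, abs_of_nonneg hk]
    · simp [hσ₂, hk, abs_of_neg (not_le.1 hk)]
  have h6 : deriv b (inner ℝ θ x) ≤ deriv b (inner ℝ (θ₀ + δ • s σ₁) x) :=
    hb (by rw [h3, h4]; linarith [h2.2])
  have h7 : deriv b (inner ℝ (θ₀ + δ • s σ₂) x) ≤ deriv b (inner ℝ θ x) :=
    hb (by rw [h3, h5]; linarith [h2.1])
  have h8 : ∃ σ, (out z - deriv b (inner ℝ θ x)) ^ 2 ≤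
      (out z - deriv b (inner ℝ (θ₀ + δ • s σ) x)) ^ 2 := by
    rcases le_total (out z) (deriv b (inner ℝ θ x)) with h | h
    · exact ⟨σ₁, sq_le_sq' (by linarith) (by linarith) |>.trans (le_of_eq (neg_sq _))⟩
    · exact ⟨σ₂, pow_le_pow_left₀ (by linarith) (by linarith) 2⟩
  obtain ⟨σ, hσ⟩ := h8
  calc scoreCoord b out θ j z ^ 2 ≤ scoreCoord b out (θ₀ + δ • s σ) j z ^ 2 := by
        simp only [scoreCoord, mul_pow]
        exact mul_le_mul_of_nonneg_right hσ (sq_nonneg _)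
    _ ≤ _ := Finset.single_le_sum (f := fun σ => scoreCoord b out (θ₀ + δ • s σ) j z ^ 2)
        (fun σ _ => sq_nonneg _) (Finset.mem_univ σ)

/-- `∑ ‖ûᵢ‖² = o_p(N²)` for the weighted score contributions `ûᵢ` at a consistent estimate. -/
lemma tendsto_sum_norm_sq_scoreTerm [IsProbabilityMeasure P] (hiid : IsIIDSample P X Y S)
    (hs : IsPoissonSampling P X Y S n π R) (hb : Monotone (deriv b)) (hout : Measurable out)
    {K : Set (Vec p)} {θ₀ : Vec p} (hint : θ₀ ∈ interior K)
    (hmom : WeightedMoments P b X (fun i ω => out (unit X Y S i ω)) n π K)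
    {θhat : ℕ × Ω → Vec p} (hθ : Tendsto θhat (whp P) (𝓝 θ₀)) :
    Tendsto (fun q : ℕ × Ω => ((q.1 : ℝ)⁻¹) ^ 2 * ∑ i : Fin q.1, ‖ipw π R q.1 i q.2 •
      scoreTerm b (θhat q) (unit X Y S i q.2).1 (out (unit X Y S i q.2))‖ ^ 2) (whp P) (𝓝 0) := by
  obtain ⟨δ, hδ, V, hV, hle⟩ := exists_scoreCoord_sq_le (out := out) hb hint
  have h1 : Tendsto (fun q : ℕ × Ω => ∑ σ, ∑ j, ((q.1 : ℝ)⁻¹) ^ 2 * ∑ i : Fin q.1,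
      ipw π R q.1 i q.2 ^ 2 * scoreCoord b out (V σ) j (unit X Y S i q.2) ^ 2) (whp P) (𝓝 0) := by
    have : Tendsto (fun q : ℕ × Ω => ∑ σ, ∑ j, ((q.1 : ℝ)⁻¹) ^ 2 * ∑ i : Fin q.1,
        ipw π R q.1 i q.2 ^ 2 * scoreCoord b out (V σ) j (unit X Y S i q.2) ^ 2) (whp P)
        (𝓝 (∑ _σ : Fin p → Bool, ∑ _j : Fin p, 0)) :=
      tendsto_finsetSum _ fun σ _ => tendsto_finsetSum _ fun j _ =>
        tendsto_sum_ipw_sq_mul_sq hiid hs (measurable_scoreCoord hb.measurable hout _ j)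
          (hs.smallVar_of_weightedMoments (hV σ) hmom j)
    simpa using this
  refine squeeze_zero' (Eventually.of_forall fun q => by positivity) ?_ h1
  filter_upwards [Metric.tendsto_nhds.1 hθ δ hδ] with q hq
  rw [dist_eq_norm] at hq
  simp only [← Finset.mul_sum]
  refine mul_le_mul_of_nonneg_left ?_ (by positivity)
  have h2 : ∀ i : Fin q.1, ‖ipw π R q.1 i q.2 •
      scoreTerm b (θhat q) (unit X Y S i q.2).1 (out (unit X Y S i q.2))‖ ^ 2 =
      ∑ j, ipw π R q.1 i q.2 ^ 2 * scoreCoord b out (θhat q) j (unit X Y S i q.2) ^ 2 := by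
    intro i
    rw [EuclideanSpace.real_norm_sq_eq]
    refine Finset.sum_congr rfl fun j _ => ?_
    rw [← mul_pow]
    rfl
  simp only [h2]
  calc ∑ i : Fin q.1, ∑ j, ipw π R q.1 i q.2 ^ 2 *
        scoreCoord b out (θhat q) j (unit X Y S i q.2) ^ 2
      ≤ ∑ i : Fin q.1, ∑ j, ipw π R q.1 i q.2 ^ 2 *
        ∑ σ, scoreCoord b out (V σ) j (unit X Y S i q.2) ^ 2 :=
        Finset.sum_le_sum fun i _ => Finset.sum_le_sum fun j _ =>
          mul_le_mul_of_nonneg_left (hle _ hq.le _ _) (sq_nonneg _)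
    _ = _ := by
        simp only [Finset.mul_sum]
        rw [Finset.sum_comm]
        calc _ = ∑ j, ∑ σ, ∑ i : Fin q.1, ipw π R q.1 i q.2 ^ 2 *
              scoreCoord b out (V σ) j (unit X Y S i q.2) ^ 2 :=
              Finset.sum_congr rfl fun j _ => Finset.sum_comm
          _ = _ := Finset.sum_comm

omit [MeasurableSpace Ω] in
lemma ind_nonneg (N : ℕ) (i : Fin N) (ω : Ω) : 0 ≤ ind R N i ω := by
  unfold ind; split_ifs <;> simp

omit [MeasurableSpace Ω] in
lemma ind_sq (N : ℕ) (i : Fin N) (ω : Ω) : ind R N i ω ^ 2 = ind R N i ω := by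
  unfold ind; split_ifs <;> simp

/-- The size of the subsample is at most of the order of its expectation. -/
lemma bddInProb_sum_ind [IsProbabilityMeasure P] (hiid : IsIIDSample P X Y S)
    (hs : IsPoissonSampling P X Y S n π R) :
    BddInProb P (fun q => (∑ i, ind R q.1 i q.2) / n q.1) := by
  refine BddInProb.of_lintegral (F := fun N ω => (∑ i, ind R N i ω) / n N) (C := 1)
    (fun N => (Finset.measurable_fun_sum _ fun i _ => hs.measurable_ind N i).div_const _) ?_
    ENNReal.one_ne_top ?_
  · intro N
    refine Eventually.of_forall fun ω => ?_
    rcases Nat.eq_zero_or_pos N with rfl | hN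
    · simp
    · exact div_nonneg (Finset.sum_nonneg fun i _ => ind_nonneg _ _ _) (hs.n_pos hN).le
  · filter_upwards [eventually_ge_atTop 1] with N hN
    have hn := hs.n_pos hN
    simp only [div_eq_inv_mul, ENNReal.ofReal_mul (inv_nonneg.2 hn.le)]
    rw [lintegral_const_mul' _ _ ENNReal.ofReal_ne_top, hs.lintegral_sum_ind hiid N,
      ← ENNReal.ofReal_mul (inv_nonneg.2 hn.le), inv_mul_cancel₀ hn.ne', ENNReal.ofReal_one]

lemma tendsto_sum_ind_div [IsProbabilityMeasure P] (hiid : IsIIDSample P X Y S)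
    (hs : IsPoissonSampling P X Y S n π R) (hn : Tendsto (fun N : ℕ => n N / N) atTop (𝓝 0)) :
    Tendsto (fun q : ℕ × Ω => (∑ i, ind R q.1 i q.2) / q.1) (whp P) (𝓝 0) := by
  refine tendsto_whp_zero_of_lintegral (F := fun N ω => (∑ i, ind R N i ω) / N)
    (fun N => (Finset.measurable_fun_sum _ fun i _ => hs.measurable_ind N i).div_const _)
    (fun N => Eventually.of_forall fun ω => div_nonneg
      (Finset.sum_nonneg fun i _ => ind_nonneg _ _ _) (Nat.cast_nonneg N)) ?_
  have h1 := ENNReal.tendsto_ofReal hn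
  rw [ENNReal.ofReal_zero] at h1
  refine h1.congr fun N => ?_
  have hN : (0 : ℝ) ≤ (N : ℝ)⁻¹ := by positivity
  simp only [div_eq_inv_mul, ENNReal.ofReal_mul hN]
  rw [lintegral_const_mul' _ _ ENNReal.ofReal_ne_top, hs.lintegral_sum_ind hiid N]

/-- The units in the subsample, counted without weights, do not contribute to means over all units
when `n / N → 0`. -/
lemma tendsto_mean_ind_mul [IsProbabilityMeasure P] (hiid : IsIIDSample P X Y S)
    (hs : IsPoissonSampling P X Y S n π R) (hn : Tendsto (fun N : ℕ => n N / N) atTop (𝓝 0))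
    (hf : Measurable f) (hint : Integrable (fun ω => f (unit X Y S 0 ω) ^ 2) P) :
    Tendsto (fun q : ℕ × Ω => (q.1 : ℝ)⁻¹ * ∑ i : Fin q.1, ind R q.1 i q.2 * f (unit X Y S i q.2))
      (whp P) (𝓝 0) := by
  refine tendsto_zero_of_sq_tendsto_zero ?_
  have h1 := (tendsto_sum_ind_div hiid hs hn).mul
    (hiid.tendsto_wmean_unitWeight (hf.pow_const 2) hint)
  rw [zero_mul] at h1
  refine squeeze_zero (fun q => sq_nonneg _) (fun q => ?_) h1
  have h2 := Finset.sum_mul_sq_le_sq_mul_sq Finset.univ (fun i => ind R q.1 i q.2)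
    (fun i : Fin q.1 => f (unit X Y S i q.2))
  simp only [ind_sq] at h2
  calc ((q.1 : ℝ)⁻¹ * ∑ i : Fin q.1, ind R q.1 i q.2 * f (unit X Y S i q.2)) ^ 2
      = ((q.1 : ℝ)⁻¹) ^ 2 * (∑ i : Fin q.1, ind R q.1 i q.2 * f (unit X Y S i q.2)) ^ 2 := mul_pow _ _ _
    _ ≤ ((q.1 : ℝ)⁻¹) ^ 2 * ((∑ i, ind R q.1 i q.2) *
          ∑ i : Fin q.1, f (unit X Y S i q.2) ^ 2) :=
        mul_le_mul_of_nonneg_left h2 (sq_nonneg _)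
    _ = _ := by
        simp only [wmean, unitWeight, one_mul]
        ring

/-- The second-moment matrix of the vectors `v̂ᵢ = (wᵢ - 1) ŝᵢ` from below, for weights that are either
`0` (when `ρᵢ = 0`) or at least `1` (when `ρᵢ = 1`), by the Cauchy-Schwarz inequality against the test
vectors `sᵢ / (1 + ‖sᵢ‖)`. The vectors `ŝᵢ` are perturbations of the `sᵢ`. -/
lemma quadratic_le_card_mul_sum {N : ℕ} {w ρ e : Fin N → ℝ} {s shat : Fin N → Vec p} {c : ℝ}
    (hc : 0 < c) (hN : 0 < N) (hρ : ∀ i, ρ i = 0 ∧ w i = 0 ∨ ρ i = 1 ∧ 1 ≤ w i)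
    (hse : ∀ i, ‖shat i - s i‖ ≤ e i) (a : Vec p)
    (hlow : c * ‖a‖ ^ 2 ≤ (N : ℝ)⁻¹ * ∑ i, w i * ((1 + ‖s i‖)⁻¹ * inner ℝ a (s i) ^ 2))
    (hsmall : (N : ℝ)⁻¹ * ∑ i, ρ i * ‖s i‖ + (N : ℝ)⁻¹ * ∑ i, w i * e i ≤ c / 2) :
    (c / 2) ^ 2 * (N : ℝ) ^ 2 * ‖a‖ ^ 2 ≤ (∑ i, ρ i) * ∑ i, inner ℝ a ((w i - 1) • shat i) ^ 2 := by
  have hN' : (0 : ℝ) < N := by exact_mod_cast hN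
  rcases (norm_nonneg a).eq_or_lt with ha | ha
  · rw [← ha]
    have : 0 ≤ ∑ i, ρ i := Finset.sum_nonneg fun i _ => by rcases hρ i with h | h <;> simp [h.1]
    have h2 : 0 ≤ ∑ i, inner ℝ a ((w i - 1) • shat i) ^ 2 := Finset.sum_nonneg fun i _ => sq_nonneg _
    simpa using mul_nonneg this h2
  set τ : Fin N → ℝ := fun i => ρ i * ((1 + ‖s i‖)⁻¹ * inner ℝ a (s i)) with hτ
  have hbd : ∀ i, |(1 + ‖s i‖)⁻¹ * inner ℝ a (s i)| ≤ ‖a‖ := by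
    intro i
    have h1 : 0 < 1 + ‖s i‖ := by positivity
    rw [abs_mul, abs_of_pos (inv_pos.2 h1), inv_mul_le_iff₀ h1]
    nlinarith [abs_real_inner_le_norm a (s i), norm_nonneg (s i), norm_nonneg a]
  have hw : ∀ i, 0 ≤ w i := fun i => by rcases hρ i with h | h <;> linarith [h.2]
  -- the term-by-term lower bound of the cross sum
  have hterm : ∀ i, w i * ((1 + ‖s i‖)⁻¹ * inner ℝ a (s i) ^ 2) -
      (ρ i * ‖s i‖ + w i * e i) * ‖a‖ ^ 2 ≤ inner ℝ a ((w i - 1) • shat i) * τ i := by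
    intro i
    rcases hρ i with h | h
    · simp [hτ, h.1, h.2]
    have h1 : inner ℝ a (shat i) = inner ℝ a (s i) + inner ℝ a (shat i - s i) := by
      rw [inner_sub_right]; ring
    set t := (1 + ‖s i‖)⁻¹ * inner ℝ a (s i) with ht
    have h2 : (1 + ‖s i‖)⁻¹ * inner ℝ a (s i) ^ 2 = t * inner ℝ a (s i) := by rw [ht]; ring
    have h3 : |t * inner ℝ a (s i)| ≤ ‖a‖ ^ 2 * ‖s i‖ := by
      rw [abs_mul]
      calc |t| * |inner ℝ a (s i)| ≤ ‖a‖ * (‖a‖ * ‖s i‖) :=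
            mul_le_mul (hbd i) (abs_real_inner_le_norm _ _) (abs_nonneg _) (norm_nonneg _)
        _ = _ := by ring
    have h4 : |t * inner ℝ a (shat i - s i)| ≤ ‖a‖ ^ 2 * e i := by
      rw [abs_mul]
      calc |t| * |inner ℝ a (shat i - s i)| ≤ ‖a‖ * (‖a‖ * e i) :=
            mul_le_mul (hbd i) ((abs_real_inner_le_norm _ _).trans
              (mul_le_mul_of_nonneg_left (hse i) (norm_nonneg _))) (abs_nonneg _) (norm_nonneg _)
        _ = _ := by ring
    have h5 : 0 ≤ ‖a‖ ^ 2 * e i := (abs_nonneg _).trans h4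
    have h6 : (w i - 1) * -(t * inner ℝ a (shat i - s i)) ≤ w i * (‖a‖ ^ 2 * e i) :=
      calc (w i - 1) * -(t * inner ℝ a (shat i - s i)) ≤ (w i - 1) * (‖a‖ ^ 2 * e i) :=
            mul_le_mul_of_nonneg_left ((neg_le_abs _).trans h4) (by linarith [h.2])
        _ ≤ w i * (‖a‖ ^ 2 * e i) := mul_le_mul_of_nonneg_right (by linarith) h5
    rw [real_inner_smul_right, hτ, h2, h.1, h1]
    have h7 := le_abs_self (t * inner ℝ a (s i))
    simp only [one_mul]
    rw [← ht, h.1]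
    nlinarith
  have hsum : N * (c / 2 * ‖a‖ ^ 2) ≤ ∑ i, inner ℝ a ((w i - 1) • shat i) * τ i := by
    have h1 := Finset.sum_le_sum fun i (_ : i ∈ Finset.univ) => hterm i
    rw [Finset.sum_sub_distrib, ← Finset.sum_mul, Finset.sum_add_distrib] at h1
    rw [← mul_add, inv_mul_le_iff₀ hN'] at hsmall
    rw [le_inv_mul_iff₀ hN'] at hlow
    nlinarith [mul_le_mul_of_nonneg_right hsmall (sq_nonneg ‖a‖)]
  have hCS := Finset.sum_mul_sq_le_sq_mul_sq Finset.univ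
    (fun i => inner ℝ a ((w i - 1) • shat i)) τ
  have hτs : ∑ i, τ i ^ 2 ≤ (∑ i, ρ i) * ‖a‖ ^ 2 := by
    rw [Finset.sum_mul]
    refine Finset.sum_le_sum fun i _ => ?_
    have h1 : ((1 + ‖s i‖)⁻¹ * inner ℝ a (s i)) ^ 2 ≤ ‖a‖ ^ 2 := by
      rw [← sq_abs]
      exact pow_le_pow_left₀ (abs_nonneg _) (hbd i) 2
    rcases hρ i with h | h
    · simp [hτ, h.1]
    · simp only [hτ, h.1, one_mul]; exact h1
  have hsq : (N * (c / 2 * ‖a‖ ^ 2)) ^ 2 ≤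
      (∑ i, inner ℝ a ((w i - 1) • shat i) ^ 2) * ((∑ i, ρ i) * ‖a‖ ^ 2) :=
    (pow_le_pow_left₀ (by positivity) hsum 2).trans (hCS.trans
      (mul_le_mul_of_nonneg_left hτs (Finset.sum_nonneg fun i _ => sq_nonneg _)))
  have ha2 : 0 < ‖a‖ ^ 2 := by positivity
  refine le_of_mul_le_mul_right ?_ ha2
  nlinarith [hsq]

/-- The empirical second-moment matrix of the `v̂ᵢ` is at least of the order `N² / #R`. -/
lemma exists_quadratic_le_card_mul_sum [IsProbabilityMeasure P] (hp : p ≠ 0)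
    (hiid : IsIIDSample P X Y S) (hs : IsPoissonSampling P X Y S n π R)
    (hb : Differentiable ℝ (deriv b)) (hb' : Continuous (deriv (deriv b))) (hout : Measurable out)
    (hbdd : (∃ C, ∀ t, |deriv (deriv b) t| ≤ C) ∨ ∃ C, ∀ᵐ ω ∂P, ‖X 0 ω‖ ≤ C)
    (hX : Integrable (fun ω => ‖X 0 ω‖ ^ 2) P)
    {K : Set (Vec p)} (hK : IsCompact K) {γ₀ : Vec p} (hγ₀ : γ₀ ∈ K)
    (hint : Integrable
      (fun ω => (deriv b (inner ℝ γ₀ (X 0 ω)) - out (unit X Y S 0 ω)) • X 0 ω) P)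
    (hmom : WeightedMoments P b X (fun i ω => out (unit X Y S i ω)) n π K)
    {V : Matrix (Fin p) (Fin p) ℝ}
    (hV : Tendsto (sigma22 P b X (fun i ω => out (unit X Y S i ω)) n π R γ₀) atTop (𝓝 V))
    (hpd : V.PosDef) (hn : Tendsto (fun N : ℕ => n N / N) atTop (𝓝 0))
    {θhat : ℕ × Ω → Vec p} (hθK : ∀ᶠ q in whp P, θhat q ∈ K)
    (hθ : Tendsto θhat (whp P) (𝓝 γ₀)) :
    ∃ c > 0, ∀ᶠ q in whp P, ∀ a : Vec p, c * (q.1 : ℝ) ^ 2 * ‖a‖ ^ 2 ≤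
      (∑ i, ind R q.1 i q.2) * ∑ i : Fin q.1, inner ℝ a ((ipw π R q.1 i q.2 - 1) •
        scoreTerm b (θhat q) (unit X Y S i q.2).1 (out (unit X Y S i q.2))) ^ 2 := by
  set v : Vec p × ℝ × ℝ → Vec p := fun z => scoreTerm b γ₀ z.1 (out z) with hv
  have hbm : Measurable (deriv b) := hb.continuous.measurable
  have hvm : ∀ j, Measurable fun z => v z j := measurable_scoreCoord hbm hout γ₀
  have hnorm : ∀ z, ‖v z‖ ^ 2 = ∑ j, v z j ^ 2 := fun z => EuclideanSpace.real_norm_sq_eq _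
  have hnm : Measurable fun z => ‖v z‖ := by
    have : (fun z => ‖v z‖) = fun z => Real.sqrt (∑ j, v z j ^ 2) := by
      funext z
      rw [← hnorm, Real.sqrt_sq (norm_nonneg _)]
    rw [this]
    exact (Finset.measurable_fun_sum _ fun j _ => (hvm j).pow_const 2).sqrt
  set ρ : Vec p × ℝ × ℝ → ℝ := fun z => (1 + ‖v z‖)⁻¹ with hρ
  have hρpos : ∀ z, 0 < ρ z := fun z => inv_pos.2 (by positivity)
  have hvint : ∀ j, Integrable (fun ω => v (unit X Y S 0 ω) j) P := integrable_scoreCoord hint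
  have hle : ∀ j k z, |ρ z * (v z j * v z k)| ≤ |v z j| := by
    intro j k z
    have h1 : 0 < 1 + ‖v z‖ := by positivity
    rw [abs_mul, abs_mul, abs_of_pos (hρpos z), hρ, inv_mul_le_iff₀ h1]
    nlinarith [abs_coord_le_norm (v z) k, abs_nonneg (v z j), abs_nonneg (v z k)]
  have hfm : ∀ j k, Measurable fun z => ρ z * (v z j * v z k) := fun j k =>
    (hnm.const_add 1).inv.mul ((hvm j).mul (hvm k))
  have hfint : ∀ j k, Integrable (fun ω => ρ (unit X Y S 0 ω) *
      (v (unit X Y S 0 ω) j * v (unit X Y S 0 ω) k)) P := fun j k =>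
    (hvint j).mono ((hfm j k).comp (hiid.measurable_unit 0)).aestronglyMeasurable
      (Eventually.of_forall fun ω => hle j k _)
  obtain ⟨c, hc, hlow⟩ := exists_wmean_sq_lower_bound (w := ipw π R) (P := P) (X := X) (Y := Y)
    (S := S) (ρ := ρ) (v := v) hρpos
    (fun j k => hs.tendsto_wmean_ipw hiid (hfm j k) (hfint j k)
      (SmallVar.of_sq_le (s := {j}) (F := fun j z => v z j) (C := 1) hiid hs (fun k _ => hvm k)
        (fun k _ => hs.smallVar_of_weightedMoments hγ₀ hmom k) zero_le_one
        (Eventually.of_forall fun ω i => by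
          rw [Finset.sum_singleton, one_mul, ← sq_abs, ← sq_abs (v _ j)]
          exact pow_le_pow_left₀ (abs_nonneg _) (hle j k _) 2)))
    hfint (fun a ha => not_ae_inner_score_eq_zero hp hiid hs hbm hout hγ₀ hmom hV hpd ha)
  obtain ⟨r, hr⟩ := hK.isBounded.exists_norm_le
  obtain ⟨L, hL0, hL⟩ := exists_curvature_bound hiid hb' r hbdd
  have hv2 : Integrable (fun ω => ‖v (unit X Y S 0 ω)‖ ^ 2) P := by
    simp only [hnorm]
    exact integrable_finsetSum _ fun j _ =>
      (hs.integrable_sq_of_weightedMoments hiid hbm hout hγ₀ hmom j).1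
  have hsm1 := tendsto_mean_ind_mul hiid hs hn (f := fun z => ‖v z‖) hnm hv2
  have hsm2 : Tendsto (fun q => wmean X Y S (ipw π R) (fun z => ‖z.1‖ ^ 2) q *
      (L * ‖θhat q - γ₀‖)) (whp P) (𝓝 0) := by
    refine (hs.bddInProb_wmean_ipw hiid (f := fun z => ‖z.1‖ ^ 2) (by fun_prop)
      (fun z => sq_nonneg _) hX).mul_tendsto_zero ?_
    have := ((hθ.sub_const γ₀).norm).const_mul L
    simpa using this
  have hsm := hsm1.add hsm2
  rw [add_zero] at hsm
  have hdesign : ∀ᶠ q in whp P, (∀ i, 0 < π q.1 i q.2) ∧ (∀ i, π q.1 i q.2 ≤ 1) ∧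
      ∀ i, ∀ t, |t| ≤ r * ‖X i q.2‖ → |deriv (deriv b) t| ≤ L := by
    refine eventually_whp_of_ae (Eventually.of_forall fun N => ?_)
    have h1 : ∀ᵐ ω ∂P, ∀ i, 0 < π N i ω := ae_all_iff.2 (hs.pos N)
    have h2 : ∀ᵐ ω ∂P, ∀ i, π N i ω ≤ 1 := ae_all_iff.2 (hs.le_one N)
    filter_upwards [h1, h2, hL] with ω h1 h2 h3
    exact ⟨h1, h2, h3⟩
  refine ⟨(c / 2) ^ 2, by positivity, ?_⟩
  filter_upwards [hlow, hsm.eventually (gt_mem_nhds (half_pos hc)), hdesign, hθK,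
    tendsto_fst_whp.eventually (eventually_ge_atTop 1)] with q h1 h2 h3 h4 h5 a
  refine quadratic_le_card_mul_sum (w := fun i => ipw π R q.1 i q.2)
    (ρ := fun i => ind R q.1 i q.2) (s := fun i : Fin q.1 => v (unit X Y S i q.2))
    (e := fun i : Fin q.1 => L * ‖X i q.2‖ ^ 2 * ‖θhat q - γ₀‖) hc h5 (fun i => ?_)
    (fun i => norm_scoreTerm_sub_le hb (h3.2.2 i) (hr _ h4) (hr _ hγ₀)) a (h1 a)
    (le_of_eq_of_le ?_ h2.le)
  · unfold ipw ind
    split_ifs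
    · exact Or.inr ⟨rfl, one_le_one_div (h3.1 i) (h3.2.1 i)⟩
    · exact Or.inl ⟨rfl, by simp⟩
  · congr 1
    simp only [wmean, Finset.mul_sum, Finset.sum_mul, unit]
    exact Finset.sum_congr rfl fun i _ => by ring

end EmpiricalMoments

/-! ### The augmented estimator with the empirical covariance estimates -/

section RegressionBound

variable {p : ℕ}

lemma det_ne_zero_of_forall_mulVec {M : Matrix (Fin p) (Fin p) ℝ}
    (h : ∀ a, M *ᵥ a = 0 → a = 0) : M.det ≠ 0 := by
  intro h0
  obtain ⟨a, ha, h1⟩ := Matrix.exists_mulVec_eq_zero_iff.2 h0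
  exact ha (h a h1)

lemma dotProduct_sq_le (x y : Fin p → ℝ) : (x ⬝ᵥ y) ^ 2 ≤ (x ⬝ᵥ x) * (y ⬝ᵥ y) := by
  simpa [dotProduct, sq] using Finset.sum_mul_sq_le_sq_mul_sq Finset.univ x y

lemma dotProduct_self_nonneg_real (x : Fin p → ℝ) : 0 ≤ x ⬝ᵥ x :=
  Finset.sum_nonneg fun _ _ => mul_self_nonneg _

lemma sum_vecMulVec_mulVec {N : ℕ} (u v : Fin N → Fin p → ℝ) (y : Fin p → ℝ) :
    (∑ i, Matrix.vecMulVec (u i) (v i)) *ᵥ y = ∑ i, (y ⬝ᵥ v i) • u i := by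
  rw [Matrix.sum_mulVec]
  refine Finset.sum_congr rfl fun i _ => ?_
  funext j
  simp only [Matrix.mulVec, dotProduct, Matrix.vecMulVec_apply, Pi.smul_apply, smul_eq_mul,
    Finset.sum_mul]
  exact Finset.sum_congr rfl fun k _ => by ring

/-- The coefficient `M₁₂ M₂₂⁻¹` built from the empirical estimates is, up to the information matrices,
the least squares coefficient of the `uᵢ` on the `vᵢ`. Cauchy-Schwarz bounds its effect on `d` by the
size of the `uᵢ` and the least eigenvalue of `∑ vᵢvᵢᵀ`. -/
lemma dotProduct_regression_le {N : ℕ} {u v : Fin N → Fin p → ℝ}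
    {I₁ I₂ : Matrix (Fin p) (Fin p) ℝ} {s c κ ρ : ℝ} (hs : s ≠ 0) (hc : 0 < c)
    (h₁ : ∀ a, c * (a ⬝ᵥ a) ≤ -(a ⬝ᵥ I₁ *ᵥ a)) (h₂ : I₂.det ≠ 0) (hκ : 0 < κ) (hρ : 0 ≤ ρ)
    (hK : ∀ a, κ * (a ⬝ᵥ a) ≤ ρ * ∑ i, (a ⬝ᵥ v i) ^ 2) {d T : Fin p → ℝ}
    (hT : T = ((s • (I₁⁻¹ * (∑ i, Matrix.vecMulVec (u i) (v i)) * I₂⁻¹)) *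
      (s • (I₂⁻¹ * (∑ i, Matrix.vecMulVec (v i) (v i)) * I₂⁻¹))⁻¹) *ᵥ d) :
    c ^ 2 * κ * (T ⬝ᵥ T) ≤ ρ * (∑ i, u i ⬝ᵥ u i) * ((I₂ *ᵥ d) ⬝ᵥ (I₂ *ᵥ d)) := by
  set G := ∑ i, Matrix.vecMulVec (u i) (v i) with hG
  set Kv := ∑ i, Matrix.vecMulVec (v i) (v i) with hKv
  have hquad : ∀ y, y ⬝ᵥ Kv *ᵥ y = ∑ i, (y ⬝ᵥ v i) ^ 2 := by
    intro y
    rw [hKv, sum_vecMulVec_mulVec, dotProduct_sum]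
    exact Finset.sum_congr rfl fun i _ => by rw [dotProduct_smul, smul_eq_mul, sq]
  have hzero : ∀ a : Fin p → ℝ, a ⬝ᵥ a ≤ 0 → a = 0 := fun a ha =>
    dotProduct_self_eq_zero.1 (le_antisymm ha (dotProduct_self_nonneg_real a))
  have hKdet : Kv.det ≠ 0 := by
    refine det_ne_zero_of_forall_mulVec fun a ha => hzero a ?_
    have h := hK a
    rw [← hquad, ha, dotProduct_zero, mul_zero] at h
    exact nonpos_of_mul_nonpos_right h hκ
  have hIdet : I₁.det ≠ 0 := by
    refine det_ne_zero_of_forall_mulVec fun a ha => hzero a ?_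
    have h := h₁ a
    rw [ha, dotProduct_zero, neg_zero] at h
    exact nonpos_of_mul_nonpos_right h hc
  set z := I₂ *ᵥ d with hz
  set y := Kv⁻¹ *ᵥ z with hy
  have hIT : I₁ *ᵥ T = G *ᵥ y := by
    have hu2 : IsUnit I₂.det := h₂.isUnit
    have hinv : (s • (I₂⁻¹ * Kv * I₂⁻¹))⁻¹ = s⁻¹ • (I₂ * Kv⁻¹ * I₂) := by
      refine Matrix.inv_eq_right_inv ?_
      rw [Matrix.smul_mul, Matrix.mul_smul, smul_smul, mul_inv_cancel₀ hs, one_smul]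
      calc I₂⁻¹ * Kv * I₂⁻¹ * (I₂ * Kv⁻¹ * I₂) = I₂⁻¹ * Kv * (I₂⁻¹ * I₂) * Kv⁻¹ * I₂ := by
            simp only [mul_assoc]
        _ = I₂⁻¹ * (Kv * Kv⁻¹) * I₂ := by
            rw [Matrix.nonsing_inv_mul _ hu2, mul_one, mul_assoc I₂⁻¹]
        _ = 1 := by
            rw [Matrix.mul_nonsing_inv _ hKdet.isUnit, mul_one, Matrix.nonsing_inv_mul _ hu2]
    have hprod : (s • (I₁⁻¹ * G * I₂⁻¹)) * (s • (I₂⁻¹ * Kv * I₂⁻¹))⁻¹ =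
        I₁⁻¹ * (G * Kv⁻¹ * I₂) := by
      rw [hinv, Matrix.smul_mul, Matrix.mul_smul, smul_smul, mul_inv_cancel₀ hs, one_smul]
      calc I₁⁻¹ * G * I₂⁻¹ * (I₂ * Kv⁻¹ * I₂) = I₁⁻¹ * G * (I₂⁻¹ * I₂) * Kv⁻¹ * I₂ := by
            simp only [mul_assoc]
        _ = _ := by
            rw [Matrix.nonsing_inv_mul _ hu2, mul_one]
            simp only [mul_assoc]
    rw [hT, hprod, Matrix.mulVec_mulVec, ← mul_assoc, Matrix.mul_nonsing_inv _ hIdet.isUnit,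
      one_mul, hy, hz, Matrix.mulVec_mulVec, Matrix.mulVec_mulVec, mul_assoc]
  have hKy : Kv *ᵥ y = z := by
    rw [hy, Matrix.mulVec_mulVec, Matrix.mul_nonsing_inv _ hKdet.isUnit, Matrix.one_mulVec]
  set q := ∑ i, (y ⬝ᵥ v i) ^ 2 with hq
  have hq0 : 0 ≤ q := Finset.sum_nonneg fun i _ => sq_nonneg _
  have hqz : q = y ⬝ᵥ z := by rw [hq, ← hquad, hKy]
  -- `κ q ≤ ρ ‖z‖²`
  have hκq : κ * q ≤ ρ * (z ⬝ᵥ z) := by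
    rcases hq0.eq_or_lt with h0 | h0
    · rw [← h0, mul_zero]
      exact mul_nonneg hρ (dotProduct_self_nonneg_real z)
    · have h3 := dotProduct_sq_le y z
      rw [← hqz] at h3
      have h4 := mul_le_mul_of_nonneg_right (hK y) (dotProduct_self_nonneg_real z)
      refine le_of_mul_le_mul_right ?_ h0
      nlinarith
  -- `‖∑ (y ⬝ vᵢ) uᵢ‖² ≤ q ∑ ‖uᵢ‖²`
  set g := G *ᵥ y with hg
  have hU0 : 0 ≤ ∑ i, u i ⬝ᵥ u i := Finset.sum_nonneg fun i _ => dotProduct_self_nonneg_real _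
  have hgg : g ⬝ᵥ g ≤ q * ∑ i, u i ⬝ᵥ u i := by
    rcases (dotProduct_self_nonneg_real g).eq_or_lt with h0 | h0
    · rw [← h0]; exact mul_nonneg hq0 hU0
    · have h3 : g ⬝ᵥ g = ∑ i, (y ⬝ᵥ v i) * (g ⬝ᵥ u i) := by
        conv_lhs => rw [hg, hG, sum_vecMulVec_mulVec, ← sum_vecMulVec_mulVec u v y, ← hG, ← hg]
        conv_lhs => rhs; rw [hg, hG, sum_vecMulVec_mulVec]
        rw [dotProduct_sum]
        exact Finset.sum_congr rfl fun i _ => by rw [dotProduct_smul, smul_eq_mul]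
      have h4 := Finset.sum_mul_sq_le_sq_mul_sq Finset.univ (fun i => y ⬝ᵥ v i) (fun i => g ⬝ᵥ u i)
      rw [← h3, ← hq] at h4
      have h5 : ∑ i, (g ⬝ᵥ u i) ^ 2 ≤ (g ⬝ᵥ g) * ∑ i, u i ⬝ᵥ u i := by
        rw [Finset.mul_sum]
        exact Finset.sum_le_sum fun i _ => dotProduct_sq_le _ _
      refine le_of_mul_le_mul_right ?_ h0
      nlinarith [mul_le_mul_of_nonneg_left h5 hq0]
  -- `c ‖T‖ ≤ ‖I₁ T‖`
  have hTT : c ^ 2 * (T ⬝ᵥ T) ≤ g ⬝ᵥ g := by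
    rcases (dotProduct_self_nonneg_real T).eq_or_lt with h0 | h0
    · rw [← h0, mul_zero]; exact dotProduct_self_nonneg_real g
    · have h3 := h₁ T
      rw [hIT] at h3
      have h4 : (c * (T ⬝ᵥ T)) ^ 2 ≤ (T ⬝ᵥ g) ^ 2 := by
        rw [← neg_sq (T ⬝ᵥ g)]
        exact pow_le_pow_left₀ (by positivity) h3 2
      refine le_of_mul_le_mul_right ?_ h0
      nlinarith [dotProduct_sq_le T g]
  calc c ^ 2 * κ * (T ⬝ᵥ T) = κ * (c ^ 2 * (T ⬝ᵥ T)) := by ring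
    _ ≤ κ * (q * ∑ i, u i ⬝ᵥ u i) := mul_le_mul_of_nonneg_left (hTT.trans hgg) hκ.le
    _ = κ * q * ∑ i, u i ⬝ᵥ u i := by ring
    _ ≤ ρ * (z ⬝ᵥ z) * ∑ i, u i ⬝ᵥ u i := mul_le_mul_of_nonneg_right hκq hU0
    _ = _ := by ring

end RegressionBound

section EmpiricalAugmentation

variable {Ω : Type*} [MeasurableSpace Ω] {p : ℕ} {P : Measure Ω}
  {X : ℕ → Ω → Vec p} {Y S : ℕ → Ω → ℝ} {n : ℕ → ℝ}
  {π : (N : ℕ) → Fin N → Ω → ℝ} {R : (N : ℕ) → Fin N → Ω → Bool}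
  {b : ℝ → ℝ} {out : Vec p × ℝ × ℝ → ℝ} {w : (N : ℕ) → Fin N → Ω → ℝ}

lemma dotProduct_ofLp_self (a : Vec p) : a.ofLp ⬝ᵥ a.ofLp = ‖a‖ ^ 2 := by
  rw [EuclideanSpace.real_norm_sq_eq]
  exact Finset.sum_congr rfl fun i _ => (sq _).symm

omit [MeasurableSpace Ω] in
lemma neg_dotProduct_empInfo (θ a : Vec p) (q : ℕ × Ω) :
    -(a.ofLp ⬝ᵥ empInfo b X q.1 θ q.2 *ᵥ a.ofLp) = wmean X Y S unitWeight
      (fun z => deriv (deriv b) (inner ℝ θ z.1) * inner ℝ a z.1 ^ 2) q := by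
  simp only [wmean, unitWeight, one_mul, inner_sq_eq_sum, empInfo, dotProduct, Matrix.mulVec,
    Matrix.of_apply, unit, Finset.mul_sum, Finset.sum_mul, ← Finset.sum_neg_distrib]
  rw [Finset.sum_comm' (t' := Finset.univ) (s' := fun _ => Finset.univ) (by simp)]
  rw [Finset.sum_comm]
  rw [Finset.sum_comm (s := (Finset.univ : Finset (Fin q.1)))]
  refine Finset.sum_congr rfl fun j _ => ?_
  rw [Finset.sum_comm]
  refine Finset.sum_congr rfl fun i _ => Finset.sum_congr rfl fun k _ => ?_
  ring

omit [MeasurableSpace Ω] in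
lemma abs_empInfo_le {θ : Vec p} {q : ℕ × Ω} {r L : ℝ} (hθ : ‖θ‖ ≤ r)
    (hL : ∀ i, ∀ t, |t| ≤ r * ‖X i q.2‖ → |deriv (deriv b) t| ≤ L) (j k : Fin p) :
    |empInfo b X q.1 θ q.2 j k| ≤ L * wmean X Y S unitWeight (fun z => ‖z.1‖ ^ 2) q := by
  simp only [empInfo, Matrix.of_apply, abs_neg, wmean, unitWeight, one_mul, unit]
  rw [abs_mul, abs_of_nonneg (by positivity : (0 : ℝ) ≤ (q.1 : ℝ)⁻¹), mul_left_comm]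
  refine mul_le_mul_of_nonneg_left ?_ (by positivity)
  rw [Finset.mul_sum]
  refine (Finset.abs_sum_le_sum_abs _ _).trans (Finset.sum_le_sum fun i _ => ?_)
  rw [abs_mul, abs_mul, sq]
  exact mul_le_mul (hL i _ (abs_inner_le_of_norm_le hθ))
    (mul_le_mul (abs_coord_le_norm _ j) (abs_coord_le_norm _ k) (abs_nonneg _) (norm_nonneg _))
    (by positivity) ((abs_nonneg _).trans (hL i _ (abs_inner_le_of_norm_le hθ)))

/-- Curvature of the weighted score around a well-separated interior zero of the population score. -/
lemma exists_curvature_lower_bound [IsProbabilityMeasure P] (hiid : IsIIDSample P X Y S)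
    {h : Vec p → ℝ} {r : ℝ} (hh : IsCurvatureMinorant b r h)
    (hX : Integrable (fun ω => ‖X 0 ω‖ ^ 2) P) {K : Set (Vec p)} {θ₀ : Vec p}
    (hint : θ₀ ∈ interior K)
    (hsep : WellSeparated (popScore P b (X 0) fun ω => out (unit X Y S 0 ω)) θ₀ K)
    (h0 : popScore P b (X 0) (fun ω => out (unit X Y S 0 ω)) θ₀ = 0)
    (hlln : ∀ j k, Tendsto (wmean X Y S w fun z => h z.1 * (z.1 j * z.1 k)) (whp P)
      (𝓝 (∫ ω, h (X 0 ω) * (X 0 ω j * X 0 ω k) ∂P))) :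
    ∃ c > 0, ∀ᶠ q in whp P, ∀ a : Vec p,
      c * ‖a‖ ^ 2 ≤ wmean X Y S w (fun z => h z.1 * inner ℝ a z.1 ^ 2) q :=
  exists_wmean_sq_lower_bound (ρ := fun z => h z.1) (v := fun z => z.1) (fun z => hh.pos z.1) hlln
    (hh.integrable_mul hX (hiid.measurable_X 0))
    (fun _ ha => not_ae_inner_eq_zero hint hsep h0 ha)

lemma tendsto_wmean_unitWeight_minorant [IsProbabilityMeasure P] (hiid : IsIIDSample P X Y S)
    {h : Vec p → ℝ} {r : ℝ} (hh : IsCurvatureMinorant b r h)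
    (hX : Integrable (fun ω => ‖X 0 ω‖ ^ 2) P) (j k : Fin p) :
    Tendsto (wmean X Y S unitWeight fun z => h z.1 * (z.1 j * z.1 k)) (whp P)
      (𝓝 (∫ ω, h (X 0 ω) * (X 0 ω j * X 0 ω k) ∂P)) :=
  hiid.tendsto_wmean_unitWeight (f := fun z => h z.1 * (z.1 j * z.1 k))
    ((hh.measurable.comp measurable_fst).mul (by fun_prop))
    (hh.integrable_mul hX (hiid.measurable_X 0) j k)

/-- The empirical information matrix is negative definite, uniformly in `N`. -/
lemma exists_empInfo_lower_bound [IsProbabilityMeasure P] (hiid : IsIIDSample P X Y S)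
    {ν : Measure ℝ} {c₀ : ℝ → ℝ} (hfam : IsCanonicalFamily ν b c₀) (hp : p ≠ 0)
    (hX : Integrable (fun ω => ‖X 0 ω‖ ^ 2) P) {K : Set (Vec p)} (hK : IsCompact K) {θ₀ : Vec p}
    (hint : θ₀ ∈ interior K)
    (hsep : WellSeparated (popScore P b (X 0) fun ω => out (unit X Y S 0 ω)) θ₀ K)
    (h0 : popScore P b (X 0) (fun ω => out (unit X Y S 0 ω)) θ₀ = 0)
    {θhat : ℕ × Ω → Vec p} (hθ : ∀ᶠ q in whp P, θhat q ∈ K) :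
    ∃ c > 0, ∀ᶠ q in whp P, ∀ a : Fin p → ℝ,
      c * (a ⬝ᵥ a) ≤ -(a ⬝ᵥ empInfo b X q.1 (θhat q) q.2 *ᵥ a) := by
  obtain ⟨r, hr⟩ := hK.isBounded.exists_norm_le
  have hr0 : 0 ≤ r := (norm_nonneg _).trans (hr θ₀ (interior_subset hint))
  obtain ⟨h, hh⟩ := exists_isCurvatureMinorant (p := p) hfam.continuous_deriv_deriv
    (deriv_deriv_pos_of_wellSeparated hfam hp hint hsep h0) hr0
  obtain ⟨c, hc, hlow⟩ := exists_curvature_lower_bound hiid hh hX hint hsep h0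
    (tendsto_wmean_unitWeight_minorant hiid hh hX)
  refine ⟨c, hc, ?_⟩
  filter_upwards [hlow, hθ] with q h1 h2 a
  have h3 := neg_dotProduct_empInfo (b := b) (X := X) (Y := Y) (S := S) (θhat q)
    (WithLp.toLp 2 a) q
  have h4 := dotProduct_ofLp_self (WithLp.toLp 2 a)
  simp only at h3 h4
  rw [h3, h4]
  refine (h1 _).trans (wmean_mono (fun i => zero_le_one) fun i => ?_)
  exact mul_le_mul_of_nonneg_right (hh.le _ _ (abs_inner_le_of_norm_le (hr _ h2))) (sq_nonneg _)

/-- Rate of convergence: `n ‖θ̂ - θ₀‖²` is tight if `n` times the squared mean score at `θ₀` is. -/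
lemma bddInProb_mul_norm_sub_sq [IsProbabilityMeasure P] (hiid : IsIIDSample P X Y S)
    (hs : IsPoissonSampling P X Y S n π R) {h : Vec p → ℝ} {r : ℝ}
    (hh : IsCurvatureMinorant b r h) (hb : Differentiable ℝ (deriv b))
    (hX : Integrable (fun ω => ‖X 0 ω‖ ^ 2) P) {K : Set (Vec p)} (hr : ∀ θ ∈ K, ‖θ‖ ≤ r)
    {θ₀ : Vec p} (hint : θ₀ ∈ interior K)
    (hsep : WellSeparated (popScore P b (X 0) fun ω => out (unit X Y S 0 ω)) θ₀ K)
    (h0 : popScore P b (X 0) (fun ω => out (unit X Y S 0 ω)) θ₀ = 0)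
    (hw : ∀ N, ∀ᵐ ω ∂P, ∀ i, 0 ≤ w N i ω)
    (hlln : ∀ j k, Tendsto (wmean X Y S w fun z => h z.1 * (z.1 j * z.1 k)) (whp P)
      (𝓝 (∫ ω, h (X 0 ω) * (X 0 ω j * X 0 ω k) ∂P)))
    (hscore : ∀ j, BddInProb P fun q => n q.1 * wmean X Y S w (scoreCoord b out θ₀ j) q ^ 2)
    {θhat : ℕ × Ω → Vec p}
    (hθ : ∀ᶠ q in whp P, θhat q ∈ K ∧ meanScore X Y S w b out (θhat q) q = 0) :
    BddInProb P fun q => n q.1 * ‖θhat q - θ₀‖ ^ 2 := by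
  obtain ⟨c, hc, hlow⟩ := exists_curvature_lower_bound hiid hh hX hint hsep h0 hlln
  have h1 := (BddInProb.const (P := P) ((c ^ 2)⁻¹)).mul
    (BddInProb.sum Finset.univ fun j _ => hscore j)
  refine h1.mono ?_
  have hw' : ∀ᶠ q in whp P, ∀ i, 0 ≤ w q.1 i q.2 :=
    eventually_whp_of_ae (Eventually.of_forall hw)
  filter_upwards [hlow, hθ, hw', tendsto_fst_whp.eventually (eventually_ge_atTop 1)]
    with q h2 h3 h4 h5
  have hn := hs.n_pos h5
  have h6 := hh.mul_norm_sub_le hb h4 h2 (hr _ h3.1) (hr _ (interior_subset hint)) h3.2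
  have h7 : ‖meanScore X Y S w b out θ₀ q‖ ^ 2 =
      ∑ j, wmean X Y S w (scoreCoord b out θ₀ j) q ^ 2 := by
    rw [EuclideanSpace.real_norm_sq_eq]
    simp only [meanScore_apply]
  rw [← Finset.mul_sum, ← h7, abs_of_nonneg (by positivity), abs_of_nonneg (by positivity)]
  have h8 : c ^ 2 * ‖θhat q - θ₀‖ ^ 2 ≤ ‖meanScore X Y S w b out θ₀ q‖ ^ 2 := by
    rw [← mul_pow]
    exact pow_le_pow_left₀ (by positivity) h6 2
  rw [mul_left_comm]
  refine mul_le_mul_of_nonneg_left ?_ hn.le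
  rw [le_inv_mul_iff₀ (by positivity)]
  exact h8

/-- The surrogate estimates from the subsample and from the full data are within `O_p(n^{-1/2})` of
each other. -/
lemma bddInProb_mul_norm_sub_full_sq [IsProbabilityMeasure P] (hp : p ≠ 0)
    (hiid : IsIIDSample P X Y S) (hs : IsPoissonSampling P X Y S n π R)
    {ν : Measure ℝ} {c₀ : ℝ → ℝ} (hfam : IsCanonicalFamily ν b c₀) (hout : Measurable out)
    (hX : Integrable (fun ω => ‖X 0 ω‖ ^ 2) P) {K : Set (Vec p)} (hK : IsCompact K) {γ₀ : Vec p}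
    (hint : γ₀ ∈ interior K)
    (hsep : WellSeparated (popScore P b (X 0) fun ω => out (unit X Y S 0 ω)) γ₀ K)
    (h0 : popScore P b (X 0) (fun ω => out (unit X Y S 0 ω)) γ₀ = 0)
    (hg : ∀ θ ∈ K, Integrable
      (fun ω => (deriv b (inner ℝ θ (X 0 ω)) - out (unit X Y S 0 ω)) • X 0 ω) P)
    (hmom : WeightedMoments P b X (fun i ω => out (unit X Y S i ω)) n π K)
    {V : Matrix (Fin p) (Fin p) ℝ}
    (hV : Tendsto (sigma22 P b X (fun i ω => out (unit X Y S i ω)) n π R γ₀) atTop (𝓝 V))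
    (hpd : V.PosDef) {γhat γfull : ℕ × Ω → Vec p}
    (h1 : ∀ᶠ q in whp P, γhat q ∈ K ∧ meanScore X Y S (ipw π R) b out (γhat q) q = 0)
    (h2 : ∀ᶠ q in whp P, γfull q ∈ K ∧ meanScore X Y S unitWeight b out (γfull q) q = 0) :
    BddInProb P fun q => n q.1 * ‖γhat q - γfull q‖ ^ 2 := by
  have hb := hfam.differentiable_deriv
  have hbm := hfam.continuous_deriv.measurable
  have hγ₀ : γ₀ ∈ K := interior_subset hint
  obtain ⟨r, hr⟩ := hK.isBounded.exists_norm_le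
  have hr0 : 0 ≤ r := (norm_nonneg _).trans (hr γ₀ hγ₀)
  obtain ⟨h, hh⟩ := exists_isCurvatureMinorant (p := p) hfam.continuous_deriv_deriv
    (deriv_deriv_pos_of_wellSeparated hfam hp hint hsep h0) hr0
  have hmean : ∀ j, ∫ ω, scoreCoord b out γ₀ j (unit X Y S 0 ω) ∂P = 0 := by
    intro j
    have := popScore_apply (hg γ₀ hγ₀) j
    rw [h0] at this
    simpa using this.symm
  have hfull : ∀ j, BddInProb P fun q =>
      n q.1 * wmean X Y S unitWeight (scoreCoord b out γ₀ j) q ^ 2 := fun j =>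
    bddInProb_fullScore hiid hs (measurable_scoreCoord hbm hout γ₀ j) (hmean j)
      (hs.integrable_sq_of_weightedMoments hiid hbm hout hγ₀ hmom j).1
  have hsub : ∀ j, BddInProb P fun q =>
      n q.1 * wmean X Y S (ipw π R) (scoreCoord b out γ₀ j) q ^ 2 := by
    intro j
    have h3 := (BddInProb.const (P := P) 2).mul
      ((bddInProb_samplingError hp hiid hs hbm hout hγ₀ hmom hV hpd j).add (hfull j))
    refine h3.mono ?_
    filter_upwards [tendsto_fst_whp.eventually (eventually_ge_atTop 1)] with q hq
    have hn := hs.n_pos hq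
    have h4 : wmean X Y S (ipw π R) (scoreCoord b out γ₀ j) q =
        (q.1 : ℝ)⁻¹ * samplingError X Y S π R (scoreCoord b out γ₀ j) q.1 q.2 +
          wmean X Y S unitWeight (scoreCoord b out γ₀ j) q := by
      rw [wmean, wmean, samplingError, ← mul_add, ← Finset.sum_add_distrib]
      congr 1
      exact Finset.sum_congr rfl fun i _ => by simp only [unitWeight]; ring
    rw [abs_of_nonneg (by positivity), abs_of_nonneg (by positivity), h4]
    set x := samplingError X Y S π R (scoreCoord b out γ₀ j) q.1 q.2
    set y := wmean X Y S unitWeight (scoreCoord b out γ₀ j) q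
    have h5 : n q.1 / (q.1 : ℝ) ^ 2 * x ^ 2 = n q.1 * ((q.1 : ℝ)⁻¹ * x) ^ 2 := by
      rw [mul_pow, inv_pow]; ring
    rw [h5, ← mul_add, mul_left_comm]
    exact mul_le_mul_of_nonneg_left (by linarith [add_sq_le (a := (q.1 : ℝ)⁻¹ * x) (b := y)]) hn.le
  have hA := bddInProb_mul_norm_sub_sq hiid hs hh hb hX hr hint hsep h0 hs.ae_ipw_nonneg
    (fun j k => hs.tendsto_wmean_ipw hiid (f := fun z => h z.1 * (z.1 j * z.1 k))
      ((hh.measurable.comp measurable_fst).mul (by fun_prop))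
      (hh.integrable_mul hX (hiid.measurable_X 0) j k)
      (hh.smallVar_mul hb hiid hs hout hr hint hmom j k)) hsub h1
  have hB := bddInProb_mul_norm_sub_sq hiid hs hh hb hX hr hint hsep h0
    (fun N => Eventually.of_forall fun ω i => zero_le_one)
    (tendsto_wmean_unitWeight_minorant hiid hh hX) hfull h2
  refine ((BddInProb.const (P := P) 2).mul (hA.add hB)).mono ?_
  filter_upwards [tendsto_fst_whp.eventually (eventually_ge_atTop 1)] with q hq
  have hn := hs.n_pos hq
  rw [abs_of_nonneg (by positivity), abs_of_nonneg (by positivity), ← mul_add, mul_left_comm]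
  refine mul_le_mul_of_nonneg_left ?_ hn.le
  have h5 : ‖γhat q - γfull q‖ ≤ ‖γhat q - γ₀‖ + ‖γfull q - γ₀‖ := by
    rw [← sub_sub_sub_cancel_right (γhat q) (γfull q) γ₀]
    exact norm_sub_le _ _
  calc ‖γhat q - γfull q‖ ^ 2 ≤ (‖γhat q - γ₀‖ + ‖γfull q - γ₀‖) ^ 2 :=
        pow_le_pow_left₀ (norm_nonneg _) h5 2
    _ ≤ _ := add_sq_le

lemma norm_sq_mulVec_le {M : Matrix (Fin p) (Fin p) ℝ} {B : ℝ} (hM : ∀ j k, |M j k| ≤ B)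
    (d : Vec p) : (M *ᵥ d.ofLp) ⬝ᵥ (M *ᵥ d.ofLp) ≤ p ^ 3 * (B ^ 2 * ‖d‖ ^ 2) := by
  have h1 : ∀ j, (M *ᵥ d.ofLp) j * (M *ᵥ d.ofLp) j ≤ (p * (B * ‖d‖)) ^ 2 := by
    intro j
    rw [← sq, ← sq_abs]
    refine pow_le_pow_left₀ (abs_nonneg _) ?_ 2
    calc |(M *ᵥ d.ofLp) j| ≤ ∑ k, |M j k * d k| := by
          rw [Matrix.mulVec, dotProduct]
          exact Finset.abs_sum_le_sum_abs _ _
      _ ≤ ∑ _k : Fin p, B * ‖d‖ := by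
          refine Finset.sum_le_sum fun k _ => ?_
          rw [abs_mul]
          exact mul_le_mul (hM j k) (abs_coord_le_norm d k) (abs_nonneg _)
            ((abs_nonneg _).trans (hM j k))
      _ = p * (B * ‖d‖) := by simp
  calc (M *ᵥ d.ofLp) ⬝ᵥ (M *ᵥ d.ofLp) ≤ ∑ _j : Fin p, ((p : ℝ) * (B * ‖d‖)) ^ 2 :=
        Finset.sum_le_sum fun j _ => h1 j
    _ = _ := by
        rw [Finset.sum_const, Finset.card_univ, Fintype.card_fin, nsmul_eq_mul]
        ring

end EmpiricalAugmentation

section Main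

/-- The correction term of the augmented estimator with the empirical covariance estimates is
`o_p(1)`. Consistency of the estimates themselves is not needed; the bound `dotProduct_regression_le`
on their quotient is enough. -/
lemma tendsto_empirical_correction {Ω : Type*} [MeasurableSpace Ω] {P : Measure Ω}
    [IsProbabilityMeasure P] {p : ℕ} (hp : p ≠ 0) {X : ℕ → Ω → Vec p} {Y S : ℕ → Ω → ℝ} {n : ℕ → ℝ}
    {π : (N : ℕ) → Fin N → Ω → ℝ} {R : (N : ℕ) → Fin N → Ω → Bool}
    (hiid : IsIIDSample P X Y S) (hs : IsPoissonSampling P X Y S n π R)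
    {A B : Set (Vec p)} (hA : IsCompact A) (hB : IsCompact B) {β₀ γ₀ : Vec p}
    (hβ₀ : β₀ ∈ interior B) (hγ₀ : γ₀ ∈ interior A)
    {ν₁ ν₂ : Measure ℝ} {b₁ b₂ c₁ c₂ : ℝ → ℝ}
    (hfam₁ : IsCanonicalFamily ν₁ b₁ c₁) (hfam₂ : IsCanonicalFamily ν₂ b₂ c₂)
    {βhat γhat γfull : ℕ → Ω → Vec p}
    (hβhat : ∀ᶠ q in whp P, βhat q.1 q.2 ∈ B)
    (hγhat : ∀ᶠ q in whp P, γhat q.1 q.2 ∈ A ∧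
      meanScore X Y S (ipw π R) b₂ (fun z => z.2.2) (γhat q.1 q.2) q = 0)
    (hγfull : ∀ᶠ q in whp P, γfull q.1 q.2 ∈ A ∧
      meanScore X Y S unitWeight b₂ (fun z => z.2.2) (γfull q.1 q.2) q = 0)
    (hβlim : Tendsto (fun q : ℕ × Ω => βhat q.1 q.2) (whp P) (𝓝 β₀))
    (hγlim : Tendsto (fun q : ℕ × Ω => γhat q.1 q.2) (whp P) (𝓝 γ₀))
    (hbdd₂ : (∃ C, ∀ t, |deriv (deriv b₂) t| ≤ C) ∨ ∃ C, ∀ᵐ ω ∂P, ‖X 0 ω‖ ≤ C)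
    (hX : Integrable (fun ω => ‖X 0 ω‖ ^ 2) P)
    (hg₂ : ∀ γ ∈ A, Integrable (fun ω => (deriv b₂ (inner ℝ γ (X 0 ω)) - S 0 ω) • X 0 ω) P)
    (hmom₁ : WeightedMoments P b₁ X Y n π B) (hmom₂ : WeightedMoments P b₂ X S n π A)
    (hsep₁ : WellSeparated (popScore P b₁ (X 0) (Y 0)) β₀ B)
    (hsep₂ : WellSeparated (popScore P b₂ (X 0) (S 0)) γ₀ A)
    (hpop₁ : popScore P b₁ (X 0) (Y 0) β₀ = 0) (hpop₂ : popScore P b₂ (X 0) (S 0) γ₀ = 0)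
    {V : Matrix (Fin p) (Fin p) ℝ}
    (hV : Tendsto (sigma22 P b₂ X S n π R γ₀) atTop (𝓝 V)) (hpd : V.PosDef)
    (hn : Tendsto (fun N : ℕ => n N / N) atTop (𝓝 0)) :
    Tendsto (fun q : ℕ × Ω => WithLp.toLp 2
      ((empSigma12 b₁ b₂ X Y S n π R βhat γhat q.1 q.2 *
        (empSigma22 b₂ X S n π R γhat q.1 q.2)⁻¹) *ᵥ (γhat q.1 q.2 - γfull q.1 q.2).ofLp))
      (whp P) (𝓝 (0 : Vec p)) := by
  have hout₁ : Measurable fun z : Vec p × ℝ × ℝ => z.2.1 := by fun_prop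
  have hout₂ : Measurable fun z : Vec p × ℝ × ℝ => z.2.2 := by fun_prop
  obtain ⟨c, hc, hI₁⟩ := exists_empInfo_lower_bound (out := fun z => z.2.1) hiid hfam₁ hp hX hB hβ₀
    hsep₁ hpop₁ hβhat
  obtain ⟨c', hc', hI₂⟩ := exists_empInfo_lower_bound (out := fun z => z.2.2) hiid hfam₂ hp hX hA hγ₀
    hsep₂ hpop₂ (hγhat.mono fun q h => h.1)
  obtain ⟨κ, hκ, hK⟩ := exists_quadratic_le_card_mul_sum (out := fun z => z.2.2) hp hiid hs
    hfam₂.differentiable_deriv hfam₂.continuous_deriv_deriv hout₂ hbdd₂ hX hA (interior_subset hγ₀)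
    (hg₂ _ (interior_subset hγ₀)) hmom₂ hV hpd hn (hγhat.mono fun q h => h.1) hγlim
  have hU := tendsto_sum_norm_sq_scoreTerm (out := fun z => z.2.1) hiid hs hfam₁.monotone_deriv
    hout₁ hβ₀ hmom₁ hβlim
  have hD := bddInProb_mul_norm_sub_full_sq (out := fun z => z.2.2) hp hiid hs hfam₂ hout₂ hX hA hγ₀
    hsep₂ hpop₂ hg₂ hmom₂ hV hpd hγhat hγfull
  obtain ⟨r, hr⟩ := hA.isBounded.exists_norm_le
  obtain ⟨L, hL0, hL⟩ := exists_curvature_bound hiid hfam₂.continuous_deriv_deriv r hbdd₂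
  have hW : BddInProb P fun q => L * wmean X Y S unitWeight (fun z => ‖z.1‖ ^ 2) q :=
    (BddInProb.const L).mul (BddInProb.of_tendsto
      (hiid.tendsto_wmean_unitWeight (f := fun z => ‖z.1‖ ^ 2) (by fun_prop) hX))
  have hlim := ((((BddInProb.const (P := P) ((p : ℝ) ^ 3 / (c ^ 2 * κ))).mul
    (bddInProb_sum_ind hiid hs)).mul (hW.mul hW)).mul hD).mul_tendsto_zero hU
  rw [tendsto_zero_iff_norm_tendsto_zero]
  refine tendsto_zero_of_sq_tendsto_zero (squeeze_zero' (Eventually.of_forall fun q => sq_nonneg _)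
    ?_ hlim)
  have hL' : ∀ᶠ q in whp P, ∀ i, ∀ t, |t| ≤ r * ‖X i q.2‖ → |deriv (deriv b₂) t| ≤ L :=
    eventually_whp_of_ae (Eventually.of_forall fun N => hL)
  filter_upwards [hI₁, hI₂, hK, hγhat, hL', tendsto_fst_whp.eventually (eventually_ge_atTop 1)]
    with q h1 h2 h3 h4 h5 h6
  have hN : (0 : ℝ) < q.1 := by exact_mod_cast h6
  have hnq := hs.n_pos h6
  set d : Vec p := γhat q.1 q.2 - γfull q.1 q.2 with hd
  set W := L * wmean X Y S unitWeight (fun z => ‖z.1‖ ^ 2) q with hWdef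
  have hdet : (empInfo b₂ X q.1 (γhat q.1 q.2) q.2).det ≠ 0 := by
    refine det_ne_zero_of_forall_mulVec fun a ha => ?_
    have h := h2 a
    rw [ha, dotProduct_zero, neg_zero] at h
    exact dotProduct_self_eq_zero.1 (le_antisymm (nonpos_of_mul_nonpos_right h hc')
      (dotProduct_self_nonneg_real a))
  have hρ : 0 ≤ ∑ i, ind R q.1 i q.2 := Finset.sum_nonneg fun i _ => ind_nonneg _ _ _
  set u : Fin q.1 → Vec p := fun i => ipw π R q.1 i q.2 •
    scoreTerm b₁ (βhat q.1 q.2) (X i q.2) (Y i q.2) with hu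
  set v : Fin q.1 → Vec p := fun i => (ipw π R q.1 i q.2 - 1) •
    scoreTerm b₂ (γhat q.1 q.2) (X i q.2) (S i q.2) with hv
  set T := (empSigma12 b₁ b₂ X Y S n π R βhat γhat q.1 q.2 *
        (empSigma22 b₂ X S n π R γhat q.1 q.2)⁻¹) *ᵥ d.ofLp with hT
  have key := dotProduct_regression_le (u := fun i => (u i).ofLp) (v := fun i => (v i).ofLp)
    (s := n q.1 / (q.1 : ℝ) ^ 2) (c := c) (κ := κ * (q.1 : ℝ) ^ 2) (ρ := ∑ i, ind R q.1 i q.2)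
    (by positivity) hc h1 hdet (by positivity) hρ (fun a => by
      have h := h3 (WithLp.toLp 2 a)
      rw [← dotProduct_ofLp_self] at h
      simp only [inner_eq_sum] at h
      exact h) (d := d.ofLp) (T := T) hT
  have hz := norm_sq_mulVec_le (abs_empInfo_le (X := X) (Y := Y) (S := S) (b := b₂) (q := q)
    (hr _ h4.1) h5) d
  rw [← hWdef] at hz
  have hTn : T ⬝ᵥ T = ‖(WithLp.toLp 2 T : Vec p)‖ ^ 2 := dotProduct_ofLp_self (WithLp.toLp 2 T)
  have hun : ∑ i, (u i).ofLp ⬝ᵥ (u i).ofLp = ∑ i, ‖u i‖ ^ 2 :=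
    Finset.sum_congr rfl fun i _ => dotProduct_ofLp_self _
  rw [hTn, hun] at key
  have hU0 : 0 ≤ ∑ i, ‖u i‖ ^ 2 := Finset.sum_nonneg fun i _ => sq_nonneg _
  have key2 := key.trans (mul_le_mul_of_nonneg_left hz (mul_nonneg hρ hU0))
  have hpos : 0 < c ^ 2 * (κ * (q.1 : ℝ) ^ 2) := by positivity
  refine le_of_mul_le_mul_left (key2.trans (le_of_eq ?_)) hpos
  change _ = c ^ 2 * (κ * (q.1 : ℝ) ^ 2) * ((p : ℝ) ^ 3 / (c ^ 2 * κ) *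
    ((∑ i, ind R q.1 i q.2) / n q.1) * (W * W) * (n q.1 * ‖d‖ ^ 2) *
    (((q.1 : ℝ)⁻¹) ^ 2 * ∑ i, ‖u i‖ ^ 2))
  field_simp

end Main

theorem theorem1 {Ω : Type*} [MeasurableSpace Ω] (P : Measure Ω) [IsProbabilityMeasure P] {p : ℕ}
    -- data, expected subsample sizes, inclusion probabilities and indicators
    (X : ℕ → Ω → Vec p) (Y S : ℕ → Ω → ℝ) (n : ℕ → ℝ)
    (π : (N : ℕ) → Fin N → Ω → ℝ) (R : (N : ℕ) → Fin N → Ω → Bool)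
    (h_iid : IsIIDSample P X Y S) (h_sampling : IsPoissonSampling P X Y S n π R)
    -- compact parameter sets, the two canonical families, the model for `Y` given `X`, and the
    -- limiting parameter `γ₀` of the (possibly misspecified) working model for `S` given `X`
    (A B : Set (Vec p)) (hA : IsCompact A) (hB : IsCompact B)
    (β₀ γ₀ : Vec p) (hβ₀ : β₀ ∈ B) (hγ₀ : γ₀ ∈ A)
    (ν₁ ν₂ : Measure ℝ) (b₁ b₂ c₁ c₂ : ℝ → ℝ)
    (h_fam₁ : IsCanonicalFamily ν₁ b₁ c₁) (h_fam₂ : IsCanonicalFamily ν₂ b₂ c₂)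
    (h_glm : FollowsGLM P ν₁ b₁ c₁ β₀ (X 0) (Y 0))
    (h_pseudo : popScore P b₂ (X 0) (S 0) γ₀ = 0)
    -- the solutions of the three score equations
    (βhat γhat γfull : ℕ → Ω → Vec p)
    (h_βhat : IsEstimator P (weightedScore b₁ X Y π R) B βhat)
    (h_γhat : IsEstimator P (weightedScore b₂ X S π R) A γhat)
    (h_γfull : IsEstimator P (fullScore b₂ X S) A γfull)
    -- (i)
    (h_bdd : ((∃ C, ∀ t, |deriv (deriv b₁) t| ≤ C) ∧ (∃ C, ∀ t, |deriv (deriv b₂) t| ≤ C)) ∨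
      (∃ C, ∀ᵐ ω ∂P, ‖X 0 ω‖ ≤ C))
    -- (ii)
    (h_XX : ∀ j k, Integrable (fun ω => X 0 ω j * X 0 ω k) P)
    (h_g₁ : ∀ β ∈ B, Integrable (fun ω => (deriv b₁ (inner ℝ β (X 0 ω)) - Y 0 ω) • X 0 ω) P)
    (h_g₂ : ∀ γ ∈ A, Integrable (fun ω => (deriv b₂ (inner ℝ γ (X 0 ω)) - S 0 ω) • X 0 ω) P)
    -- (iii)
    (h_mom₁ : WeightedMoments P b₁ X Y n π B)
    (h_mom₂ : WeightedMoments P b₂ X S n π A)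
    -- (iv)
    (h_sep₁ : WellSeparated (popScore P b₁ (X 0) (Y 0)) β₀ B)
    (h_sep₂ : WellSeparated (popScore P b₂ (X 0) (S 0)) γ₀ A)
    -- (v)
    (V₁₂ V₂₂ : Matrix (Fin p) (Fin p) ℝ)
    (h_V₁₂ : Tendsto (sigma12 P b₁ b₂ X Y S n π R β₀ γ₀) atTop (𝓝 V₁₂))
    (h_V₂₂ : Tendsto (sigma22 P b₂ X S n π R γ₀) atTop (𝓝 V₂₂))
    (h_pd : V₂₂.PosDef)
    -- (vi)
    (h_X4 : Integrable (fun ω => ‖X 0 ω‖ ^ 4) P) :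
    -- with the empirical estimates of `V₁₂` and `V₂₂`
    (β₀ ∈ interior B → γ₀ ∈ interior A → Tendsto (fun N : ℕ => n N / N) atTop (𝓝 0) →
      TendstoInMeasure P
        (augmented βhat γhat γfull (empSigma12 b₁ b₂ X Y S n π R βhat γhat)
          (empSigma22 b₂ X S n π R γhat)) atTop fun _ => β₀) ∧
    -- with any consistent estimates of `V₁₂` and `V₂₂`
    (∀ M₁₂ M₂₂ : ℕ → Ω → Matrix (Fin p) (Fin p) ℝ,
      ConsistentFor P M₁₂ V₁₂ → ConsistentFor P M₂₂ V₂₂ →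
      TendstoInMeasure P (augmented βhat γhat γfull M₁₂ M₂₂) atTop fun _ => β₀) := by

  have hX := integrable_norm_sq h_XX
  have hout₁ : Measurable fun z : Vec p × ℝ × ℝ => z.2.1 := by fun_prop
  have hout₂ : Measurable fun z : Vec p × ℝ × ℝ => z.2.2 := by fun_prop
  have hbdd₁ : (∃ C, ∀ t, |deriv (deriv b₁) t| ≤ C) ∨ ∃ C, ∀ᵐ ω ∂P, ‖X 0 ω‖ ≤ C :=
    h_bdd.imp_left And.left
  have hbdd₂ : (∃ C, ∀ t, |deriv (deriv b₂) t| ≤ C) ∨ ∃ C, ∀ᵐ ω ∂P, ‖X 0 ω‖ ≤ C :=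
    h_bdd.imp_left And.right
  have eβ := eventually_meanScore_ipw_eq_zero (Y := Y) (S := S) (out := fun z => z.2.1) h_βhat
  have eγ := eventually_meanScore_ipw_eq_zero (Y := Y) (S := S) (out := fun z => z.2.2) h_γhat
  have eγ' := eventually_meanScore_unitWeight_eq_zero (Y := Y) (S := S) (out := fun z => z.2.2)
    h_γfull
  obtain ⟨hβlim, hpop₁⟩ := (goodWeights_ipw (out := fun z => z.2.1) h_iid h_sampling
    h_fam₁.continuous_deriv.measurable hout₁ hX h_g₁ h_mom₁).consistent h_iid hB
    h_fam₁.differentiable_deriv h_fam₁.continuous_deriv_deriv hbdd₁ hX h_g₁ hβ₀ h_sep₁ eβ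
  obtain ⟨hγlim, -⟩ := (goodWeights_ipw (out := fun z => z.2.2) h_iid h_sampling
    h_fam₂.continuous_deriv.measurable hout₂ hX h_g₂ h_mom₂).consistent h_iid hA
    h_fam₂.differentiable_deriv h_fam₂.continuous_deriv_deriv hbdd₂ hX h_g₂ hγ₀ h_sep₂ eγ
  obtain ⟨hγlim', -⟩ := (goodWeights_unitWeight (out := fun z => z.2.2) h_iid
    h_fam₂.continuous_deriv.measurable hout₂ hX h_g₂).consistent h_iid hA
    h_fam₂.differentiable_deriv h_fam₂.continuous_deriv_deriv hbdd₂ hX h_g₂ hγ₀ h_sep₂ eγ'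
  refine ⟨fun hβi hγi hn => ?_, fun M₁₂ M₂₂ h₁ h₂ =>
    tendstoInMeasure_augmented_of_consistent (det_ne_zero_of_posDef h_pd) hβlim hγlim hγlim' h₁ h₂⟩
  refine tendstoInMeasure_augmented hβlim ?_
  rcases eq_or_ne p 0 with rfl | hp
  · exact tendsto_const_nhds.congr fun q => Subsingleton.elim _ _
  · exact tendsto_empirical_correction hp h_iid h_sampling hA hB hβi hγi h_fam₁ h_fam₂
      (eβ.mono fun q h => h.1) eγ eγ' hβlim hγlim hbdd₂ hX h_g₂ h_mom₁ h_mom₂ h_sep₁ h_sep₂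
      hpop₁ h_pseudo h_V₂₂ h_pd hn
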